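/- Let $S$ be a smooth projective complex surface with $q(S)=h^1(\mathcal O_S)=0$, $p_g(S)=h^0(K_S)=5$ and $K_S^2=11$, such that $|K_S|$ has no base points and the canonical morphism $\pi=(x_0:\dots:x_4):S\to\mathbb P^4$, given by a basis $x_0,\dots,x_4$ of $H^0(S,K_S)$, is birational onto its image $Y$. Let $\mathcal A=\mathbb C[x_0,\dots,x_4]$ be the homogeneous coordinate ring of $\mathbb P^4$, and regard the canonical ring $\mathcal R=\bigoplus_{n\ge 0}H^0(S,nK_S)$ as a graded $\mathcal A$-module via $\pi$. Let $$0\to\mathcal A(-6)\oplus\mathcal A(-4)^2\xrightarrow{\binom{-\beta^t}{\alpha^t}}\mathcal A(-3)^6\xrightarrow{(\alpha\ \beta)}\mathcal A\oplus\mathcal A(-2)^2\to\mathcal R\to 0$$ be a graded free resolution in which the generator of the summand $\mathcal A$ maps to $1\in\mathcal R$. Thus $\alpha,\beta$ are $3\times3$ matrices whose first rows consist of cubic forms and whose other rows consist of linear forms, and $\alpha\beta^t=\beta\alpha^t$. Assume that $Y$ has exactly three singular points $P_1,P_2,P_3$, and that each of them is an improper double point of $Y$, i.e. the tangent cone of $Y$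 there is the union of two planes spanning $\mathbb P^4$. Then there are $\varphi\in GL_2(\mathbb C)$ and $M\in Sp_6(\mathbb C)$ such that $$\begin{pmatrix}1&0\\0&\varphi\end{pmatrix}(\alpha\ \beta)\,M=\left(\begin{array}{ccc|ccc}\tilde A_1&\tilde A_2&\tilde A_3&\tilde B_1&\tilde B_2&\tilde B_3\\0&\tilde a_2&\tilde a_3&0&\tilde b_2&\tilde b_3\\ \tilde a_4&-\tilde a_2&0&\tilde b_4&-\tilde b_2&0\end{array}\right)=:(\tilde\alpha\ \tilde\beta),$$ where $\tilde\alpha\tilde\beta^t=\tilde\beta\tilde\alpha^t$, the $\tilde A_j,\tilde B_j$ are cubic forms that are $\mathbb C$-linear combinations of the entries of the first row of $(\alpha\ \beta)$, the $\tilde a_i,\tilde b_i$ are linear forms, and $$V(\tilde a_2,\tilde a_3,\tilde b_2,\tilde b_3)=\{P_1\},\qquad V(\tilde a_4,\tilde a_2,\tilde b_4,\tilde b_2)=\{P_2\},\qquad V(\tilde a_4,\tilde a_3,\tilde b_4,\tilde b_3)=\{P_3\}.$$ Here "form" and "linear form" allow the zero form. -/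

import Mathlib

open CategoryTheory AlgebraicGeometry TopologicalSpace Filter Topology
open scoped LinearAlgebra.Projectivization Polynomial KaehlerDifferential

noncomputable section

/-! ## Smooth complete surfaces and their pluricanonical forms -/

/-- A smooth complete (hence projective) connected complex surface. -/
structure ComplexSurface where
  /-- the underlying scheme -/
  toScheme : Scheme.{0}
  /-- the structure morphism -/
  str : toScheme ⟶ Spec (CommRingCat.of ℂ)
  integral : IsIntegral toScheme
  proper : IsProper str
  smooth : SmoothOfRelativeDimension 2 str

namespace ComplexSurface

variable (S : ComplexSurface)

instance : IsIntegral S.toScheme := S.integral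
instance : IsProper S.str := S.proper
instance : SmoothOfRelativeDimension 2 S.str := S.smooth

/-- The field of rational functions on `S`. -/
def K : Type := S.toScheme.functionField

instance : Field S.K := inferInstanceAs (Field S.toScheme.functionField)

/-- Complex constants as global regular functions. -/
def constants : ℂ →+* Γ(S.toScheme, ⊤) :=
  ((Scheme.ΓSpecIso (CommRingCat.of ℂ)).inv ≫ S.str.appTop).hom

instance : Nonempty (⊤ : S.toScheme.Opens) := ⟨⟨genericPoint S.toScheme, trivial⟩⟩

instance : Algebra ℂ S.K :=
  RingHom.toAlgebra ((S.toScheme.germToFunctionField ⊤).hom.comp S.constants)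

/-- The local ring of `S` at the point `s`, as a subring of the function field. -/
def localRing (s : S.toScheme) : Subring S.K :=
  RingHom.range (algebraMap (S.toScheme.presheaf.stalk s) S.toScheme.functionField)

theorem algebraMap_mem_localRing (s : S.toScheme) (c : ℂ) :
    algebraMap ℂ S.K c ∈ S.localRing s :=
  ⟨S.toScheme.presheaf.germ ⊤ s trivial (S.constants c),
    Scheme.algebraMap_germ_eq_germToFunctionField (X := S.toScheme) (U := ⊤) (x := s) trivial
      (S.constants c)⟩

/-- Rational 2-forms on `S`: the one-dimensional `K`-vector space `Λ² Ω_{K/ℂ}`. -/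
abbrev RatTwoForm : Type := ⋀[S.K]^2 Ω[S.K⁄ℂ]

/-- The stalk at `s` of the canonical sheaf `Ω²_S`, inside the rational 2-forms: it is generated
over the local ring by the `df ∧ dg` with `f, g` regular at `s`. -/
def canonicalStalk (s : S.toScheme) : Submodule (S.localRing s) S.RatTwoForm :=
  Submodule.span (S.localRing s)
    {θ | ∃ f ∈ S.localRing s, ∃ g ∈ S.localRing s,
      θ = exteriorPower.ιMulti S.K 2
        ![KaehlerDifferential.D ℂ S.K f, KaehlerDifferential.D ℂ S.K g]}

/-- Fix a nonzero rational 2-form `ω`. Every rational section of `Ω²_S^{⊗ n}` is `f ω^{⊗ n}` for a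
unique rational function `f`. It is regular at `s` iff, writing `ω = g η` with `η` a generator of
the stalk of `Ω²_S` at `s` (an invertible module, as `S` is smooth), `f g ^ n` is regular at `s`. -/
def IsRegularAt (ω : S.RatTwoForm) (n : ℕ) (f : S.K) (s : S.toScheme) : Prop :=
  ∀ η : S.RatTwoForm, S.canonicalStalk s = Submodule.span (S.localRing s) {η} →
    ∀ g : S.K, ω = g • η → f * g ^ n ∈ S.localRing s

/-- `H⁰(S, n K_S)`, a global section `f ω^{⊗ n}` being represented by its coefficient `f`. -/
def pluricanonical (ω : S.RatTwoForm) (n : ℕ) : Submodule ℂ S.K where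
  carrier := {f | ∀ s, S.IsRegularAt ω n f s}
  add_mem' := by
    intro a b ha hb s η hη g hg
    rw [add_mul]
    exact add_mem (ha s η hη g hg) (hb s η hη g hg)
  zero_mem' := by
    intro s η _ g _
    rw [zero_mul]
    exact zero_mem _
  smul_mem' := by
    intro c a ha s η hη g hg
    rw [Algebra.smul_def, mul_assoc]
    exact mul_mem (S.algebraMap_mem_localRing s c) (ha s η hη g hg)

/-- The canonical ring `⨁ₙ H⁰(S, n K_S)`, as a graded subalgebra of `K[t]`: the section
`f ω^{⊗ n}` is the polynomial `f tⁿ`. -/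
def canonicalRing (ω : S.RatTwoForm) : Subalgebra ℂ S.K[X] where
  carrier := {p | ∀ n, p.coeff n ∈ S.pluricanonical ω n}
  mul_mem' := by
    intro p q hp hq n
    rw [Polynomial.coeff_mul]
    refine Submodule.sum_mem _ fun ij hij => ?_
    replace hij := Finset.HasAntidiagonal.mem_antidiagonal.mp hij
    intro s η hη g hg
    have h := mul_mem (hp ij.1 s η hη g hg) (hq ij.2 s η hη g hg)
    rw [← hij, pow_add]
    convert h using 1
    ring
  add_mem' := by
    intro p q hp hq n
    rw [Polynomial.coeff_add]
    exact add_mem (hp n) (hq n)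
  algebraMap_mem' := by
    intro c n
    rw [Polynomial.algebraMap_apply, Polynomial.coeff_C]
    split_ifs with h
    · subst h
      intro s η _ g _
      rw [pow_zero, mul_one]
      exact S.algebraMap_mem_localRing s c
    · exact zero_mem _

/-- The structure sheaf of `S` as a sheaf of abelian groups. -/
def structureSheaf : Sheaf (Opens.grothendieckTopology S.toScheme) AddCommGrpCat.{0} :=
  (sheafCompose _ (forget₂ CommRingCat RingCat ⋙ forget₂ RingCat AddCommGrpCat)).obj
    S.toScheme.sheaf

/-- Irregularity zero: `H¹(S, 𝒪_S) = 0`. -/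
def IsRegularSurface : Prop := Subsingleton (Sheaf.H.{0} S.structureSheaf 1)

/-- `K_S² = k` for a surface `S` with `K_S` nef: by asymptotic Riemann–Roch the plurigenera
`P_m = h⁰(S, m K_S)` satisfy `P_m = (K_S² / 2) m² + O(m)`. -/
def CanonicalSelfIntersection (ω : S.RatTwoForm) (k : ℝ) : Prop :=
  Tendsto (fun m : ℕ => 2 * (Module.finrank ℂ (S.pluricanonical ω m) : ℝ) / (m : ℝ) ^ 2)
    atTop (𝓝 k)

/-- `p_g(S) = 5` with a basis `x₀ ω, …, x₄ ω` of `H⁰(S, K_S)`, such that `|K_S|` has no base point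
and the canonical morphism `π = (x₀ : … : x₄) : S → ℙ⁴` is birational onto its image `Y`. -/
structure IsCanonical (ω : S.RatTwoForm) (x : Module.Basis (Fin 5) ℂ (S.pluricanonical ω 1)) :
    Prop where
  base_point_free : ∀ s : S.toScheme, ∃ i,
    S.canonicalStalk s = Submodule.span (S.localRing s) {(x i : S.K) • ω}
  birational : IntermediateField.adjoin ℂ {z : S.K | ∃ i j, z = (x i : S.K) / (x j : S.K)} = ⊤

end ComplexSurface

/-! ## Projective four-space -/

/-- The homogeneous coordinate ring `ℂ[x₀, …, x₄]` of `ℙ⁴`. -/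
abbrev CoordRing : Type := MvPolynomial (Fin 5) ℂ

/-- The set of points of `ℙ⁴(ℂ)`. -/
abbrev P4 : Type := ℙ ℂ (Fin 5 → ℂ)

/-- The set of common zeros in `ℙ⁴` of a set of forms. -/
def projZeros (E : Set CoordRing) : Set P4 :=
  {p | ∀ f ∈ E, MvPolynomial.eval p.rep f = 0}

/-- The gradient of a polynomial at a vector. -/
def gradientAt (v : Fin 5 → ℂ) (f : CoordRing) : Fin 5 → ℂ :=
  fun i => MvPolynomial.eval v (MvPolynomial.pderiv i f)

/-- Jacobian criterion: `p` is a singular point of the surface in `ℙ⁴` with homogeneous ideal `I`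
if it lies on the surface and the Jacobian matrix at `p` does not have rank `2 = 4 - 2`. -/
def IsSingularPoint (I : Ideal CoordRing) (p : P4) : Prop :=
  p ∈ projZeros (I : Set CoordRing) ∧
    Module.finrank ℂ (Submodule.span ℂ (gradientAt p.rep '' (I : Set CoordRing))) ≠ 2

/-- The polynomial `f (v + y)` in the variables `y`. -/
def shiftBy (v : Fin 5 → ℂ) (f : CoordRing) : CoordRing :=
  MvPolynomial.aeval (fun i => MvPolynomial.X i + MvPolynomial.C (v i)) f

/-- The ideal of the tangent cone at `v` of the affine cone in `ℂ⁵` with ideal `I`: it is generated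
by the lowest-degree parts of the `f (v + y)`, `f ∈ I`. For `I` homogeneous and `v` a
representative of `p ∈ ℙ⁴`, this is the preimage in `ℂ⁵` of the tangent cone at `p` of the
projective scheme of `I`, which lies in `T_p ℙ⁴ = ℂ⁵ / ℂ v` (up to scaling). -/
def tangentConeIdeal (I : Ideal CoordRing) (v : Fin 5 → ℂ) : Ideal CoordRing :=
  Ideal.span {g | ∃ f ∈ I, ∃ d : ℕ,
    (∀ k < d, MvPolynomial.homogeneousComponent k (shiftBy v f) = 0) ∧
      g = MvPolynomial.homogeneousComponent d (shiftBy v f)}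

/-- `p` is an improper double point of the projective scheme with homogeneous ideal `I`: its
tangent cone at `p` is the union of two planes through `p` which span `ℙ⁴`. Planes in `ℙ⁴` are
three-dimensional subspaces of `ℂ⁵`. -/
def IsImproperDoublePoint (I : Ideal CoordRing) (p : P4) : Prop :=
  p ∈ projZeros (I : Set CoordRing) ∧
  ∃ U W : Submodule ℂ (Fin 5 → ℂ),
    Module.finrank ℂ U = 3 ∧ Module.finrank ℂ W = 3 ∧
    p.submodule ≤ U ∧ p.submodule ≤ W ∧ U ⊔ W = ⊤ ∧
    tangentConeIdeal I p.rep =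
      MvPolynomial.vanishingIdeal ℂ ((U : Set (Fin 5 → ℂ)) ∪ (W : Set (Fin 5 → ℂ)))

/-! ## The canonical image and the resolution of the canonical ring -/

namespace ComplexSurface

variable (S : ComplexSurface) (ω : S.RatTwoForm)
  (x : Module.Basis (Fin 5) ℂ (S.pluricanonical ω 1))

/-- The homomorphism `ℂ[x₀, …, x₄] → ⨁ₙ H⁰(S, n K_S)` sending the `i`-th variable to the section
`x i` of `K_S`. It makes the canonical ring an algebra over `ℂ[x₀, …, x₄]`. -/
def coordHom : CoordRing →ₐ[ℂ] S.K[X] :=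
  MvPolynomial.aeval fun i => Polynomial.monomial 1 (x i : S.K)

/-- The homogeneous ideal of the image `Y = π(S) ⊆ ℙ⁴`: it is spanned by the forms `F` with
`F(x₀, …, x₄) = 0`. It is also the annihilator of the canonical ring. -/
def imageIdeal : Ideal CoordRing := RingHom.ker (S.coordHom ω x)

/-- With `𝒜 = ℂ[x₀, …, x₄]` and `ℛ` the canonical ring of `S`, the matrices `α`, `β` are those of
a graded free resolution

`0 → 𝒜(-6) ⊕ 𝒜(-4)² → 𝒜(-3)⁶ → 𝒜 ⊕ 𝒜(-2)² → ℛ → 0`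

of the `𝒜`-module `ℛ`, with left map `(-βᵀ ; αᵀ)`, middle map `(α β)`, and whose right map sends
the first basis vector to `1 ∈ ℛ`. -/
structure IsResolution (α β : Matrix (Fin 3) (Fin 3) CoordRing) : Prop where
  cubic_α : ∀ j, (α 0 j).IsHomogeneous 3
  cubic_β : ∀ j, (β 0 j).IsHomogeneous 3
  linear_α : ∀ i j, i ≠ 0 → (α i j).IsHomogeneous 1
  linear_β : ∀ i j, i ≠ 0 → (β i j).IsHomogeneous 1
  injective : Function.Injective
    (Matrix.mulVec (Matrix.fromRows (-β.transpose) α.transpose))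
  exact_middle : Function.Exact
    (Matrix.mulVec (Matrix.fromRows (-β.transpose) α.transpose))
    (Matrix.mulVec (Matrix.fromCols α β))
  exact_right : ∃ y₁ ∈ S.pluricanonical ω 2, ∃ y₂ ∈ S.pluricanonical ω 2,
    let ε : (Fin 3 → CoordRing) → S.K[X] := fun c =>
      S.coordHom ω x (c 0) + S.coordHom ω x (c 1) * Polynomial.monomial 2 y₁
        + S.coordHom ω x (c 2) * Polynomial.monomial 2 y₂
    Function.Exact (Matrix.mulVec (Matrix.fromCols α β)) ε ∧
      Set.range ε = (S.canonicalRing ω : Set S.K[X])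

end ComplexSurface

/-- A matrix of complex numbers as a matrix of constant polynomials. -/
def constMatrix {m n : Type} (N : Matrix m n ℂ) : Matrix m n CoordRing :=
  fun i j => MvPolynomial.C (N i j)

/-- The block matrix `(1 0 ; 0 φ)` with `φ ∈ GL₂(ℂ)`. -/
def rowBlock (φ : GL (Fin 2) ℂ) : Matrix (Fin 3) (Fin 3) ℂ :=
  !![1, 0, 0; 0, φ.1 0 0, φ.1 0 1; 0, φ.1 1 0, φ.1 1 1]

end

/-! ## Initial forms of polynomials at the origin -/

namespace MvPolynomial

section InitialForms

variable {σ τ k : Type*} [Field k]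

-- The columns of N = (α β) generate the relations between 1, y₁, y₂ in the canonical ring, and αβᵗ
-- = βαᵗ says that the rows of N are isotropic for the standard symplectic form B on a space of
-- dimension six. The normal form is a statement about the pencil of linear rows, each read as a
-- linear map ℂ⁵ → ℂ⁶.
--
-- Local input. If no row of the pencil vanished at Pᵢ, isotropy would make the ideal of Y generated
-- by two elements near Pᵢ (`exists_two_generators_of_linearIndependent`), whereas the tangent cone
-- there has too many independent quadrics (`not_locally_generated_by_two_of_improper`). So some row
-- sᵢ vanishes at Pᵢ. Moreover, near Pᵢ every linear form through Pᵢ multiplies y₁, y₂ into the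
-- coordinate ring (`exists_mul_mem_sectionConductor`). Indeed all powers of the y's have a common
-- denominator. Since polynomial rings are integrally closed, the quotients of initial forms are
-- polynomials on each plane of the tangent cone, and forms of positive degree on two planes meeting
-- only in the point glue. This needs a denominator whose initial form is nonzero on both planes.
-- The Nullstellensatz provides it once the conductor is known to be trivial at smooth points, where
-- the same approximation works with a single plane; there the tangent cone is computed from the
-- vanishing of Jacobian minors, forced by a nonzero rational 2-form.
--
-- Differentiating a relation at Pᵢ (`PresentsSections.mem_span_of_linearValue_eq`) then shows that
-- ker sᵢ is exactly the line Pᵢ and that sⱼ(Pᵢ) is not in im sᵢ for j ≠ i. Hence the three rows are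
-- pairwise independent and can be scaled so that s₃ = s₁ + s₂.
--
-- Linear algebra. For i ≠ j the alternating form B(sᵢ p, sⱼ q) on ℂ⁵ has a radical of odd dimension
-- containing Pᵢ and Pⱼ, hence of dimension at least 3. So sⱼ maps it onto the plane (im sᵢ)^⊥,
-- which is therefore orthogonal to (im sⱼ)^⊥. Each of these planes is nondegenerate, because (im
-- sᵢ)^⊥ contains sⱼ(Pᵢ), which is not in im sᵢ. Symplectic bases of the three planes give M, and
-- each sᵢ vanishes in its own pair of columns. The entries -ã₂, -b̃₂ record that s₁ + s₂ vanishes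
-- in the middle pair.

theorem mem_pow_idealOfVars_iff_homogeneousComponent (n : ℕ) (f : MvPolynomial σ k) :
    f ∈ idealOfVars σ k ^ n ↔ ∀ j < n, homogeneousComponent j f = 0 := by
  rw [mem_pow_idealOfVars_iff']
  constructor
  · intro h j hj
    ext d
    rw [coeff_homogeneousComponent]
    split_ifs with hd
    · simpa using h d (by omega)
    · simp
  · intro h d hd
    have := congrArg (coeff d) (h _ hd)
    simpa [coeff_homogeneousComponent] using this

theorem IsHomogeneous.mem_pow_idealOfVars {f : MvPolynomial σ k} {n : ℕ} (hf : f.IsHomogeneous n) :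
    f ∈ idealOfVars σ k ^ n := by
  rw [mem_pow_idealOfVars_iff_homogeneousComponent]
  intro j hj
  rw [homogeneousComponent_of_mem hf, if_neg (by omega)]

theorem homogeneousComponent_eq_zero_of_mem {f : MvPolynomial σ k} {n j : ℕ}
    (hf : f ∈ idealOfVars σ k ^ n) (hj : j < n) : homogeneousComponent j f = 0 :=
  (mem_pow_idealOfVars_iff_homogeneousComponent n f).1 hf j hj

theorem mem_pow_succ_idealOfVars_iff {f : MvPolynomial σ k} {n : ℕ}
    (hf : f ∈ idealOfVars σ k ^ n) :
    f ∈ idealOfVars σ k ^ (n + 1) ↔ homogeneousComponent n f = 0 := by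
  rw [mem_pow_idealOfVars_iff_homogeneousComponent] at hf ⊢
  constructor
  · intro h
    exact h n (by omega)
  · intro h j hj
    rcases Nat.lt_succ_iff_lt_or_eq.1 hj with h' | rfl
    · exact hf j h'
    · exact h

theorem sub_homogeneousComponent_mem {f : MvPolynomial σ k} {n : ℕ}
    (hf : f ∈ idealOfVars σ k ^ n) :
    f - homogeneousComponent n f ∈ idealOfVars σ k ^ (n + 1) := by
  have hh := (homogeneousComponent_isHomogeneous n f)
  rw [mem_pow_succ_idealOfVars_iff (sub_mem hf hh.mem_pow_idealOfVars), map_sub,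
    homogeneousComponent_eq_self hh, sub_self]

theorem homogeneousComponent_mul_of_mem {f g : MvPolynomial σ k} {a b : ℕ}
    (hf : f ∈ idealOfVars σ k ^ a) (hg : g ∈ idealOfVars σ k ^ b) :
    homogeneousComponent (a + b) (f * g) = homogeneousComponent a f * homogeneousComponent b g := by
  have hfh := (homogeneousComponent_isHomogeneous a f)
  have hgh := (homogeneousComponent_isHomogeneous b g)
  have h : f * g - homogeneousComponent a f * homogeneousComponent b g ∈
      idealOfVars σ k ^ (a + b + 1) := by
    have h1 : (f - homogeneousComponent a f) * g ∈ idealOfVars σ k ^ (a + b + 1) := by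
      have := Ideal.mul_mem_mul (sub_homogeneousComponent_mem hf) hg
      rwa [← pow_add, show a + 1 + b = a + b + 1 by ring] at this
    have h2 : homogeneousComponent a f * (g - homogeneousComponent b g) ∈
        idealOfVars σ k ^ (a + b + 1) := by
      have := Ideal.mul_mem_mul hfh.mem_pow_idealOfVars (sub_homogeneousComponent_mem hg)
      rwa [← pow_add, show a + (b + 1) = a + b + 1 by ring] at this
    convert add_mem h1 h2 using 1
    ring
  have := homogeneousComponent_eq_zero_of_mem h (Nat.lt_succ_self _)
  rw [map_sub, homogeneousComponent_eq_self (hfh.mul hgh), sub_eq_zero] at this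
  exact this

theorem homogeneousComponent_pow_of_mem {f : MvPolynomial σ k} {a : ℕ}
    (hf : f ∈ idealOfVars σ k ^ a) (n : ℕ) :
    f ^ n ∈ idealOfVars σ k ^ (n * a) ∧
      homogeneousComponent (n * a) (f ^ n) = homogeneousComponent a f ^ n := by
  have hmem : ∀ n, f ^ n ∈ idealOfVars σ k ^ (n * a) := fun n => by
    rw [mul_comm, pow_mul]
    exact Ideal.pow_mem_pow hf n
  refine ⟨hmem n, ?_⟩
  induction n with
  | zero => simp [homogeneousComponent_zero]
  | succ n ih =>
    rw [pow_succ, Nat.succ_mul, homogeneousComponent_mul_of_mem (hmem n) hf, ih, pow_succ]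

theorem homogeneousComponent_algHom (g : MvPolynomial σ k →ₐ[k] MvPolynomial τ k)
    (hg : ∀ i, (g (X i)).IsHomogeneous 1) (n : ℕ) (f : MvPolynomial σ k) :
    homogeneousComponent n (g f) = g (homogeneousComponent n f) := by
  have key : ∀ (d : ℕ) (f : MvPolynomial σ k), f.IsHomogeneous d → (g f).IsHomogeneous d := by
    intro d f hf
    have := hf.aeval (fun i => g (X i)) (n := 1) hg
    rw [one_mul] at this
    convert this using 1
    exact congrArg (fun φ : MvPolynomial σ k →ₐ[k] MvPolynomial τ k => φ f) (aeval_unique g)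
  conv_lhs => rw [← sum_homogeneousComponent f]
  rw [map_sum, map_sum]
  by_cases hn : n ≤ f.totalDegree
  · rw [Finset.sum_eq_single_of_mem n (by simpa [Nat.lt_succ_iff] using hn)]
    · exact homogeneousComponent_eq_self (key _ _ (homogeneousComponent_isHomogeneous n f))
    · intro i _ hi
      rw [homogeneousComponent_of_mem (key _ _ (homogeneousComponent_isHomogeneous i f)),
        if_neg (Ne.symm hi)]
  · rw [homogeneousComponent_eq_zero n f (by omega), map_zero]
    refine Finset.sum_eq_zero fun i hi => ?_
    rw [homogeneousComponent_of_mem (key _ _ (homogeneousComponent_isHomogeneous i f)), if_neg]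
    have := Finset.mem_range.1 hi
    omega

theorem isHomogeneous_algHom (g : MvPolynomial σ k →ₐ[k] MvPolynomial τ k)
    (hg : ∀ i, (g (X i)).IsHomogeneous 1) {n : ℕ} {f : MvPolynomial σ k} (hf : f.IsHomogeneous n) :
    (g f).IsHomogeneous n := by
  rw [← homogeneousComponent_eq_self hf, ← homogeneousComponent_algHom g hg]
  exact homogeneousComponent_isHomogeneous n _

theorem map_mem_pow_idealOfVars (g : MvPolynomial σ k →ₐ[k] MvPolynomial τ k)
    (hg : ∀ i, (g (X i)).IsHomogeneous 1) {n : ℕ} {f : MvPolynomial σ k}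
    (hf : f ∈ idealOfVars σ k ^ n) : g f ∈ idealOfVars τ k ^ n := by
  rw [mem_pow_idealOfVars_iff_homogeneousComponent] at hf ⊢
  intro j hj
  rw [homogeneousComponent_algHom g hg, hf j hj, map_zero]

theorem mem_idealOfVars_iff {f : MvPolynomial σ k} :
    f ∈ idealOfVars σ k ↔ constantCoeff f = 0 := by
  have := mem_pow_idealOfVars_iff' (σ := σ) (R := k) 1 f
  rw [pow_one] at this
  rw [this, constantCoeff_eq]
  constructor
  · intro h
    exact h 0 (by simp)
  · intro h d hd
    have : d = 0 := (Finsupp.degree_eq_zero_iff d).1 (by omega)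
    rw [this, h]

/-- Krull's intersection theorem at the origin. -/
theorem exists_mul_mem_of_forall_mem_sup_pow [Finite σ] {J : Ideal (MvPolynomial σ k)}
    {f : MvPolynomial σ k} (h : ∀ n, f ∈ J ⊔ idealOfVars σ k ^ n) :
    ∃ u : MvPolynomial σ k, constantCoeff u = 1 ∧ u * f ∈ J := by
  have := (Ideal.mem_iInf_smul_pow_eq_bot_iff (idealOfVars σ k) (M := MvPolynomial σ k ⧸ J)
    (Ideal.Quotient.mk J f)).1 (by
      rw [Submodule.mem_iInf]
      intro n
      obtain ⟨a, ha, b, hb, rfl⟩ := Submodule.mem_sup.1 (h n)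
      rw [map_add, Ideal.Quotient.eq_zero_iff_mem.2 ha, zero_add]
      have : Ideal.Quotient.mk J (b * 1) = b • Ideal.Quotient.mk J 1 := rfl
      rw [← mul_one b, this]
      exact Submodule.smul_mem_smul hb trivial)
  obtain ⟨r, hr⟩ := this
  refine ⟨1 - r, ?_, ?_⟩
  · rw [map_sub, map_one, mem_idealOfVars_iff.1 r.2, sub_zero]
  · rw [← Ideal.Quotient.eq_zero_iff_mem, sub_mul, one_mul, map_sub, sub_eq_zero]
    exact hr.symm

end InitialForms

/-- The hypothesis says that `a` is a common denominator of all powers of w / a, so w / a is almost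
integral. In a Noetherian ring this is integrality, and R is integrally closed. -/
theorem _root_.dvd_of_forall_pow_dvd_mul_pow {R : Type*} [CommRing R] [IsDomain R]
    [IsNoetherianRing R] [IsIntegrallyClosed R] {a w : R} (ha : a ≠ 0)
    (h : ∀ n : ℕ, a ^ n ∣ a * w ^ n) : a ∣ w := by
  let F := FractionRing R
  have ha' : algebraMap R F a ≠ 0 := by simpa using ha
  have hint : IsAlmostIntegral R (algebraMap R F w / algebraMap R F a) := by
    refine ⟨a, mem_nonZeroDivisors_of_ne_zero ha, fun n => ?_⟩
    obtain ⟨c, hc⟩ := h n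
    refine ⟨c, ?_⟩
    rw [Algebra.smul_def, div_pow, mul_div_assoc', eq_div_iff (pow_ne_zero _ ha'), ← map_pow,
      ← map_mul, ← map_pow, ← map_mul, hc, mul_comm]
  obtain ⟨c, hc⟩ := IsIntegrallyClosed.isIntegral_iff.1 hint.isIntegral
  refine ⟨c, ?_⟩
  rw [eq_div_iff ha', ← map_mul] at hc
  rw [← IsFractionRing.injective R F hc, mul_comm]

end MvPolynomial

/-! ## Local rings with a reduced tangent cone which is a union of linear spaces -/

namespace MvPolynomial

variable {σ k ι K : Type*} [Field k] [Field K] [Algebra k K]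

/-- The initial forms at the origin of the elements of `I` are the forms killed by all the
graded endomorphisms `π i`. -/
structure HasTangentCone (I : Ideal (MvPolynomial σ k))
    (π : ι → MvPolynomial σ k →ₐ[k] MvPolynomial σ k) : Prop where
  linear : ∀ i j, (π i (X j)).IsHomogeneous 1
  init : ∀ n, ∀ f ∈ I, f ∈ idealOfVars σ k ^ n → ∀ i, π i (homogeneousComponent n f) = 0
  lift : ∀ n, ∀ f ∈ idealOfVars σ k ^ n, (∀ i, π i (homogeneousComponent n f) = 0) →
    f ∈ I ⊔ idealOfVars σ k ^ (n + 1)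

namespace HasTangentCone

variable {π : ι → MvPolynomial σ k →ₐ[k] MvPolynomial σ k}

theorem constantCoeff_eq_zero {I : Ideal (MvPolynomial σ k)} (hI : HasTangentCone I π) [Nonempty ι]
    {f : MvPolynomial σ k} (hf : f ∈ I) : constantCoeff f = 0 := by
  have h := hI.init 0 f hf (by simp) (Classical.arbitrary ι)
  rw [homogeneousComponent_zero, ← algebraMap_eq, AlgHom.commutes, algebraMap_eq, C_eq_zero] at h
  exact h

/-- The initial form of `b` is nonzero on every component of the cone, hence a nonzerodivisor modulo
the initial ideal. So high order of b ^ N * e modulo I forces high order of `e` modulo I, gained one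
degree at a time. -/
theorem exists_sub_mem {I : Ideal (MvPolynomial σ k)} (hI : HasTangentCone I π)
    {b : MvPolynomial σ k} {β : ℕ} (hb : b ∈ idealOfVars σ k ^ β)
    (hb0 : ∀ i, π i (homogeneousComponent β b) ≠ 0) {N M : ℕ} {e s : MvPolynomial σ k}
    (hs : s ∈ idealOfVars σ k ^ M) (h : b ^ N * e - s ∈ I) (j : ℕ) (hj : N * β + j ≤ M) :
    ∃ e', e - e' ∈ I ∧ e' ∈ idealOfVars σ k ^ j := by
  induction j with
  | zero => exact ⟨e, by simp, by simp⟩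
  | succ j ih =>
    obtain ⟨e', he', hej⟩ := ih (by omega)
    have hbN := homogeneousComponent_pow_of_mem hb N
    have h' : b ^ N * e' - s ∈ I := by
      convert sub_mem h (I.mul_mem_left (b ^ N) he') using 1
      ring
    have hmem : b ^ N * e' ∈ idealOfVars σ k ^ (N * β + j) := by
      rw [pow_add]
      exact Ideal.mul_mem_mul hbN.1 hej
    have hs' : s ∈ idealOfVars σ k ^ (N * β + j) := Ideal.pow_le_pow_right (by omega) hs
    have key := hI.init _ _ h' (sub_mem hmem hs')
    rw [map_sub, homogeneousComponent_mul_of_mem hbN.1 hej, hbN.2,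
      homogeneousComponent_eq_zero_of_mem hs (by omega), sub_zero] at key
    have key' : ∀ i, π i (homogeneousComponent j e') = 0 := fun i => by
      have := key i
      rw [map_mul, map_pow] at this
      exact (mul_eq_zero.1 this).resolve_left (pow_ne_zero _ (hb0 i))
    obtain ⟨c, hc, e'', he'', hce⟩ := Submodule.mem_sup.1 (hI.lift j e' hej key')
    refine ⟨e'', ?_, he''⟩
    convert add_mem he' hc using 1
    rw [← hce]
    ring

variable {θ : MvPolynomial σ k →ₐ[k] K}

/-- The initial form of `b` divides that of `b y` on each component of the tangent cone, if all
the `b y ^ n` are regular. -/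
theorem dvd_homogeneousComponent [Finite σ] (hI : HasTangentCone (RingHom.ker θ) π)
    {b : MvPolynomial σ k} {β : ℕ} (hb : b ∈ idealOfVars σ k ^ β)
    (hb0 : ∀ i, π i (homogeneousComponent β b) ≠ 0) {y : K} (hy : ∀ n, ∃ e, θ e = θ b * y ^ n)
    {n : ℕ} {r : MvPolynomial σ k} (hr : r ∈ idealOfVars σ k ^ n) (hry : θ r = θ b * y) (i : ι) :
    π i (homogeneousComponent β b) ∣ π i (homogeneousComponent n r) := by
  refine dvd_of_forall_pow_dvd_mul_pow (hb0 i) fun N => ?_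
  obtain ⟨e, he⟩ := hy N
  have hrN := homogeneousComponent_pow_of_mem hr N
  have hbN := homogeneousComponent_pow_of_mem hb N
  have hs : b * r ^ N ∈ idealOfVars σ k ^ (β + N * n) := by
    rw [pow_add]
    exact Ideal.mul_mem_mul hb hrN.1
  have hsc : homogeneousComponent (β + N * n) (b * r ^ N) =
      homogeneousComponent β b * homogeneousComponent n r ^ N := by
    rw [homogeneousComponent_mul_of_mem hb hrN.1, hrN.2]
  -- Since e represents b y ^ N and r represents b y, both products represent b ^ (N + 1) y ^ N.
  have hmem : b ^ N * e - b * r ^ N ∈ RingHom.ker θ := by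
    rw [RingHom.mem_ker]
    simp only [map_sub, map_mul, map_pow, he, hry]
    ring
  -- If the order allows it, `e` is replaced by an element whose initial form is the quotient
  -- sought. Otherwise the left side has too high an order, and the initial form of b * r ^ N
  -- vanishes on each component.
  by_cases hle : N * β ≤ β + N * n
  · obtain ⟨j, hj⟩ := Nat.exists_eq_add_of_le hle
    obtain ⟨e', he', hej⟩ := hI.exists_sub_mem hb hb0 hs hmem j hj.ge
    have h' : b ^ N * e' - b * r ^ N ∈ RingHom.ker θ := by
      convert sub_mem hmem (Ideal.mul_mem_left _ (b ^ N) he') using 1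
      ring
    have hm : b ^ N * e' ∈ idealOfVars σ k ^ (β + N * n) := by
      rw [hj, pow_add]
      exact Ideal.mul_mem_mul hbN.1 hej
    have key := hI.init _ _ h' (sub_mem hm hs) i
    rw [map_sub, hsc, map_sub, sub_eq_zero] at key
    rw [map_mul (π i) (homogeneousComponent β b), map_pow (π i)] at key
    rw [← key, hj, homogeneousComponent_mul_of_mem hbN.1 hej, hbN.2, map_mul (π i),
      map_pow (π i)]
    exact dvd_mul_right _ _
  · have hm : b ^ N * e ∈ idealOfVars σ k ^ (N * β) := Ideal.mul_mem_right _ _ hbN.1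
    have hm' : b ^ N * e ∈ idealOfVars σ k ^ (β + N * n) :=
      Ideal.pow_le_pow_right (by omega) hm
    have key := hI.init _ _ hmem (sub_mem hm' hs) i
    rw [map_sub, hsc, homogeneousComponent_eq_zero_of_mem hm (by omega), zero_sub, map_neg,
      neg_eq_zero, map_mul, map_pow] at key
    rw [key]
    exact dvd_zero _

/-- The successive approximation step, when quotients of initial forms can be lifted. -/
theorem exists_mul_eq_of_lift [Finite σ] [Nonempty ι] (hI : HasTangentCone (RingHom.ker θ) π)
    {b : MvPolynomial σ k} {β : ℕ} (hb : b ∈ idealOfVars σ k ^ β)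
    (hb0 : ∀ i, π i (homogeneousComponent β b) ≠ 0) {y : K} (hy : ∀ n, ∃ e, θ e = θ b * y ^ n)
    {n₀ : ℕ} {r : MvPolynomial σ k} (hr : r ∈ idealOfVars σ k ^ n₀) (hry : θ r = θ b * y)
    (hlift : ∀ n ≥ n₀, ∀ q : MvPolynomial σ k, q.IsHomogeneous n →
      (∀ i, π i (homogeneousComponent β b) ∣ π i q) →
      ∃ z, b * z ∈ idealOfVars σ k ^ n ∧
        ∀ i, π i (homogeneousComponent n (b * z)) = π i q) :
    ∃ h z, constantCoeff h = 1 ∧ θ h * y = θ z := by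
  -- Here z approximates y and s represents the error multiplied by b. The hypothesis on `y` is
  -- inherited by y - z through the binomial theorem, so divisibility of initial forms applies again
  -- to s.
  have happ : ∀ n, ∃ z s, s ∈ idealOfVars σ k ^ (n₀ + n) ∧ θ s = θ b * (y - θ z) := by
    intro n
    induction n with
    | zero => exact ⟨0, r, hr, by simpa using hry⟩
    | succ n ih =>
      obtain ⟨z, s, hs, hsy⟩ := ih
      have hy' : ∀ N, ∃ e, θ e = θ b * (y - θ z) ^ N := by
        intro N
        choose e he using hy
        refine ⟨∑ m ∈ Finset.range (N + 1), e m * (-z) ^ (N - m) * (N.choose m : MvPolynomial σ k), ?_⟩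
        rw [sub_eq_add_neg, add_pow, map_sum, Finset.mul_sum]
        refine Finset.sum_congr rfl fun m _ => ?_
        simp only [map_mul, map_pow, map_neg, he, map_natCast]
        ring
      have hdvd := hI.dvd_homogeneousComponent hb hb0 hy' hs hsy
      obtain ⟨w, hw, hwq⟩ := hlift _ (Nat.le_add_right n₀ n) _
        (homogeneousComponent_isHomogeneous _ s) hdvd
      have := hI.lift (n₀ + n) (s - b * w) (sub_mem hs hw) (fun i => by
        rw [map_sub, map_sub, hwq i, sub_self])
      obtain ⟨c, hc, s', hs', hcs⟩ := Submodule.mem_sup.1 this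
      refine ⟨z + w, s', hs', ?_⟩
      have h1 : θ c = 0 := hc
      have h2 := congrArg θ hcs
      rw [map_add, h1, zero_add, map_sub, map_mul, hsy] at h2
      rw [h2, map_add]
      ring
  have hb1 : θ b ≠ 0 := by
    intro h
    exact hb0 (Classical.arbitrary ι) (hI.init β b h hb _)
  -- The approximations put r in ker θ + (b) + m ^ n for all n. Krull's theorem then puts r in ker θ
  -- + (b) after multiplication by a local unit, and cancelling b shows that y is regular.
  obtain ⟨u, hu, huJ⟩ := exists_mul_mem_of_forall_mem_sup_pow
    (J := RingHom.ker θ ⊔ Ideal.span {b}) (f := r) (by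
      intro n
      obtain ⟨z, s, hs, hsy⟩ := happ n
      have : r = (r - b * z - s) + z * b + s := by ring
      rw [this]
      refine add_mem (Ideal.mem_sup_left (add_mem (Ideal.mem_sup_left ?_) (Ideal.mem_sup_right ?_)))
        (Ideal.mem_sup_right ?_)
      · rw [RingHom.mem_ker]
        simp only [map_sub, map_mul, hsy, hry]
        ring
      · exact Ideal.mul_mem_left _ _ (Ideal.mem_span_singleton_self b)
      · exact Ideal.pow_le_pow_right (by omega) hs)
  obtain ⟨c, hc, d, hd, hcd⟩ := Submodule.mem_sup.1 huJ
  obtain ⟨z, rfl⟩ := Ideal.mem_span_singleton'.1 hd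
  refine ⟨u, z, hu, ?_⟩
  have h1 : θ c = 0 := hc
  have h2 := congrArg θ hcd
  rw [map_add, h1, zero_add, map_mul, map_mul, hry] at h2
  apply mul_left_cancel₀ hb1
  rw [mul_comm (θ b) (θ z), h2]
  ring

/-- An element outside of `ker θ` has a nonzero initial form on a tangent space. -/
theorem exists_homogeneousComponent_ne_zero [Finite σ] [Unique ι]
    (hI : HasTangentCone (RingHom.ker θ) π) {b : MvPolynomial σ k} (hb : θ b ≠ 0) :
    ∃ b' n, θ b' = θ b ∧ b' ∈ idealOfVars σ k ^ n ∧
      ∀ i, π i (homogeneousComponent n b') ≠ 0 := by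
  by_contra hcon
  push Not at hcon
  -- With a single component, an initial form vanishing on it can always be removed modulo the
  -- kernel. If this never stopped, Krull's theorem and primality of the kernel would force θ b = 0.
  have hall : ∀ n, ∃ b', θ b' = θ b ∧ b' ∈ idealOfVars σ k ^ n := by
    intro n
    induction n with
    | zero => exact ⟨b, rfl, by simp⟩
    | succ n ih =>
      obtain ⟨b', h1, h2⟩ := ih
      obtain ⟨i, hi⟩ := hcon b' n h1 h2
      obtain ⟨c, hc, s, hs, hcs⟩ := Submodule.mem_sup.1
        (hI.lift n b' h2 (fun j => by rwa [Subsingleton.elim j i]))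
      refine ⟨s, ?_, hs⟩
      have hc' : θ c = 0 := hc
      rw [← h1, ← hcs, map_add, hc', zero_add]
  obtain ⟨u, hu, huJ⟩ := exists_mul_mem_of_forall_mem_sup_pow (J := RingHom.ker θ) (f := b) (by
    intro n
    obtain ⟨b', h1, h2⟩ := hall n
    have : b = (b - b') + b' := by ring
    rw [this]
    refine add_mem (Ideal.mem_sup_left ?_) (Ideal.mem_sup_right h2)
    rw [RingHom.mem_ker, map_sub, h1, sub_self])
  rw [RingHom.mem_ker, map_mul, mul_eq_zero] at huJ
  have := hI.constantCoeff_eq_zero (f := u) (huJ.resolve_right hb)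
  rw [hu] at this
  exact one_ne_zero this

end HasTangentCone

-- Forms restricted to coordinate subspaces

theorem IsHomogeneous.homogeneousComponent_mul {a c : MvPolynomial σ k} {m : ℕ}
    (ha : a.IsHomogeneous m) (n : ℕ) :
    homogeneousComponent n (a * c) = if m ≤ n then a * homogeneousComponent (n - m) c else 0 := by
  conv_lhs => rw [← sum_homogeneousComponent c, Finset.mul_sum, map_sum]
  have h : ∀ i, homogeneousComponent n (a * homogeneousComponent i c) =
      if n = m + i then a * homogeneousComponent i c else 0 := fun i =>
    homogeneousComponent_of_mem (ha.mul (homogeneousComponent_isHomogeneous i c))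
  simp only [h]
  split_ifs with hmn
  · by_cases hn : n - m ≤ c.totalDegree
    · rw [Finset.sum_eq_single_of_mem (n - m) (by simpa [Nat.lt_succ_iff] using hn)]
      · rw [if_pos (by omega)]
      · intro i _ hi
        rw [if_neg (by omega)]
    · rw [homogeneousComponent_eq_zero _ c (by omega), mul_zero]
      refine Finset.sum_eq_zero fun i hi => ?_
      have := Finset.mem_range.1 hi
      rw [if_neg (by omega)]
  · exact Finset.sum_eq_zero fun i _ => by rw [if_neg (by omega)]

/-- The endomorphism restricting polynomials to the coordinate subspace of the variables in `s`. -/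
noncomputable def restrictVars (k : Type*) [Field k] (s : σ → Prop) [DecidablePred s] :
    MvPolynomial σ k →ₐ[k] MvPolynomial σ k :=
  aeval fun j => if s j then X j else 0

section restrictVars

variable (s t : σ → Prop) [DecidablePred s] [DecidablePred t]

@[simp] theorem restrictVars_X (j : σ) :
    restrictVars k s (X j) = if s j then X j else 0 := by
  simp [restrictVars]

theorem isHomogeneous_restrictVars_X (j : σ) : (restrictVars k s (X j)).IsHomogeneous 1 := by
  rw [restrictVars_X]
  split_ifs
  · exact isHomogeneous_X _ _
  · exact isHomogeneous_zero _ _ _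

theorem restrictVars_restrictVars (f : MvPolynomial σ k) :
    restrictVars k s (restrictVars k s f) = restrictVars k s f := by
  have : (restrictVars k s).comp (restrictVars k s) = restrictVars k s := by
    refine algHom_ext fun j => ?_
    rw [AlgHom.comp_apply, restrictVars_X]
    split_ifs with h <;> simp [h]
  exact congrArg (fun φ : MvPolynomial σ k →ₐ[k] MvPolynomial σ k => φ f) this

theorem restrictVars_restrictVars_of_disjoint (hst : ∀ j, ¬ (s j ∧ t j)) (f : MvPolynomial σ k) :
    restrictVars k s (restrictVars k t f) = C (constantCoeff f) := by
  have : (restrictVars k s).comp (restrictVars k t) =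
      (Algebra.ofId k _).comp (aeval fun _ => (0 : k)) := by
    refine algHom_ext fun j => ?_
    rw [AlgHom.comp_apply, restrictVars_X]
    split_ifs with h
    · have hs : ¬ s j := fun hs => hst j ⟨hs, h⟩
      simp [hs]
    · simp
  have h2 := congrArg (fun φ : MvPolynomial σ k →ₐ[k] MvPolynomial σ k => φ f) this
  simpa [Algebra.ofId_apply, algebraMap_eq] using h2

end restrictVars

/-- An arbitrary quotient may be restricted to the subspace and cut down to its component of degree
n - β without spoiling the product. If n < β there is no such component and the dividend is zero. -/
theorem exists_isHomogeneous_quotient {s : σ → Prop} [DecidablePred s] {b q : MvPolynomial σ k}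
    {β n : ℕ} (hb : b.IsHomogeneous β) (hq : q.IsHomogeneous n)
    (h : restrictVars k s b ∣ restrictVars k s q) :
    (n < β ∧ restrictVars k s q = 0) ∨
      β ≤ n ∧ ∃ c : MvPolynomial σ k, c.IsHomogeneous (n - β) ∧ restrictVars k s c = c ∧
        restrictVars k s b * c = restrictVars k s q := by
  have hb' := isHomogeneous_algHom _ (isHomogeneous_restrictVars_X (k := k) s) hb
  have hq' := isHomogeneous_algHom _ (isHomogeneous_restrictVars_X (k := k) s) hq
  obtain ⟨c, hc⟩ := h
  have hc1 := congrArg (restrictVars k s) hc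
  rw [map_mul, restrictVars_restrictVars, restrictVars_restrictVars] at hc1
  have hc2 := hb'.homogeneousComponent_mul (c := restrictVars k s c) n
  rw [← hc1, homogeneousComponent_eq_self hq'] at hc2
  split_ifs at hc2 with hle
  · refine Or.inr ⟨hle, _, homogeneousComponent_isHomogeneous _ _, ?_, hc2.symm⟩
    rw [← homogeneousComponent_algHom _ (isHomogeneous_restrictVars_X (k := k) s),
      restrictVars_restrictVars]
  · exact Or.inl ⟨by omega, hc2⟩

namespace HasTangentCone

variable [Finite σ] {θ : MvPolynomial σ k →ₐ[k] K}

/-- Normality at a point whose tangent cone is a linear space. -/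
theorem exists_mul_eq_of_smooth {s : σ → Prop} [DecidablePred s]
    (hI : HasTangentCone (RingHom.ker θ) (fun _ : Unit => restrictVars k s))
    {b : MvPolynomial σ k} (hb : θ b ≠ 0) {y : K} (hy : ∀ n, ∃ e, θ e = θ b * y ^ n) :
    ∃ h z, constantCoeff h = 1 ∧ θ h * y = θ z := by
  obtain ⟨b', β, hbb, hbβ, hb0⟩ := hI.exists_homogeneousComponent_ne_zero hb
  rw [← hbb] at hy
  obtain ⟨r, hr⟩ := hy 1
  rw [pow_one] at hr
  refine hI.exists_mul_eq_of_lift hbβ hb0 hy (n₀ := 0) (by simp) hr ?_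
  intro n _ q hq hdvd
  obtain ⟨_, h0⟩ | ⟨hle, c, hc, hcc, hbc⟩ :=
    exists_isHomogeneous_quotient (homogeneousComponent_isHomogeneous β b') hq (hdvd ())
  · exact ⟨0, by simp, fun _ => by simpa using h0.symm⟩
  · refine ⟨c, ?_, fun _ => ?_⟩
    · rw [← Nat.add_sub_cancel' hle, pow_add]
      exact Ideal.mul_mem_mul hbβ hc.mem_pow_idealOfVars
    · have := homogeneousComponent_mul_of_mem hbβ hc.mem_pow_idealOfVars
      rw [Nat.add_sub_cancel' hle] at this
      rw [this, map_mul, homogeneousComponent_eq_self hc, hcc, hbc]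

/-- At a point whose tangent cone is a union of two linear spaces meeting in one point, the
functions vanishing at the point multiply the normalization into the local ring. -/
theorem exists_mul_mul_eq_of_improper {s : Bool → σ → Prop} [∀ i, DecidablePred (s i)]
    (hs : ∀ j, ¬ (s false j ∧ s true j))
    (hI : HasTangentCone (RingHom.ker θ) (fun i => restrictVars k (s i)))
    {b : MvPolynomial σ k} {β : ℕ} (hb : b ∈ idealOfVars σ k ^ β)
    (hb0 : ∀ i, restrictVars k (s i) (homogeneousComponent β b) ≠ 0)
    {y : K} (hy : ∀ n, ∃ e, θ e = θ b * y ^ n) {l : MvPolynomial σ k} (hl : constantCoeff l = 0) :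
    ∃ h z, constantCoeff h = 1 ∧ θ h * (θ l * y) = θ z := by
  -- A form of degree less than β divisible by one of degree β is zero, so the representative of b y
  -- can be improved until its order is β.
  have hr : ∀ n ≤ β, ∃ r ∈ idealOfVars σ k ^ n, θ r = θ b * y := by
    intro n
    induction n with
    | zero =>
      obtain ⟨r, hr⟩ := hy 1
      exact fun _ => ⟨r, by simp, by rw [hr, pow_one]⟩
    | succ n ih =>
      intro hn
      obtain ⟨r, hr, hry⟩ := ih (by omega)
      have hdvd := hI.dvd_homogeneousComponent hb hb0 hy hr hry
      obtain ⟨c, hc, r', hr', hcr⟩ := Submodule.mem_sup.1 (hI.lift n r hr (fun i => by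
        obtain ⟨_, h0⟩ | ⟨hle, _⟩ := exists_isHomogeneous_quotient
          (homogeneousComponent_isHomogeneous β b) (homogeneousComponent_isHomogeneous n r) (hdvd i)
        · exact h0
        · omega))
      have hc' : θ c = 0 := hc
      exact ⟨r', hr', by rw [← hry, ← hcr, map_add, hc', zero_add]⟩
  obtain ⟨r, hr, hry⟩ := hr β le_rfl
  have hl' : l ∈ idealOfVars σ k := mem_idealOfVars_iff.2 hl
  -- The factor `l` raises the order to β + 1, so that all quotients of initial forms have positive
  -- degree. In degree zero, two constants on the two components need not agree and could not be
  -- glued.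
  refine hI.exists_mul_eq_of_lift hb hb0 (n₀ := β + 1) (r := r * l) ?_ ?_ ?_ ?_
  · intro n
    obtain ⟨e, he⟩ := hy n
    exact ⟨l ^ n * e, by rw [map_mul, map_pow, he]; ring⟩
  · rw [pow_succ]
    exact Ideal.mul_mem_mul hr hl'
  · rw [map_mul, hry]
    ring
  · intro n hn q hq hdvd
    have hquot : ∀ i, ∃ c : MvPolynomial σ k, c.IsHomogeneous (n - β) ∧
        restrictVars k (s i) c = c ∧
        restrictVars k (s i) (homogeneousComponent β b) * c = restrictVars k (s i) q := by
      intro i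
      obtain ⟨hlt, _⟩ | ⟨_, h⟩ := exists_isHomogeneous_quotient
        (homogeneousComponent_isHomogeneous β b) hq (hdvd i)
      · omega
      · exact h
    choose c hc hcc hbc using hquot
    have hc0 : ∀ i, constantCoeff (c i) = 0 := fun i => by
      rw [← mem_idealOfVars_iff, ← pow_one (idealOfVars σ k)]
      exact Ideal.pow_le_pow_right (by omega) (hc i).mem_pow_idealOfVars
    have hcross : ∀ i, restrictVars k (s i) (c (!i)) = 0 := by
      intro i
      rw [← hcc (!i), restrictVars_restrictVars_of_disjoint, hc0, C_0]
      intro j hj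
      cases i
      · exact hs j hj
      · exact hs j hj.symm
    have hz : (c false + c true).IsHomogeneous (n - β) := (hc false).add (hc true)
    -- The two quotients involve disjoint variables and have no constant term, so each vanishes on
    -- the other component and their sum restricts correctly to both.
    refine ⟨c false + c true, ?_, fun i => ?_⟩
    · rw [← Nat.add_sub_cancel' (show β ≤ n by omega), pow_add]
      exact Ideal.mul_mem_mul hb hz.mem_pow_idealOfVars
    · have := homogeneousComponent_mul_of_mem hb hz.mem_pow_idealOfVars
      rw [Nat.add_sub_cancel' (show β ≤ n by omega)] at this
      rw [this, map_mul, homogeneousComponent_eq_self hz, map_add, ← hbc i]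
      have h1 := hcross i
      cases i
      · simp only [Bool.not_false] at h1
        rw [h1, hcc, add_zero]
      · simp only [Bool.not_true] at h1
        rw [h1, hcc, zero_add]

end HasTangentCone

end MvPolynomial

/-! ## The Jacobian criterion on a function field of transcendence degree two -/

namespace MvPolynomial

section Jacobian

variable {σ k K : Type*} [Field k] [Field K] [Algebra k K]

theorem D_algHom_apply [Fintype σ] (θ : MvPolynomial σ k →ₐ[k] K) (f : MvPolynomial σ k) :
    KaehlerDifferential.D k K (θ f) =
      ∑ j, θ (pderiv j f) • KaehlerDifferential.D k K (θ (X j)) := by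
  classical
  induction f using MvPolynomial.induction_on with
  | C a =>
    rw [← algebraMap_eq, AlgHom.commutes, Derivation.map_algebraMap]
    simp [algebraMap_eq]
  | add f g hf hg => simp only [map_add, hf, hg, add_smul, Finset.sum_add_distrib]
  | mul_X f i hf =>
    rw [map_mul, Derivation.leibniz, hf, Finset.smul_sum, add_comm]
    simp only [Derivation.leibniz, pderiv_X, map_add, smul_eq_mul, map_mul, add_smul,
      Finset.sum_add_distrib, mul_smul]
    rw [add_comm]
    congr 1
    rw [Finset.sum_eq_single i]
    · simp
    · intro b _ hb
      simp [hb.symm]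
    · simp

/-- If there is a nonzero rational 2-form, then three relations between four generators of the
function field have linearly dependent gradients. -/
theorem det_pderiv_mem_ker (θ : MvPolynomial (Fin 4) k →ₐ[k] K)
    (hgen : IntermediateField.adjoin k (Set.range fun j => θ (X j)) = ⊤)
    {ω : ⋀[K]^2 Ω[K⁄k]} (hω : ω ≠ 0) (f : Fin 3 → MvPolynomial (Fin 4) k)
    (hf : ∀ a, θ (f a) = 0) (j : Fin 4) :
    (Matrix.of fun a b => pderiv (j.succAbove b) (f a)).det ∈ RingHom.ker θ := by
  rw [RingHom.mem_ker]
  -- If the minor were nonzero in K, the three relations between differentials could be solved by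
  -- inverting it. All differentials would then be multiples of that of the j-th generator, and
  -- there would be no nonzero 2-form.
  by_contra hdet
  set N : Matrix (Fin 3) (Fin 3) K := Matrix.of fun a b => θ (pderiv (j.succAbove b) (f a)) with hN
  have hNdet : N.det ≠ 0 := by
    convert hdet using 1
    rw [AlgHom.map_det]
    rfl
  set w := KaehlerDifferential.D k K (θ (X j)) with hw
  set L : Submodule K Ω[K⁄k] := Submodule.span K {w} with hL
  have hX : ∀ i, KaehlerDifferential.D k K (θ (X i)) ∈ L := by
    have hrel : ∀ a, ∑ b, N a b • KaehlerDifferential.D k K (θ (X (j.succAbove b))) ∈ L := by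
      intro a
      have h := D_algHom_apply θ (f a)
      rw [hf, map_zero, Fin.sum_univ_succAbove _ j] at h
      have h' : ∑ b, N a b • KaehlerDifferential.D k K (θ (X (j.succAbove b))) =
          -(θ (pderiv j (f a)) • w) := by
        rw [eq_neg_iff_add_eq_zero, add_comm]
        exact h.symm
      rw [h']
      exact neg_mem (Submodule.smul_mem _ _ (Submodule.mem_span_singleton_self w))
    intro i
    rcases Fin.eq_self_or_eq_succAbove j i with rfl | ⟨c, rfl⟩
    · exact Submodule.mem_span_singleton_self _
    · have h1 : ∑ a, N⁻¹ c a • ∑ b, N a b • KaehlerDifferential.D k K (θ (X (j.succAbove b))) =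
          KaehlerDifferential.D k K (θ (X (j.succAbove c))) := by
        simp only [Finset.smul_sum, smul_smul]
        rw [Finset.sum_comm]
        simp only [← Finset.sum_smul]
        have h2 : ∀ b, ∑ a, N⁻¹ c a * N a b = (1 : Matrix (Fin 3) (Fin 3) K) c b := fun b => by
          rw [← Matrix.nonsing_inv_mul N (isUnit_iff_ne_zero.2 hNdet), Matrix.mul_apply]
        simp only [h2, Matrix.one_apply, ite_smul, one_smul, zero_smul]
        simp
      rw [← h1]
      exact Submodule.sum_mem _ fun a _ => Submodule.smul_mem _ _ (hrel a)
  have hD : ∀ z, KaehlerDifferential.D k K z ∈ L := by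
    intro z
    have hz : z ∈ IntermediateField.adjoin k (Set.range fun j => θ (X j)) := by
      rw [hgen]
      trivial
    induction hz using IntermediateField.adjoin_induction with
    | mem x hx =>
      obtain ⟨i, rfl⟩ := hx
      exact hX i
    | algebraMap x => simp
    | add x y _ _ hx hy =>
      rw [map_add]
      exact add_mem hx hy
    | inv x _ hx =>
      rw [Derivation.leibniz_inv]
      exact Submodule.smul_mem _ _ hx
    | mul x y _ _ hx hy =>
      rw [Derivation.leibniz]
      exact add_mem (Submodule.smul_mem _ _ hy) (Submodule.smul_mem _ _ hx)
  have htop : ∀ z, z ∈ L := by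
    have : (⊤ : Submodule K Ω[K⁄k]) ≤ L := by
      rw [← KaehlerDifferential.span_range_derivation, Submodule.span_le]
      rintro _ ⟨z, rfl⟩
      exact hD z
    exact fun z => this trivial
  apply hω
  have hspan : (⊤ : Submodule K (⋀[K]^2 Ω[K⁄k])) ≤ ⊥ := by
    rw [← exteriorPower.ιMulti_span, Submodule.span_le]
    rintro _ ⟨v, rfl⟩
    obtain ⟨a, ha⟩ := Submodule.mem_span_singleton.1 (htop (v 0))
    obtain ⟨b, hb⟩ := Submodule.mem_span_singleton.1 (htop (v 1))
    have hv : v = ![a • w, b • w] := by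
      funext i
      fin_cases i
      · exact ha.symm
      · exact hb.symm
    have h0 : v 0 = a • w := ha.symm
    have : exteriorPower.ιMulti K 2 v = 0 := by
      apply AlternatingMap.map_linearDependent
      intro hli
      rw [hv, LinearIndependent.pair_iff] at hli
      by_cases hb0 : b = 0
      · exact one_ne_zero (hli 0 1 (by simp [hb0])).2
      · exact hb0 (hli b (-a) (by
          rw [smul_smul, smul_smul, ← add_smul]
          ring_nf
          exact zero_smul _ _)).1
    exact this
  exact (Submodule.mem_bot K).1 (hspan trivial)

end Jacobian

/-! ## The tangent cone at a smooth point -/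

section Smooth

variable {σ k : Type*} [Field k]

theorem homogeneousComponent_pderiv (n : ℕ) (i : σ) (f : MvPolynomial σ k) :
    homogeneousComponent n (pderiv i f) = pderiv i (homogeneousComponent (n + 1) f) := by
  ext d
  rw [coeff_homogeneousComponent, coeff_pderiv, coeff_pderiv, coeff_homogeneousComponent]
  simp

theorem pderiv_mem_pow_idealOfVars {n : ℕ} {f : MvPolynomial σ k}
    (hf : f ∈ idealOfVars σ k ^ (n + 1)) (i : σ) : pderiv i f ∈ idealOfVars σ k ^ n := by
  rw [mem_pow_idealOfVars_iff_homogeneousComponent] at hf ⊢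
  intro j hj
  rw [homogeneousComponent_pderiv, hf (j + 1) (by omega), map_zero]

/-- A monomial of positive degree contains some variable, and the exponent brought down by
differentiation is invertible in characteristic zero. -/
theorem eq_zero_of_pderiv_eq_zero [CharZero k] {n : ℕ} {f : MvPolynomial σ k}
    (hf : f.IsHomogeneous (n + 1)) (h : ∀ i, pderiv i f = 0) : f = 0 := by
  ext d
  by_cases hd : d.degree = n + 1
  · obtain ⟨i, hi⟩ : ∃ i, d i ≠ 0 := by
      by_contra hcon
      push Not at hcon
      have : d = 0 := by
        ext i
        exact hcon i
      rw [this, map_zero] at hd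
      omega
    have h1 := congrArg (coeff (d - Finsupp.single i 1)) (h i)
    have h2 : d - Finsupp.single i 1 + Finsupp.single i 1 = d := by
      classical
      ext j
      by_cases hj : j = i
      · subst hj
        simp
        omega
      · simp [Ne.symm hj]
    rw [coeff_pderiv, h2, coeff_zero, mul_eq_zero] at h1
    rw [coeff_zero]
    refine h1.resolve_right ?_
    exact Nat.cast_add_one_ne_zero _
  · rw [hf.coeff_eq_zero hd, coeff_zero]

theorem pderiv_restrictVars_of_mem (s : σ → Prop) [DecidablePred s] {i : σ} (hi : s i)
    (f : MvPolynomial σ k) :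
    pderiv i (restrictVars k s f) = restrictVars k s (pderiv i f) := by
  classical
  induction f using MvPolynomial.induction_on with
  | C a =>
    rw [← algebraMap_eq, AlgHom.commutes, algebraMap_eq, pderiv_C, map_zero]
  | add f g hf hg => simp only [map_add, hf, hg]
  | mul_X f j hf =>
    simp only [map_mul, Derivation.leibniz, hf, restrictVars_X, smul_eq_mul, map_add, pderiv_X]
    by_cases hj : j = i
    · subst hj
      simp [hi]
    · by_cases hsj : s j
      · simp [hsj, hj]
      · simp [hsj, hj]

theorem pderiv_restrictVars_of_notMem (s : σ → Prop) [DecidablePred s] {i : σ} (hi : ¬ s i)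
    (f : MvPolynomial σ k) : pderiv i (restrictVars k s f) = 0 := by
  classical
  induction f using MvPolynomial.induction_on with
  | C a =>
    rw [← algebraMap_eq, AlgHom.commutes, algebraMap_eq, pderiv_C]
  | add f g hf hg => simp only [map_add, hf, hg, add_zero]
  | mul_X f j hf =>
    simp only [map_mul, Derivation.leibniz, hf, restrictVars_X, smul_eq_mul, mul_zero, add_zero]
    split_ifs with hj
    · rw [pderiv_X_of_ne (by rintro rfl; exact hi hj), mul_zero]
    · simp

theorem mem_span_of_restrictVars_eq_zero (s : σ → Prop) [DecidablePred s]
    {f : MvPolynomial σ k} (hf : restrictVars k s f = 0) :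
    f ∈ Ideal.span (X '' {j | ¬ s j} : Set (MvPolynomial σ k)) := by
  have key : ∀ f : MvPolynomial σ k,
      f - restrictVars k s f ∈ Ideal.span (X '' {j | ¬ s j} : Set (MvPolynomial σ k)) := by
    intro f
    induction f using MvPolynomial.induction_on with
    | C a =>
      rw [← algebraMap_eq, AlgHom.commutes, sub_self]
      exact zero_mem _
    | add f g hf hg =>
      rw [map_add, add_sub_add_comm]
      exact add_mem hf hg
    | mul_X f j hf =>
      rw [map_mul, restrictVars_X]
      split_ifs with hj
      · rw [← sub_mul]
        exact Ideal.mul_mem_right _ _ hf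
      · rw [mul_zero, sub_zero]
        exact Ideal.mul_mem_left _ _ (Ideal.subset_span ⟨j, hj, rfl⟩)
  have := key f
  rwa [hf, sub_zero] at this

/-- The tangent cone at a smooth point is the tangent space. -/
theorem hasTangentCone_of_smooth [CharZero k] {I : Ideal (MvPolynomial (Fin 4) k)}
    (hI : ∀ f ∈ I, constantCoeff f = 0)
    (hdet : ∀ f : Fin 3 → MvPolynomial (Fin 4) k, (∀ a, f a ∈ I) → ∀ j : Fin 4,
      (Matrix.of fun a b => pderiv (j.succAbove b) (f a)).det ∈ I)
    {f₀ f₁ : MvPolynomial (Fin 4) k} (hf₀ : f₀ ∈ I) (hf₁ : f₁ ∈ I)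
    (h₀ : homogeneousComponent 1 f₀ = X 0) (h₁ : homogeneousComponent 1 f₁ = X 1) :
    HasTangentCone I (fun _ : Unit => restrictVars k (fun j : Fin 4 => 2 ≤ j)) := by
  set s : Fin 4 → Prop := fun j => 2 ≤ j with hs
  set m := idealOfVars (Fin 4) k with hm
  have hp : ∀ f i, f ∈ I → ∀ x, homogeneousComponent 1 f = x →
      pderiv i f - pderiv i x ∈ m := by
    intro f i hf x hx
    have hf' : f ∈ m ^ 1 := by
      rw [pow_one, hm, mem_idealOfVars_iff]
      exact hI f hf
    have := pderiv_mem_pow_idealOfVars (sub_homogeneousComponent_mem hf') i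
    rwa [hx, map_sub, pow_one] at this
  -- The gradients of f₀, f₁ are the first two unit vectors modulo m. Hence the minor of f₀, f₁, f
  -- in columns 0, 1, j, which lies in I, agrees with ∂ⱼ f up to order n + 1.
  have hdetf : ∀ n, ∀ f ∈ I, f ∈ m ^ (n + 1) → ∀ j : Fin 4, s j →
      ∃ g ∈ I, g - pderiv j f ∈ m ^ (n + 1) := by
    intro n f hf hfn j hj
    have hcol : ∃ j' : Fin 4, j'.succAbove 0 = 0 ∧ j'.succAbove 1 = 1 ∧ j'.succAbove 2 = j := by
      have : j = 2 ∨ j = 3 := by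
        have := (show (2 : Fin 4) ≤ j from hj)
        revert this
        revert j
        decide
      rcases this with rfl | rfl
      · exact ⟨3, by decide, by decide, by decide⟩
      · exact ⟨2, by decide, by decide, by decide⟩
    obtain ⟨j', e0, e1, e2⟩ := hcol
    refine ⟨_, hdet ![f₀, f₁, f] (by
      intro a
      fin_cases a
      · exact hf₀
      · exact hf₁
      · exact hf) j', ?_⟩
    rw [Matrix.det_fin_three]
    simp only [Matrix.of_apply, e0, e1, e2, Matrix.cons_val_zero, Matrix.cons_val_one,
      Matrix.cons_val]
    have j0 : j ≠ 0 := by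
      rintro rfl
      revert hj
      decide
    have j1 : j ≠ 1 := by
      rintro rfl
      revert hj
      decide
    have a00 := hp f₀ 0 hf₀ _ h₀
    have a01 := hp f₀ 1 hf₀ _ h₀
    have a0j := hp f₀ j hf₀ _ h₀
    have a10 := hp f₁ 0 hf₁ _ h₁
    have a11 := hp f₁ 1 hf₁ _ h₁
    have a1j := hp f₁ j hf₁ _ h₁
    rw [pderiv_X_self] at a00 a11
    rw [pderiv_X_of_ne (by decide), sub_zero] at a01 a10
    rw [pderiv_X_of_ne (Ne.symm j0), sub_zero] at a0j
    rw [pderiv_X_of_ne (Ne.symm j1), sub_zero] at a1j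
    have hmul : ∀ a c, a ∈ m → c ∈ m ^ n → a * c ∈ m ^ (n + 1) := fun a c ha hc => by
      rw [pow_succ']
      exact Ideal.mul_mem_mul ha hc
    have d := fun i => pderiv_mem_pow_idealOfVars hfn i
    -- Every term of the determinant other than ∂ⱼ f is a product of a factor in m and a derivative
    -- of f in m ^ n.
    have key := add_mem (add_mem (add_mem
      (hmul _ _ (add_mem a00 (m.mul_mem_left (pderiv 0 f₀) a11)) (d j))
      (hmul _ _ (m.mul_mem_left (-pderiv 0 f₀) a1j) (d 1)))
      (hmul _ _ (m.mul_mem_left (-pderiv 1 f₀) a10) (d j)))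
      (add_mem (hmul _ _ (m.mul_mem_left (pderiv 1 f₀) a1j) (d 0))
      (add_mem (hmul _ _ (m.mul_mem_left (pderiv j f₀) a10) (d 1))
      (hmul _ _ (m.mul_mem_right (-pderiv 1 f₁) a0j) (d 0))))
    convert key using 1
    ring
  -- Induction on the order: the tangential derivatives of the initial form are initial parts of the
  -- minors, which lie in I and have smaller order. A restricted form with zero derivatives is zero.
  have hinit : ∀ n, ∀ f ∈ I, f ∈ m ^ n → restrictVars k s (homogeneousComponent n f) = 0 := by
    intro n
    induction n with
    | zero =>
      intro f hf _
      have h0 := hI f hf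
      rw [constantCoeff_eq] at h0
      rw [homogeneousComponent_zero, h0, C_0, map_zero]
    | succ n ih =>
      intro f hf hfn
      refine eq_zero_of_pderiv_eq_zero (n := n) (isHomogeneous_algHom _
        (isHomogeneous_restrictVars_X s) (homogeneousComponent_isHomogeneous _ _)) fun j => ?_
      by_cases hj : s j
      · obtain ⟨g, hg, hgf⟩ := hdetf n f hf hfn j hj
        have hd := pderiv_mem_pow_idealOfVars hfn j
        have hgn : g ∈ m ^ n := by
          have := add_mem (Ideal.pow_le_pow_right (Nat.le_succ n) hgf) hd
          rwa [sub_add_cancel] at this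
        have h1 := ih g hg hgn
        have h2 := homogeneousComponent_eq_zero_of_mem hgf (Nat.lt_succ_self n)
        rw [map_sub, sub_eq_zero] at h2
        rw [pderiv_restrictVars_of_mem s hj, ← homogeneousComponent_pderiv, ← h2, h1]
      · exact pderiv_restrictVars_of_notMem s hj _
  refine ⟨fun _ j => isHomogeneous_restrictVars_X s j, fun n f hf hfn _ => hinit n f hf hfn, ?_⟩
  intro n f hfn hf
  have hspan := mem_span_of_restrictVars_eq_zero s (hf ())
  have hset : (X '' {j | ¬ s j} : Set (MvPolynomial (Fin 4) k)) = {X 0, X 1} := by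
    have : {j : Fin 4 | ¬ s j} = {0, 1} := by
      ext j
      revert j
      decide
    rw [this, Set.image_pair]
  rw [hset, Ideal.mem_span_pair] at hspan
  obtain ⟨a, b, hab⟩ := hspan
  -- The initial form lies in (X 0, X 1), with coefficients that may be taken homogeneous of degree
  -- n - 1. Replacing X 0, X 1 by f₀, f₁ changes it only in order n + 1.
  have hF := homogeneousComponent_eq_self (homogeneousComponent_isHomogeneous n f)
  rw [← hab, map_add, mul_comm a, mul_comm b, (isHomogeneous_X k 0).homogeneousComponent_mul,
    (isHomogeneous_X k 1).homogeneousComponent_mul, mul_comm _ a, mul_comm _ b, hab] at hF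
  split_ifs at hF with hn
  · set a' := homogeneousComponent (n - 1) a
    set b' := homogeneousComponent (n - 1) b
    have ha' : a' ∈ m ^ (n - 1) := (homogeneousComponent_isHomogeneous _ _).mem_pow_idealOfVars
    have hb' : b' ∈ m ^ (n - 1) := (homogeneousComponent_isHomogeneous _ _).mem_pow_idealOfVars
    have hl : ∀ g ∈ I, ∀ x, homogeneousComponent 1 g = x → g - x ∈ m ^ 2 := by
      intro g hg x hx
      have hf' : g ∈ m ^ 1 := by
        rw [pow_one, hm, mem_idealOfVars_iff]
        exact hI g hg
      rw [← hx]
      exact sub_homogeneousComponent_mem hf'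
    have hnn : n - 1 + 2 = n + 1 := by omega
    have h3 : a' * (f₀ - X 0) + b' * (f₁ - X 1) ∈ m ^ (n + 1) := by
      rw [← hnn, pow_add]
      exact add_mem (Ideal.mul_mem_mul ha' (hl f₀ hf₀ _ h₀))
        (Ideal.mul_mem_mul hb' (hl f₁ hf₁ _ h₁))
    have : f = (a' * f₀ + b' * f₁) + ((f - homogeneousComponent n f) -
        (a' * (f₀ - X 0) + b' * (f₁ - X 1))) := by
      rw [← hF]
      ring
    rw [this]
    exact add_mem (Ideal.mem_sup_left (add_mem (I.mul_mem_left _ hf₀) (I.mul_mem_left _ hf₁)))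
      (Ideal.mem_sup_right (sub_mem (sub_homogeneousComponent_mem hfn) h3))
  · refine Ideal.mem_sup_right ((mem_pow_succ_idealOfVars_iff hfn).2 ?_)
    rw [← hF, add_zero]

end Smooth

end MvPolynomial

/-! ## Affine charts of a projective variety given by rational functions -/

section Chart

open MvPolynomial

variable {K : Type*} [Field K] [Algebra ℂ K] (x : Fin 5 → K)

/-- The homomorphism from the coordinate ring of `ℙ⁴` sending the `i`-th variable to `x i * t`. -/
noncomputable def gradedHom : CoordRing →ₐ[ℂ] K[X] :=
  aeval fun i => Polynomial.monomial 1 (x i)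

theorem coeff_gradedHom (f : CoordRing) (n : ℕ) :
    (gradedHom x f).coeff n = aeval x (homogeneousComponent n f) := by
  induction f using MvPolynomial.induction_on' with
  | add p q hp hq => simp only [map_add, Polynomial.coeff_add, hp, hq]
  | monomial d a =>
    have h1 : gradedHom x (monomial d a) =
        Polynomial.monomial d.degree (aeval x (monomial d a)) := by
      rw [gradedHom, aeval_monomial, aeval_monomial, Finsupp.prod, Finsupp.prod,
        Polynomial.algebraMap_apply]
      have : ∀ s : Finset (Fin 5), ∏ i ∈ s, Polynomial.monomial 1 (x i) ^ d i =
          Polynomial.monomial (∑ i ∈ s, d i) (∏ i ∈ s, x i ^ d i) := by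
        intro s
        induction s using Finset.induction_on with
        | empty => simp
        | insert i s hi ih =>
          rw [Finset.prod_insert hi, Finset.prod_insert hi, Finset.sum_insert hi, ih,
            Polynomial.monomial_pow, one_mul, Polynomial.monomial_mul_monomial]
      rw [this, Polynomial.C_mul_monomial]
      rfl
    rw [h1, Polynomial.coeff_monomial,
      homogeneousComponent_of_mem (isHomogeneous_monomial a rfl)]
    split_ifs with h2 h3 h3
    · rfl
    · exact absurd h2.symm h3
    · exact absurd h3.symm h2
    · rw [map_zero]

theorem gradedHom_of_isHomogeneous {f : CoordRing} {d : ℕ} (hf : f.IsHomogeneous d) :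
    gradedHom x f = Polynomial.monomial d (aeval x f) := by
  ext n
  rw [coeff_gradedHom, homogeneousComponent_of_mem hf, Polynomial.coeff_monomial]
  split_ifs with h1 h2 h2
  · rfl
  · exact absurd h1.symm h2
  · exact absurd h2.symm h1
  · rw [map_zero]

theorem gradedHom_homogeneousComponent_eq_zero {f : CoordRing} (hf : gradedHom x f = 0) (n : ℕ) :
    gradedHom x (homogeneousComponent n f) = 0 := by
  rw [gradedHom_of_isHomogeneous x (homogeneousComponent_isHomogeneous n f), ← coeff_gradedHom, hf]
  simp

-- The affine chart attached to a basis of ℂ⁵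

variable (e : Module.Basis (Fin 5) ℂ (Fin 5 → ℂ))

/-- The linear forms of the basis dual to `e`. -/
noncomputable def dualForm (j : Fin 5) : CoordRing :=
  ∑ i, C (e.coord j (Pi.single i 1)) * X i

theorem isHomogeneous_dualForm (j : Fin 5) : (dualForm e j).IsHomogeneous 1 :=
  IsHomogeneous.sum _ _ _ fun i _ => isHomogeneous_C_mul_X _ i

theorem eval_dualForm (j : Fin 5) (u : Fin 5 → ℂ) : eval u (dualForm e j) = e.coord j u := by
  conv_rhs => rw [← Finset.univ_sum_single u, map_sum]
  rw [dualForm, map_sum]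
  refine Finset.sum_congr rfl fun i _ => ?_
  rw [map_mul, eval_C, eval_X]
  have : (Pi.single i (u i) : Fin 5 → ℂ) = u i • Pi.single i 1 := by
    rw [← Pi.single_smul', smul_eq_mul, mul_one]
  rw [this, map_smul, smul_eq_mul, mul_comm]

theorem dualForm_ne_zero (j : Fin 5) : dualForm e j ≠ 0 := by
  intro h
  have := eval_dualForm e j (e j)
  rw [h] at this
  simp at this

/-- Restriction to the affine chart with origin `e 0` and coordinate directions
`e 1, …, e 4`. -/
noncomputable def chart : CoordRing →ₐ[ℂ] MvPolynomial (Fin 4) ℂ :=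
  aeval fun i => C (e 0 i) + ∑ j : Fin 4, C (e j.succ i) * X j

theorem eval_chart (u : Fin 4 → ℂ) (f : CoordRing) :
    eval u (chart e f) = eval (e 0 + ∑ j : Fin 4, u j • e j.succ) f := by
  have : ((aeval u : MvPolynomial (Fin 4) ℂ →ₐ[ℂ] ℂ).comp (chart e)) =
      aeval (e 0 + ∑ j : Fin 4, u j • e j.succ) := by
    refine algHom_ext fun i => ?_
    rw [AlgHom.comp_apply, chart, aeval_X, aeval_X]
    simp [mul_comm]
  have h := congrArg (fun φ : CoordRing →ₐ[ℂ] ℂ => φ f) this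
  simpa [aeval_eq_eval] using h

theorem constantCoeff_chart (f : CoordRing) : constantCoeff (chart e f) = eval (e 0) f := by
  have := eval_chart e 0 f
  rw [← eval_zero, this]
  simp

theorem chart_eq_iff {f : CoordRing} {g : MvPolynomial (Fin 4) ℂ}
    (h : ∀ u : Fin 4 → ℂ, eval (e 0 + ∑ j : Fin 4, u j • e j.succ) f = eval u g) :
    chart e f = g :=
  MvPolynomial.funext fun u => by rw [eval_chart, h]

theorem coord_chart_point (u : Fin 4 → ℂ) (j : Fin 5) :
    e.coord j (e 0 + ∑ j : Fin 4, u j • e j.succ) = (Fin.cons 1 u : Fin 5 → ℂ) j := by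
  have : e 0 + ∑ j : Fin 4, u j • e j.succ = ∑ i, (Fin.cons 1 u : Fin 5 → ℂ) i • e i := by
    rw [Fin.sum_univ_succ (n := 4)]
    simp only [Fin.cons_zero, one_smul, Fin.cons_succ]
  rw [this, Module.Basis.coord_apply, e.repr_sum_self]

theorem chart_dualForm_zero : chart e (dualForm e 0) = 1 := by
  refine chart_eq_iff e fun u => ?_
  rw [eval_dualForm, coord_chart_point]
  simp

theorem chart_dualForm_succ (j : Fin 4) : chart e (dualForm e j.succ) = X j := by
  refine chart_eq_iff e fun u => ?_
  rw [eval_dualForm, coord_chart_point]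
  simp

/-- The forms on `ℙ⁴` which are polynomials in the coordinates of the affine chart. -/
noncomputable def chartLift : MvPolynomial (Fin 4) ℂ →ₐ[ℂ] CoordRing :=
  aeval fun j => dualForm e j.succ

theorem isHomogeneous_chartLift {f : MvPolynomial (Fin 4) ℂ} {n : ℕ} (hf : f.IsHomogeneous n) :
    (chartLift e f).IsHomogeneous n :=
  isHomogeneous_algHom _ (fun i => by
    rw [chartLift, aeval_X]
    exact isHomogeneous_dualForm e _) hf

theorem chart_chartLift (f : MvPolynomial (Fin 4) ℂ) : chart e (chartLift e f) = f := by
  have : (chart e).comp (chartLift e) = AlgHom.id ℂ _ := by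
    refine algHom_ext fun j => ?_
    rw [AlgHom.comp_apply, chartLift, aeval_X, chart_dualForm_succ, AlgHom.id_apply]
  exact congrArg (fun φ : MvPolynomial (Fin 4) ℂ →ₐ[ℂ] MvPolynomial (Fin 4) ℂ => φ f) this

theorem eval_chartLift (f : MvPolynomial (Fin 4) ℂ) (u : Fin 5 → ℂ) :
    eval u (chartLift e f) = eval (fun j : Fin 4 => e.coord j.succ u) f := by
  have : ((aeval u : CoordRing →ₐ[ℂ] ℂ).comp (chartLift e)) =
      aeval (fun j : Fin 4 => e.coord j.succ u) := by
    refine algHom_ext fun i => ?_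
    rw [AlgHom.comp_apply, chartLift, aeval_X, aeval_X, aeval_eq_eval]
    exact eval_dualForm e _ u
  have h := congrArg (fun φ : MvPolynomial (Fin 4) ℂ →ₐ[ℂ] ℂ => φ f) this
  simpa [aeval_eq_eval] using h

/-- The form of degree `d` which restricts to the polynomial `f` on the affine chart. -/
noncomputable def homogenization (d : ℕ) (f : MvPolynomial (Fin 4) ℂ) : CoordRing :=
  ∑ j ∈ Finset.range (d + 1), dualForm e 0 ^ (d - j) * chartLift e (homogeneousComponent j f)

theorem isHomogeneous_homogenization (d : ℕ) (f : MvPolynomial (Fin 4) ℂ) :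
    (homogenization e d f).IsHomogeneous d := by
  refine IsHomogeneous.sum _ _ _ fun j hj => ?_
  have h1 := ((isHomogeneous_dualForm e 0).pow (d - j)).mul
    (isHomogeneous_chartLift e (homogeneousComponent_isHomogeneous j f))
  have : 1 * (d - j) + j = d := by
    have := Finset.mem_range.1 hj
    omega
  rwa [this] at h1

theorem chart_homogenization {d : ℕ} {f : MvPolynomial (Fin 4) ℂ} (hd : f.totalDegree ≤ d) :
    chart e (homogenization e d f) = f := by
  simp only [homogenization, map_sum, map_mul, map_pow, chart_dualForm_zero, one_pow, one_mul,
    chart_chartLift]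
  conv_rhs => rw [← sum_homogeneousComponent f]
  refine (Finset.sum_subset (by simpa using hd) fun i _ hi => ?_).symm
  rw [Finset.mem_range] at hi
  exact homogeneousComponent_eq_zero _ _ (by omega)

/-- The rational function given by the linear form `dualForm e j`. -/
noncomputable def dualCoord (j : Fin 5) : K := aeval x (dualForm e j)

theorem dualCoord_eq (j : Fin 5) : dualCoord x e j = ∑ i, e.coord j (Pi.single i 1) • x i := by
  simp [dualCoord, dualForm, Algebra.smul_def]

theorem sum_smul_dualCoord (i : Fin 5) : ∑ j, e j i • dualCoord x e j = x i := by
  simp only [dualCoord_eq, Finset.smul_sum, smul_smul]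
  rw [Finset.sum_comm]
  simp only [← Finset.sum_smul]
  have h : ∀ i', ∑ j, e j i * e.coord j (Pi.single i' 1) = (Pi.single i' (1 : ℂ) : Fin 5 → ℂ) i := by
    intro i'
    have := congrFun (e.sum_repr (Pi.single i' 1)) i
    rw [Finset.sum_apply] at this
    rw [← this]
    refine Finset.sum_congr rfl fun j _ => ?_
    rw [Pi.smul_apply, smul_eq_mul, mul_comm]
    rfl
  simp only [h, Pi.single_apply, ite_smul, one_smul, zero_smul]
  simp

theorem dualCoord_ne_zero (hx : LinearIndependent ℂ x) (j : Fin 5) : dualCoord x e j ≠ 0 := by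
  intro h
  rw [dualCoord_eq] at h
  have h0 := Fintype.linearIndependent_iff.1 hx _ h
  apply dualForm_ne_zero e j
  simp [dualForm, h0]

/-- The homomorphism from the ring of the affine chart to the field of rational functions. -/
noncomputable def chartHom : MvPolynomial (Fin 4) ℂ →ₐ[ℂ] K :=
  aeval fun j => dualCoord x e j.succ / dualCoord x e 0

/-- Evaluation of a section of degree `n` as a rational function on the affine chart. -/
noncomputable def dehomogenize : K[X] →ₐ[ℂ] K :=
  (Polynomial.aeval (dualCoord x e 0)⁻¹ : K[X] →ₐ[K] K).restrictScalars ℂ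

theorem dehomogenize_monomial (n : ℕ) (a : K) :
    dehomogenize x e (Polynomial.monomial n a) = a / dualCoord x e 0 ^ n := by
  simp [dehomogenize, Polynomial.aeval_monomial, div_eq_mul_inv]

variable {x}

theorem dehomogenize_gradedHom (hx : LinearIndependent ℂ x) (f : CoordRing) :
    dehomogenize x e (gradedHom x f) = chartHom x e (chart e f) := by
  have : (dehomogenize x e).comp (gradedHom x) = (chartHom x e).comp (chart e) := by
    refine algHom_ext fun i => ?_
    have h0 := dualCoord_ne_zero x e hx 0
    rw [AlgHom.comp_apply, AlgHom.comp_apply, gradedHom, aeval_X, dehomogenize_monomial, chart,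
      aeval_X, pow_one, div_eq_iff h0, ← sum_smul_dualCoord x e i, Fin.sum_univ_succ]
    simp only [map_add, map_sum, map_mul, algHom_C, chartHom, aeval_X, add_mul, Finset.sum_mul,
      Algebra.smul_def]
    congr 1
    refine Finset.sum_congr rfl fun j _ => ?_
    field_simp
  exact congrArg (fun φ : CoordRing →ₐ[ℂ] K => φ f) this

theorem aeval_eq_chartHom_mul (hx : LinearIndependent ℂ x) {f : CoordRing} {d : ℕ} (hf : f.IsHomogeneous d) :
    aeval x f = chartHom x e (chart e f) * dualCoord x e 0 ^ d := by
  rw [← dehomogenize_gradedHom e hx, gradedHom_of_isHomogeneous x hf, dehomogenize_monomial,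
    div_mul_cancel₀ _ (pow_ne_zero _ (dualCoord_ne_zero x e hx 0))]

theorem chart_mem_ker (hx : LinearIndependent ℂ x) {f : CoordRing} (hf : gradedHom x f = 0) :
    chart e f ∈ RingHom.ker (chartHom x e) := by
  rw [RingHom.mem_ker, ← dehomogenize_gradedHom e hx, hf, map_zero]

theorem homogenization_mem_ker (hx : LinearIndependent ℂ x) {f : MvPolynomial (Fin 4) ℂ}
    (hf : chartHom x e f = 0) {d : ℕ}
    (hd : f.totalDegree ≤ d) : gradedHom x (homogenization e d f) = 0 := by
  rw [gradedHom_of_isHomogeneous x (isHomogeneous_homogenization e d f),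
    aeval_eq_chartHom_mul e hx (isHomogeneous_homogenization e d f),
    chart_homogenization e hd, hf, zero_mul, map_zero]

/-- Regularity of a rational function on the affine chart, in terms of forms. -/
theorem exists_form_mul_eq (hx : LinearIndependent ℂ x)
    {y : K} {h z : MvPolynomial (Fin 4) ℂ} {p : CoordRing} {c : ℕ}
    (hp : p.IsHomogeneous c)
    (hyz : chartHom x e h * (chartHom x e (chart e p) * (y / dualCoord x e 0 ^ 2)) =
      chartHom x e z) :
    ∃ H : CoordRing, (∃ d, H.IsHomogeneous d) ∧ eval (e 0) H = constantCoeff h ∧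
      gradedHom x (H * p) * Polynomial.monomial 2 y ∈ (gradedHom x).range := by
  set d := max h.totalDegree z.totalDegree
  have hhd : h.totalDegree ≤ d := le_max_left _ _
  -- The degree d + c + 2 is that of h, p and the degree-two section y together; d is large enough
  -- to homogenize both h and z.
  have hzd : z.totalDegree ≤ d + c + 2 := (le_max_right h.totalDegree _).trans (by omega)
  refine ⟨homogenization e d h, ⟨d, isHomogeneous_homogenization e d h⟩, ?_,
    homogenization e (d + c + 2) z, ?_⟩
  · rw [← constantCoeff_chart, chart_homogenization e hhd]
  · have h1 := (isHomogeneous_homogenization e d h).mul hp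
    have h2 := isHomogeneous_homogenization e (d + c + 2) z
    have h0 := dualCoord_ne_zero x e hx 0
    change gradedHom x _ = _
    rw [gradedHom_of_isHomogeneous x h1, gradedHom_of_isHomogeneous x h2,
      Polynomial.monomial_mul_monomial, aeval_eq_chartHom_mul e hx h1,
      aeval_eq_chartHom_mul e hx h2, map_mul (chart e),
      map_mul (chartHom x e), chart_homogenization e hhd, chart_homogenization e hzd, ← hyz]
    congr 1
    field_simp
    ring

theorem adjoin_range_chartHom (hx : LinearIndependent ℂ x)
    (hbir : IntermediateField.adjoin ℂ {z : K | ∃ i j, z = x i / x j} = ⊤) :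
    IntermediateField.adjoin ℂ (Set.range fun j => chartHom x e (X j)) = ⊤ := by
  rw [eq_top_iff, ← hbir, IntermediateField.adjoin_le_iff]
  have h : ∀ i, x i / dualCoord x e 0 ∈
      IntermediateField.adjoin ℂ (Set.range fun j => chartHom x e (X j)) := by
    intro i
    have h1 := dehomogenize_gradedHom e hx (X i)
    rw [gradedHom, aeval_X, dehomogenize_monomial, pow_one] at h1
    rw [h1, chart, aeval_X]
    simp only [map_add, map_sum, map_mul, algHom_C]
    refine add_mem (algebraMap_mem _ _) (sum_mem fun j _ => mul_mem (algebraMap_mem _ _) ?_)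
    exact IntermediateField.subset_adjoin _ _ ⟨j, rfl⟩
  rintro _ ⟨i, j, rfl⟩
  have h0 := dualCoord_ne_zero x e hx 0
  rw [← div_div_div_cancel_right₀ h0]
  exact div_mem (h i) (h j)

end Chart

/-! ## The conductor -/

section Conductor

open MvPolynomial

variable {K : Type*} [Field K] [Algebra ℂ K] {x : Fin 5 → K} {y : Fin 2 → K}

/-- The forms multiplying the sections `y 0`, `y 1` of degree two into the image of the
homogeneous coordinate ring. -/
noncomputable def sectionConductor (x : Fin 5 → K) (y : Fin 2 → K) : Ideal CoordRing where
  carrier := {h | ∀ i, gradedHom x h * Polynomial.monomial 2 (y i) ∈ (gradedHom x).range}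
  add_mem' {a b} ha hb i := by
    rw [map_add, add_mul]
    exact add_mem (ha i) (hb i)
  zero_mem' i := by
    rw [map_zero, zero_mul]
    exact zero_mem _
  smul_mem' c a ha i := by
    rw [smul_eq_mul, map_mul, mul_assoc]
    exact mul_mem ⟨c, rfl⟩ (ha i)

/-- The powers of `y 0`, `y 1` lie in the module generated by `1, y 0, y 1`. -/
def PowersGenerated (x : Fin 5 → K) (y : Fin 2 → K) : Prop :=
  ∀ i n, ∃ c : Fin 3 → CoordRing, Polynomial.monomial 2 (y i) ^ n =
    gradedHom x (c 0) + gradedHom x (c 1) * Polynomial.monomial 2 (y 0) +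
      gradedHom x (c 2) * Polynomial.monomial 2 (y 1)

/-- A conductor element carries the whole module generated by 1, y 0, y 1 into the coordinate ring,
and all powers of y i lie in this module. So one denominator serves all powers, which is the
integrality input of the tangent cone argument. -/
theorem PowersGenerated.exists_chartHom_eq (hy : PowersGenerated x y)
    (e : Module.Basis (Fin 5) ℂ (Fin 5 → ℂ)) (hx : LinearIndependent ℂ x)
    {b : CoordRing} (hb : b ∈ sectionConductor x y) (i : Fin 2) (n : ℕ) :
    ∃ E, chartHom x e E = chartHom x e (chart e b) * (y i / dualCoord x e 0 ^ 2) ^ n := by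
  obtain ⟨c, hc⟩ := hy i n
  obtain ⟨b₀, hb₀⟩ := hb 0
  obtain ⟨b₁, hb₁⟩ := hb 1
  have hb₀' : gradedHom x b₀ = gradedHom x b * Polynomial.monomial 2 (y 0) := hb₀
  have hb₁' : gradedHom x b₁ = gradedHom x b * Polynomial.monomial 2 (y 1) := hb₁
  have key : gradedHom x (b * c 0 + c 1 * b₀ + c 2 * b₁) =
      gradedHom x b * Polynomial.monomial 2 (y i) ^ n := by
    rw [hc]
    simp only [map_add, map_mul, hb₀', hb₁']
    ring
  refine ⟨chart e (b * c 0 + c 1 * b₀ + c 2 * b₁), ?_⟩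
  rw [← dehomogenize_gradedHom e hx, key, map_mul, map_pow, dehomogenize_monomial,
    dehomogenize_gradedHom e hx]

/-- Fractions of forms of equal degree are closed under the field operations and contain the
generators x i / x j. -/
theorem exists_eq_aeval_div_aeval (hx : LinearIndependent ℂ x)
    (hbir : IntermediateField.adjoin ℂ {z : K | ∃ i j, z = x i / x j} = ⊤) (z : K) :
    ∃ (F G : CoordRing) (d : ℕ), F.IsHomogeneous d ∧ G.IsHomogeneous d ∧ aeval x G ≠ 0 ∧
      z = aeval x F / aeval x G := by
  have hz : z ∈ IntermediateField.adjoin ℂ {z : K | ∃ i j, z = x i / x j} := by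
    rw [hbir]
    trivial
  induction hz using IntermediateField.adjoin_induction with
  | mem z hz =>
    obtain ⟨i, j, rfl⟩ := hz
    exact ⟨X i, X j, 1, isHomogeneous_X _ _, isHomogeneous_X _ _, by simpa using hx.ne_zero j,
      by simp⟩
  | algebraMap c =>
    exact ⟨C c, 1, 0, isHomogeneous_C _ _, isHomogeneous_one _ _, by simp, by simp⟩
  | add z w _ _ hz hw =>
    obtain ⟨F, G, d, hF, hG, h0, rfl⟩ := hz
    obtain ⟨F', G', d', hF', hG', h0', rfl⟩ := hw
    refine ⟨F * G' + G * F', G * G', d + d', (hF.mul hG').add (hG.mul hF'), hG.mul hG', ?_, ?_⟩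
    · rw [map_mul]
      exact mul_ne_zero h0 h0'
    · simp only [map_add, map_mul]
      rw [div_add_div _ _ h0 h0']
  | inv z _ hz =>
    obtain ⟨F, G, d, hF, hG, h0, rfl⟩ := hz
    by_cases hF0 : aeval x F = 0
    · exact ⟨0, G, d, isHomogeneous_zero _ _ _, hG, h0, by simp [hF0]⟩
    · exact ⟨G, F, d, hG, hF, hF0, inv_div _ _⟩
  | mul z w _ _ hz hw =>
    obtain ⟨F, G, d, hF, hG, h0, rfl⟩ := hz
    obtain ⟨F', G', d', hF', hG', h0', rfl⟩ := hw
    refine ⟨F * F', G * G', d + d', hF.mul hF', hG.mul hG', ?_, ?_⟩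
    · rw [map_mul]
      exact mul_ne_zero h0 h0'
    · rw [map_mul, map_mul, div_mul_div_comm]

/-- By birationality the conductor is not contained in the ideal of the image. -/
theorem exists_form_mem_sectionConductor (hx : LinearIndependent ℂ x)
    (hbir : IntermediateField.adjoin ℂ {z : K | ∃ i j, z = x i / x j} = ⊤) (y : Fin 2 → K) :
    ∃ b ∈ sectionConductor x y, (∃ d, b.IsHomogeneous d) ∧ gradedHom x b ≠ 0 := by
  have h : ∀ i, ∃ (G : CoordRing) (d : ℕ), G.IsHomogeneous d ∧ aeval x G ≠ 0 ∧
      gradedHom x G * Polynomial.monomial 2 (y i) ∈ (gradedHom x).range := by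
    intro i
    -- Dividing by x 0 ^ 2 makes the section a rational function F / G, so G multiplies y i to the
    -- form F * X 0 ^ 2.
    obtain ⟨F, G, d, hF, hG, h0, hy⟩ := exists_eq_aeval_div_aeval hx hbir (y i / x 0 ^ 2)
    refine ⟨G, d, hG, h0, F * X 0 ^ 2, ?_⟩
    have hx0 := hx.ne_zero 0
    change gradedHom x _ = _
    rw [gradedHom_of_isHomogeneous x hG,
      gradedHom_of_isHomogeneous x (hF.mul ((isHomogeneous_X ℂ 0).pow 2)),
      Polynomial.monomial_mul_monomial]
    congr 1
    rw [map_mul, map_pow, aeval_X]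
    rw [div_eq_div_iff (pow_ne_zero _ hx0) h0] at hy
    rw [← hy, mul_comm]
  choose G d hG h0 hr using h
  refine ⟨G 0 * G 1, fun i => ?_, ⟨_, (hG 0).mul (hG 1)⟩, ?_⟩
  · fin_cases i
    · rw [map_mul, mul_comm (gradedHom x (G 0)), mul_assoc]
      exact mul_mem ⟨_, rfl⟩ (hr 0)
    · rw [map_mul, mul_assoc]
      exact mul_mem ⟨_, rfl⟩ (hr 1)
  · rw [map_mul, gradedHom_of_isHomogeneous x (hG 0), gradedHom_of_isHomogeneous x (hG 1)]
    exact mul_ne_zero (by simpa using h0 0) (by simpa using h0 1)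

end Conductor

/-! ## Smooth points -/

section SmoothPoints

open MvPolynomial

theorem homogeneousComponent_one_eq {σ k : Type*} [Field k] [CharZero k] [Fintype σ]
    (g : MvPolynomial σ k) :
    homogeneousComponent 1 g = ∑ j, C (constantCoeff (pderiv j g)) * X j := by
  classical
  rw [← sub_eq_zero]
  refine eq_zero_of_pderiv_eq_zero (n := 0) ((homogeneousComponent_isHomogeneous 1 g).sub
    (IsHomogeneous.sum _ _ _ fun i _ => isHomogeneous_C_mul_X _ i)) fun i => ?_
  rw [map_sub, ← homogeneousComponent_pderiv, homogeneousComponent_zero, map_sum,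
    Finset.sum_eq_single i]
  · simp [constantCoeff_eq]
  · intro j _ hj
    rw [pderiv_C_mul, pderiv_X_of_ne hj, mul_zero]
  · simp

theorem pderiv_chart (e : Module.Basis (Fin 5) ℂ (Fin 5 → ℂ)) (j : Fin 4) (f : CoordRing) :
    pderiv j (chart e f) = ∑ i, C (e j.succ i) * chart e (pderiv i f) := by
  classical
  induction f using MvPolynomial.induction_on with
  | C a =>
    rw [← algebraMap_eq, AlgHom.commutes, algebraMap_eq, pderiv_C]
    simp [algebraMap_eq]
  | add f g hf hg => simp only [map_add, hf, hg, mul_add, Finset.sum_add_distrib]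
  | mul_X f i hf =>
    have hX : pderiv j (chart e (X i)) = C (e j.succ i) := by
      rw [chart, aeval_X, map_add, pderiv_C, zero_add, map_sum, Finset.sum_eq_single j]
      · simp
      · intro b _ hb
        rw [pderiv_C_mul, pderiv_X_of_ne hb, mul_zero]
      · simp
    have hterm : ∀ b, C (e j.succ b) * chart e (pderiv b (f * X i)) =
        (if b = i then chart e f * C (e j.succ i) else 0) +
          chart e (X i) * (C (e j.succ b) * chart e (pderiv b f)) := by
      intro b
      rw [pderiv_mul, map_add, map_mul, map_mul]
      split_ifs with h
      · subst h
        rw [pderiv_X_self, map_one]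
        ring
      · rw [pderiv_X_of_ne (Ne.symm h), map_zero]
        ring
    rw [map_mul, pderiv_mul, hf, hX, Finset.sum_congr rfl fun b _ => hterm b,
      Finset.sum_add_distrib, Finset.sum_ite_eq' Finset.univ i, if_pos (Finset.mem_univ i),
      ← Finset.mul_sum]
    ring

theorem homogeneousComponent_one_chart (e : Module.Basis (Fin 5) ℂ (Fin 5 → ℂ)) (f : CoordRing) :
    homogeneousComponent 1 (chart e f) =
      ∑ j : Fin 4, C (gradientAt (e 0) f ⬝ᵥ e j.succ) * X j := by
  rw [homogeneousComponent_one_eq]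
  refine Finset.sum_congr rfl fun j _ => ?_
  rw [pderiv_chart, map_sum]
  congr 2
  refine Finset.sum_congr rfl fun i _ => ?_
  rw [map_mul, constantCoeff_C, constantCoeff_chart, mul_comm]
  rfl

theorem exists_linearIndependent_extend {V : Type*} [AddCommGroup V] [Module ℂ V]
    (U : Submodule ℂ V) (hU : Module.finrank ℂ U = 3) {v : V} (hv : v ∈ U) (hv0 : v ≠ 0) :
    ∃ a ∈ U, ∃ b ∈ U, LinearIndependent ℂ ![v, a, b] := by
  have : FiniteDimensional ℂ U := Module.finite_of_finrank_pos (by omega)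
  have h1 : LinearIndependent ℂ (![⟨v, hv⟩] : Fin 1 → U) := by
    rw [linearIndependent_unique_iff]
    simpa using hv0
  obtain ⟨a, ha⟩ := exists_linearIndependent_snoc_of_lt_finrank h1 (by omega)
  obtain ⟨b, hb⟩ := exists_linearIndependent_snoc_of_lt_finrank ha (by omega)
  refine ⟨a, a.2, b, b.2, ?_⟩
  have := hb.map' U.subtype (Submodule.ker_subtype U)
  have heq : (![v, a, b] : Fin 3 → V) =
      U.subtype ∘ (Fin.snoc (Fin.snoc ![⟨v, hv⟩] a : Fin 2 → U) b : Fin 3 → U) := by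
    funext i
    fin_cases i <;> rfl
  rw [heq]
  exact this

variable {K : Type*} [Field K] [Algebra ℂ K] {x : Fin 5 → K} {y : Fin 2 → K}

/-- Euler's formula for each homogeneous component; the components again lie in the ideal and vanish
at `v`. -/
theorem gradientAt_dotProduct_self {v : Fin 5 → ℂ}
    (hv : ∀ f, gradedHom x f = 0 → eval v f = 0) {f : CoordRing} (hf : gradedHom x f = 0) :
    gradientAt v f ⬝ᵥ v = 0 := by
  have hn : ∀ n, gradientAt v (homogeneousComponent n f) ⬝ᵥ v = 0 := by
    intro n
    have h1 := congrArg (eval v)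
      (homogeneousComponent_isHomogeneous n f).sum_X_mul_pderiv
    rw [map_sum, map_nsmul, hv _ (gradedHom_homogeneousComponent_eq_zero x hf n), smul_zero] at h1
    rw [← h1]
    refine Finset.sum_congr rfl fun i _ => ?_
    rw [map_mul, eval_X, mul_comm]
    rfl
  have hsum : gradientAt v f =
      ∑ n ∈ Finset.range (f.totalDegree + 1), gradientAt v (homogeneousComponent n f) := by
    funext i
    conv_lhs => rw [← sum_homogeneousComponent f]
    simp [gradientAt]
  rw [hsum, sum_dotProduct]
  exact Finset.sum_eq_zero fun n _ => hn n

/-- Two independent gradients define a surjection ℂ⁵ → ℂ² whose three-dimensional kernel contains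
`v` by Euler's formula. The basis consists of `v`, preimages of the unit vectors, and a completion
of `v` to a basis of the kernel. -/
theorem exists_adapted_basis_of_smooth {v : Fin 5 → ℂ} (hv0 : v ≠ 0)
    (hv : ∀ f, gradedHom x f = 0 → eval v f = 0)
    (hrank : Module.finrank ℂ (Submodule.span ℂ
      (gradientAt v '' (RingHom.ker (gradedHom x) : Set CoordRing))) = 2) :
    ∃ e : Module.Basis (Fin 5) ℂ (Fin 5 → ℂ), e 0 = v ∧ ∀ a : Fin 2, ∃ f, gradedHom x f = 0 ∧
      ∀ j : Fin 4, gradientAt v f ⬝ᵥ e j.succ = if j = a.castLE (by omega) then 1 else 0 := by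
  obtain ⟨g, hg, -, hli⟩ := Submodule.exists_fun_fin_finrank_span_eq ℂ
    (gradientAt v '' (RingHom.ker (gradedHom x) : Set CoordRing))
  set g' : Fin 2 → Fin 5 → ℂ := fun a => g (Fin.cast hrank.symm a) with hg'
  have hli' : LinearIndependent ℂ g' := hli.comp _ (Fin.cast_injective _)
  set Φ := (Matrix.of g').mulVecLin with hΦ
  have hrk : Module.finrank ℂ (LinearMap.range Φ) = 2 := by
    have := LinearIndependent.rank_matrix (M := Matrix.of g') hli'
    simpa [Matrix.rank] using this
  have hsurj : Function.Surjective Φ := by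
    rw [← LinearMap.range_eq_top]
    exact Submodule.eq_top_of_finrank_eq (by rw [hrk]; simp)
  have hker : Module.finrank ℂ (LinearMap.ker Φ) = 3 := by
    have := LinearMap.finrank_range_add_finrank_ker Φ
    rw [hrk, Module.finrank_fin_fun] at this
    omega
  choose f hf hfg using fun a => hg (Fin.cast hrank.symm a)
  have hf0 : ∀ a, gradedHom x (f a) = 0 := fun a => hf a
  have hfg' : ∀ a u, Φ u a = gradientAt v (f a) ⬝ᵥ u := by
    intro a u
    rw [hfg a]
    rfl
  have hvker : v ∈ LinearMap.ker Φ := by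
    rw [LinearMap.mem_ker]
    funext a
    rw [hfg', gradientAt_dotProduct_self hv (hf0 a)]
    rfl
  obtain ⟨k, hk, l, hl, hvkl⟩ := exists_linearIndependent_extend _ hker hvker hv0
  rw [LinearMap.mem_ker] at hvker hk hl
  obtain ⟨a₀, ha₀⟩ := hsurj (Pi.single 0 1)
  obtain ⟨a₁, ha₁⟩ := hsurj (Pi.single 1 1)
  have hE : LinearIndependent ℂ (![v, a₀, a₁, k, l] : Fin 5 → Fin 5 → ℂ) := by
    rw [Fintype.linearIndependent_iff]
    intro c hc
    rw [Fin.sum_univ_five] at hc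
    simp only [Matrix.cons_val] at hc
    have h1 := congrArg Φ hc
    simp only [map_add, map_smul, hvker, hk, hl, ha₀, ha₁, smul_zero, add_zero, zero_add,
      map_zero] at h1
    have c1 : c 1 = 0 := by simpa using congrFun h1 0
    have c2 : c 2 = 0 := by simpa using congrFun h1 1
    rw [c1, c2, zero_smul, zero_smul, add_zero, add_zero] at hc
    have h3 := Fintype.linearIndependent_iff.1 hvkl ![c 0, c 3, c 4] (by
      rw [Fin.sum_univ_three]
      simpa using hc)
    intro i
    fin_cases i
    · exact h3 0
    · exact c1
    · exact c2
    · exact h3 1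
    · exact h3 2
  refine ⟨basisOfLinearIndependentOfCardEqFinrank hE (by simp), by simp, fun a => ?_⟩
  refine ⟨f a, hf0 a, fun j => ?_⟩
  rw [← hfg', coe_basisOfLinearIndependentOfCardEqFinrank]
  fin_cases j
  · change Φ a₀ a = _
    rw [ha₀]
    fin_cases a <;> simp
  · change Φ a₁ a = _
    rw [ha₁]
    fin_cases a <;> simp
  · change Φ k a = _
    rw [hk]
    fin_cases a <;> simp
  · change Φ l a = _
    rw [hl]
    fin_cases a <;> simp

/-- At a smooth point of the image the conductor is trivial. -/
theorem exists_form_mem_sectionConductor_of_smooth (hx : LinearIndependent ℂ x)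
    (hbir : IntermediateField.adjoin ℂ {z : K | ∃ i j, z = x i / x j} = ⊤)
    {ω : ⋀[K]^2 Ω[K⁄ℂ]} (hω : ω ≠ 0) (hy : PowersGenerated x y)
    {v : Fin 5 → ℂ} (hv0 : v ≠ 0) (hv : ∀ f, gradedHom x f = 0 → eval v f = 0)
    (hrank : Module.finrank ℂ (Submodule.span ℂ
      (gradientAt v '' (RingHom.ker (gradedHom x) : Set CoordRing))) = 2) :
    ∃ H ∈ sectionConductor x y, (∃ d, H.IsHomogeneous d) ∧ eval v H ≠ 0 := by
  obtain ⟨e, rfl, he⟩ := exists_adapted_basis_of_smooth hv0 hv hrank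
  have hconst : ∀ f ∈ RingHom.ker (chartHom x e), constantCoeff f = 0 := by
    intro f hf
    have := hv _ (homogenization_mem_ker e hx hf le_rfl)
    rwa [← constantCoeff_chart, chart_homogenization e le_rfl] at this
  have hlin : ∀ (a : Fin 2), ∃ f ∈ RingHom.ker (chartHom x e),
      homogeneousComponent 1 f = X (a.castLE (by omega)) := by
    intro a
    obtain ⟨f, hf, hfe⟩ := he a
    refine ⟨_, chart_mem_ker e hx hf, ?_⟩
    rw [homogeneousComponent_one_chart]
    simp [hfe]
  obtain ⟨f₀, hf₀, h₀⟩ := hlin 0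
  obtain ⟨f₁, hf₁, h₁⟩ := hlin 1
  -- The nonzero 2-form makes all 3 × 3 Jacobian minors of the ideal vanish on the image, so the two
  -- adapted equations cut out the whole tangent cone.
  have htc := hasTangentCone_of_smooth hconst (fun f hf j =>
    det_pderiv_mem_ker (chartHom x e) (adjoin_range_chartHom e hx hbir) hω f hf j) hf₀ hf₁ h₀ h₁
  obtain ⟨b, hb, ⟨d, hbd⟩, hb0⟩ := exists_form_mem_sectionConductor hx hbir y
  have hb0' : chartHom x e (chart e b) ≠ 0 := by
    intro h
    apply hb0
    rw [gradedHom_of_isHomogeneous x hbd, aeval_eq_chartHom_mul e hx hbd, h, zero_mul, map_zero]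
  have hH : ∀ i, ∃ H : CoordRing, (∃ d, H.IsHomogeneous d) ∧ eval (e 0) H = 1 ∧
      gradedHom x H * Polynomial.monomial 2 (y i) ∈ (gradedHom x).range := by
    intro i
    obtain ⟨h, z, hh, hz⟩ := htc.exists_mul_eq_of_smooth hb0' (hy.exists_chartHom_eq e hx hb i)
    obtain ⟨H, hHd, hH1, hHr⟩ := exists_form_mul_eq e hx (p := 1) (isHomogeneous_one _ _)
      (h := h) (z := z) (y := y i) (by rw [map_one, map_one, one_mul, hz])
    exact ⟨H, hHd, by rw [hH1, hh], by rwa [mul_one] at hHr⟩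
  choose H hHd hH1 hHr using hH
  obtain ⟨d₀, hd₀⟩ := hHd 0
  obtain ⟨d₁, hd₁⟩ := hHd 1
  refine ⟨H 0 * H 1, fun i => ?_, ⟨_, hd₀.mul hd₁⟩, by rw [map_mul, hH1, hH1]; simp⟩
  fin_cases i
  · rw [map_mul, mul_comm (gradedHom x (H 0)), mul_assoc]
    exact mul_mem ⟨_, rfl⟩ (hHr 0)
  · rw [map_mul, mul_assoc]
    exact mul_mem ⟨_, rfl⟩ (hHr 1)

end SmoothPoints

/-! ## Improper double points -/

section ImproperDoublePoints

open MvPolynomial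

/-- Translation of polynomials by a vector. -/
noncomputable def shiftHom (v : Fin 5 → ℂ) : CoordRing →ₐ[ℂ] CoordRing :=
  aeval fun i => X i + C (v i)

theorem shiftHom_apply (v : Fin 5 → ℂ) (f : CoordRing) : shiftHom v f = shiftBy v f := rfl

theorem shiftHom_shiftHom_neg (v : Fin 5 → ℂ) (f : CoordRing) :
    shiftHom v (shiftHom (-v) f) = f := by
  have : (shiftHom v).comp (shiftHom (-v)) = AlgHom.id ℂ _ := by
    refine algHom_ext fun i => ?_
    rw [AlgHom.comp_apply, shiftHom, shiftHom, aeval_X, map_add, aeval_X, algHom_C]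
    simp [algebraMap_eq]
  exact congrArg (fun φ : CoordRing →ₐ[ℂ] CoordRing => φ f) this

/-- Every homogeneous element of the ideal of the tangent cone is an initial form. -/
theorem exists_initial_form_of_mem_tangentConeIdeal {I : Ideal CoordRing} {v : Fin 5 → ℂ}
    {g : CoordRing} (hg : g ∈ tangentConeIdeal I v) (k : ℕ) :
    ∃ F ∈ I, (∀ j < k, homogeneousComponent j (shiftBy v F) = 0) ∧
      homogeneousComponent k (shiftBy v F) = homogeneousComponent k g := by
  induction hg using Submodule.span_induction generalizing k with
  | mem g hg =>
    obtain ⟨f, hf, d, hd, rfl⟩ := hg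
    rw [homogeneousComponent_of_mem (homogeneousComponent_isHomogeneous d _)]
    split_ifs with h
    · subst h
      exact ⟨f, hf, hd, rfl⟩
    · exact ⟨0, I.zero_mem, by simp [← shiftHom_apply], by simp [← shiftHom_apply]⟩
  | zero => exact ⟨0, I.zero_mem, by simp [← shiftHom_apply], by simp [← shiftHom_apply]⟩
  | add g g' _ _ hg hg' =>
    obtain ⟨F, hF, h1, h2⟩ := hg k
    obtain ⟨F', hF', h1', h2'⟩ := hg' k
    simp only [← shiftHom_apply] at h1 h2 h1' h2' ⊢
    refine ⟨F + F', I.add_mem hF hF', fun j hj => ?_, ?_⟩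
    · rw [map_add, map_add, h1 j hj, h1' j hj, add_zero]
    · rw [map_add, map_add, map_add, h2, h2']
  | smul a g _ hg =>
    simp only [← shiftHom_apply, smul_eq_mul] at hg ⊢
    induction a using MvPolynomial.induction_on' with
    | add p q hp hq =>
      obtain ⟨F, hF, h1, h2⟩ := hp
      obtain ⟨F', hF', h1', h2'⟩ := hq
      refine ⟨F + F', I.add_mem hF hF', fun j hj => ?_, ?_⟩
      · rw [map_add, map_add, h1 j hj, h1' j hj, add_zero]
      · rw [map_add, map_add, add_mul, map_add, h2, h2']
    | monomial d a =>
      have hd : (monomial d a : CoordRing).IsHomogeneous d.degree := isHomogeneous_monomial a rfl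
      by_cases hk : d.degree ≤ k
      · obtain ⟨F, hF, h1, h2⟩ := hg (k - d.degree)
        -- The monomial is translated back by -v, so that after the shift to v it multiplies the
        -- initial form by exactly this monomial.
        refine ⟨shiftHom (-v) (monomial d a) * F, I.mul_mem_left _ hF, fun j hj => ?_, ?_⟩
        · rw [map_mul, shiftHom_shiftHom_neg, hd.homogeneousComponent_mul]
          split_ifs with hdj
          · rw [h1 _ (by omega), mul_zero]
          · rfl
        · rw [map_mul, shiftHom_shiftHom_neg, hd.homogeneousComponent_mul,
            hd.homogeneousComponent_mul, if_pos hk, if_pos hk, h2]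
      · refine ⟨0, I.zero_mem, by simp, ?_⟩
        rw [hd.homogeneousComponent_mul, if_neg hk]
        simp

variable {K : Type*} [Field K] [Algebra ℂ K] {x : Fin 5 → K} {y : Fin 2 → K}
  (e : Module.Basis (Fin 5) ℂ (Fin 5 → ℂ))

theorem shiftHom_dualForm (v : Fin 5 → ℂ) (j : Fin 5) :
    shiftHom v (dualForm e j) = dualForm e j + C (e.coord j v) := by
  rw [← eval_dualForm, shiftHom, dualForm]
  simp [mul_add, Finset.sum_add_distrib, algebraMap_eq]

theorem shiftHom_chartLift (f : MvPolynomial (Fin 4) ℂ) :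
    shiftHom (e 0) (chartLift e f) = chartLift e f := by
  have : (shiftHom (e 0)).comp (chartLift e) = chartLift e := by
    refine algHom_ext fun j => ?_
    rw [AlgHom.comp_apply, chartLift, aeval_X, shiftHom_dualForm]
    simp
  exact congrArg (fun φ : MvPolynomial (Fin 4) ℂ →ₐ[ℂ] CoordRing => φ f) this

/-- The shift turns the homogenizing form `dualForm e 0` into itself plus 1, a unit at the origin,
and leaves the other coordinates fixed. Thus the chart and the affine cone see the same initial
form. -/
theorem shiftHom_homogenization {d n : ℕ} {f : MvPolynomial (Fin 4) ℂ}
    (hf : f ∈ idealOfVars (Fin 4) ℂ ^ n) (hd : n ≤ d) :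
    shiftHom (e 0) (homogenization e d f) ∈ idealOfVars (Fin 5) ℂ ^ n ∧
      homogeneousComponent n (shiftHom (e 0) (homogenization e d f)) =
        chartLift e (homogeneousComponent n f) := by
  have hterm : ∀ j, ((dualForm e 0 + 1) ^ (d - j) : CoordRing) *
      chartLift e (homogeneousComponent j f) ∈ idealOfVars (Fin 5) ℂ ^ j := fun j =>
    Ideal.mul_mem_left _ _
      (isHomogeneous_chartLift e (homogeneousComponent_isHomogeneous j f)).mem_pow_idealOfVars
  have heq : shiftHom (e 0) (homogenization e d f) = ∑ j ∈ Finset.range (d + 1),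
      (dualForm e 0 + 1) ^ (d - j) * chartLift e (homogeneousComponent j f) := by
    rw [homogenization, map_sum]
    refine Finset.sum_congr rfl fun j _ => ?_
    rw [map_mul, map_pow, shiftHom_chartLift, shiftHom_dualForm]
    simp
  rw [heq]
  constructor
  · refine Ideal.sum_mem _ fun j _ => ?_
    by_cases hj : n ≤ j
    · exact Ideal.pow_le_pow_right hj (hterm j)
    · rw [homogeneousComponent_eq_zero_of_mem hf (by omega), map_zero, mul_zero]
      exact zero_mem _
  · rw [map_sum, Finset.sum_eq_single_of_mem n (Finset.mem_range.2 (by omega))]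
    · have h1 := homogeneousComponent_mul_of_mem (a := 0) (b := n)
        (f := ((dualForm e 0 + 1) ^ (d - n) : CoordRing)) (by simp)
        (isHomogeneous_chartLift e
          (homogeneousComponent_isHomogeneous n f)).mem_pow_idealOfVars
      rw [zero_add] at h1
      have h2 : constantCoeff (dualForm e 0) = 0 := by
        rw [← mem_idealOfVars_iff, ← pow_one (idealOfVars _ _)]
        exact (isHomogeneous_dualForm e 0).mem_pow_idealOfVars
      rw [h1, homogeneousComponent_zero, ← constantCoeff_eq, map_pow, map_add, h2, zero_add,
        map_one, one_pow, C_1, one_mul, homogeneousComponent_eq_self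
        (isHomogeneous_chartLift e (homogeneousComponent_isHomogeneous n f))]
    · intro j _ hj
      rcases lt_or_gt_of_ne hj with hlt | hgt
      · rw [homogeneousComponent_eq_zero_of_mem hf hlt, map_zero, mul_zero, map_zero]
      · exact homogeneousComponent_eq_zero_of_mem (hterm j) hgt

/-- Substitution of the linear parts of the chart. -/
noncomputable def chartLinear : CoordRing →ₐ[ℂ] MvPolynomial (Fin 4) ℂ :=
  aeval fun i => ∑ j : Fin 4, C (e j.succ i) * X j

theorem isHomogeneous_chartLinear_X (i : Fin 5) : (chartLinear e (X i)).IsHomogeneous 1 := by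
  rw [chartLinear, aeval_X]
  exact IsHomogeneous.sum _ _ _ fun j _ => isHomogeneous_C_mul_X _ j

theorem chartLinear_shiftHom (f : CoordRing) :
    chartLinear e (shiftHom (e 0) f) = chart e f := by
  have : (chartLinear e).comp (shiftHom (e 0)) = chart e := by
    refine algHom_ext fun i => ?_
    rw [AlgHom.comp_apply, shiftHom, aeval_X, chartLinear, map_add, aeval_X, algHom_C, chart,
      aeval_X, add_comm]
    rfl
  exact congrArg (fun φ : CoordRing →ₐ[ℂ] MvPolynomial (Fin 4) ℂ => φ f) this

theorem chartLinear_chartLift (f : MvPolynomial (Fin 4) ℂ) :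
    chartLinear e (chartLift e f) = f := by
  rw [← shiftHom_chartLift, chartLinear_shiftHom, chart_chartLift]

/-- The coordinates on the two components of the tangent cone. -/
def improperComponent (i : Bool) (j : Fin 4) : Prop :=
  if i then 2 ≤ j else j < 2

instance (i : Bool) : DecidablePred (improperComponent i) := fun j => by
  unfold improperComponent
  infer_instance

theorem improperComponent_disjoint (j : Fin 4) :
    ¬ (improperComponent false j ∧ improperComponent true j) := by
  revert j
  decide

theorem improperComponent_or (j : Fin 4) :
    improperComponent false j ∨ improperComponent true j := by
  revert j
  decide

theorem eval_restrictVars {σ k : Type*} [Field k] (s : σ → Prop) [DecidablePred s] (u : σ → k)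
    (f : MvPolynomial σ k) :
    eval u (restrictVars k s f) = eval (fun j => if s j then u j else 0) f := by
  have : ((aeval u : MvPolynomial σ k →ₐ[k] k).comp (restrictVars k s)) =
      aeval (fun j => if s j then u j else 0) := by
    refine algHom_ext fun j => ?_
    rw [AlgHom.comp_apply, restrictVars_X, aeval_X]
    split_ifs <;> simp
  have h := congrArg (fun φ : MvPolynomial σ k →ₐ[k] k => φ f) this
  simpa [aeval_eq_eval] using h

/-- The tangent cone of the affine chart at an improper double point. -/
theorem hasTangentCone_of_improper (hx : LinearIndependent ℂ x)
    {Z : Bool → Submodule ℂ (Fin 5 → ℂ)}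
    (hZ : ∀ i u, u ∈ Z i ↔ ∀ j, ¬ improperComponent i j → e.coord j.succ u = 0)
    (hT : tangentConeIdeal (RingHom.ker (gradedHom x)) (e 0) =
      vanishingIdeal ℂ ((Z false : Set (Fin 5 → ℂ)) ∪ (Z true : Set (Fin 5 → ℂ)))) :
    HasTangentCone (RingHom.ker (chartHom x e))
      (fun i => restrictVars ℂ (improperComponent i)) := by
  have hZmem : ∀ i u, u ∈ Z i →
      u ∈ (Z false : Set (Fin 5 → ℂ)) ∪ (Z true : Set (Fin 5 → ℂ)) := by
    intro i u hu
    cases i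
    · exact Or.inl hu
    · exact Or.inr hu
  refine ⟨fun i j => isHomogeneous_restrictVars_X _ j, ?_, ?_⟩
  · intro n f hf hfn i
    set d := max f.totalDegree n
    obtain ⟨h1, h2⟩ := shiftHom_homogenization e hfn (le_max_right f.totalDegree n)
    -- The initial form on the chart is, after lifting, the initial form of a homogenization at the
    -- vertex e 0. It therefore vanishes on both subspaces.
    have hmem : chartLift e (homogeneousComponent n f) ∈
        tangentConeIdeal (RingHom.ker (gradedHom x)) (e 0) :=
      Ideal.subset_span ⟨_, homogenization_mem_ker e hx hf (le_max_left f.totalDegree n), n,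
        fun j hj => homogeneousComponent_eq_zero_of_mem h1 hj, h2.symm⟩
    rw [hT, mem_vanishingIdeal_iff] at hmem
    refine MvPolynomial.funext fun u => ?_
    rw [eval_restrictVars, map_zero]
    set u' : Fin 4 → ℂ := fun j => if improperComponent i j then u j else 0 with hu'
    have hcoord : ∀ j : Fin 4, e.coord j.succ (∑ j : Fin 4, u' j • e j.succ) = u' j := by
      intro j
      rw [map_sum, Finset.sum_eq_single j]
      · simp
      · intro b _ hb
        simp [hb]
      · simp
    have := hmem (∑ j : Fin 4, u' j • e j.succ) (hZmem i _ ((hZ i _).2 fun j hj => by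
      rw [hcoord, hu']
      simp only [if_neg hj]))
    rw [aeval_eq_eval] at this
    change eval _ (chartLift e (homogeneousComponent n f)) = 0 at this
    rw [eval_chartLift] at this
    rw [← this]
    congr 2
    funext j
    exact (hcoord j).symm
  · intro n f hfn hf
    have hmem : chartLift e (homogeneousComponent n f) ∈
        tangentConeIdeal (RingHom.ker (gradedHom x)) (e 0) := by
      rw [hT, mem_vanishingIdeal_iff]
      have key : ∀ i, ∀ u ∈ Z i, eval u (chartLift e (homogeneousComponent n f)) = 0 := by
        intro i u hu
        rw [hZ] at hu
        have h0 := congrArg (eval fun j : Fin 4 => e.coord j.succ u) (hf i)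
        rw [eval_restrictVars, map_zero] at h0
        rw [eval_chartLift, ← h0]
        congr 2
        funext j
        split_ifs with hj
        · rfl
        · exact hu j hj
      rintro u (hu | hu)
      · exact key false u hu
      · exact key true u hu
    -- The equality of ideals makes the lifted form an initial form of some G in the ideal;
    -- restricting G to the chart gives an element of the kernel with the same initial form as f.
    obtain ⟨G, hG, h1, h2⟩ := exists_initial_form_of_mem_tangentConeIdeal hmem n
    rw [← shiftHom_apply] at h2
    simp only [← shiftHom_apply] at h1
    rw [homogeneousComponent_eq_self
      (isHomogeneous_chartLift e (homogeneousComponent_isHomogeneous n f))] at h2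
    have hGn : chart e G ∈ idealOfVars (Fin 4) ℂ ^ n := by
      rw [← chartLinear_shiftHom]
      exact map_mem_pow_idealOfVars _ (isHomogeneous_chartLinear_X e)
        ((mem_pow_idealOfVars_iff_homogeneousComponent _ _).2 h1)
    have hGc : homogeneousComponent n (chart e G) = homogeneousComponent n f := by
      rw [← chartLinear_shiftHom, homogeneousComponent_algHom _ (isHomogeneous_chartLinear_X e),
        h2, chartLinear_chartLift]
    rw [← add_sub_cancel (chart e G) f]
    refine add_mem (Ideal.mem_sup_left (chart_mem_ker e hx hG)) (Ideal.mem_sup_right ?_)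
    rw [mem_pow_succ_idealOfVars_iff (sub_mem hfn hGn), map_sub, hGc, sub_self]

/-- Coordinates adapted to an improper double point. -/
theorem exists_adapted_basis_of_improper {v : Fin 5 → ℂ} (hv0 : v ≠ 0)
    {U W : Submodule ℂ (Fin 5 → ℂ)} (hU : Module.finrank ℂ U = 3) (hW : Module.finrank ℂ W = 3)
    (hvU : v ∈ U) (hvW : v ∈ W) (hUW : U ⊔ W = ⊤) :
    ∃ e : Module.Basis (Fin 5) ℂ (Fin 5 → ℂ), e 0 = v ∧
      ∀ i u, u ∈ (if i then W else U : Submodule ℂ (Fin 5 → ℂ)) ↔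
        ∀ j, ¬ improperComponent i j → e.coord j.succ u = 0 := by
  obtain ⟨a, ha, b, hb, hab⟩ := exists_linearIndependent_extend U hU hvU hv0
  obtain ⟨c, hc, d, hd, hcd⟩ := exists_linearIndependent_extend W hW hvW hv0
  have hspan : ∀ (Z : Submodule ℂ (Fin 5 → ℂ)) (p q : Fin 5 → ℂ), Module.finrank ℂ Z = 3 →
      v ∈ Z → p ∈ Z → q ∈ Z → LinearIndependent ℂ ![v, p, q] →
      Z = Submodule.span ℂ {v, p, q} := by
    intro Z p q hZ h1 h2 h3 hli
    symm
    apply Submodule.eq_of_le_of_finrank_eq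
    · rw [Submodule.span_le]
      rintro _ (rfl | rfl | rfl)
      · exact h1
      · exact h2
      · exact h3
    · have hrange : Set.range ![v, p, q] = {v, p, q} := by
        rw [Matrix.range_cons, Matrix.range_cons, Matrix.range_cons, Matrix.range_empty,
          Set.union_empty, Set.singleton_union, Set.singleton_union]
      rw [hZ, ← hrange]
      exact finrank_span_eq_card hli
  have hUs := hspan U a b hU hvU ha hb hab
  have hWs := hspan W c d hW hvW hc hd hcd
  -- Five vectors spanning U + W = ℂ⁵ form a basis; the directions in U come before those in W.
  set E : Fin 5 → Fin 5 → ℂ := ![v, a, b, c, d] with hE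
  have hmemE : ∀ i, E i ∈ Submodule.span ℂ (Set.range E) := fun i =>
    Submodule.subset_span ⟨i, rfl⟩
  have htop : ⊤ ≤ Submodule.span ℂ (Set.range E) := by
    rw [← hUW, sup_le_iff, hUs, hWs, Submodule.span_le, Submodule.span_le]
    constructor
    · rintro _ (rfl | rfl | rfl)
      · exact hmemE 0
      · exact hmemE 1
      · exact hmemE 2
    · rintro _ (rfl | rfl | rfl)
      · exact hmemE 0
      · exact hmemE 3
      · exact hmemE 4
  set e := basisOfTopLeSpanOfCardEqFinrank E htop (by simp) with he
  have heE : ∀ i, e i = E i := fun i => by rw [he, coe_basisOfTopLeSpanOfCardEqFinrank]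
  refine ⟨e, heE 0, ?_⟩
  have hsum : ∀ u, u = e.coord 0 u • v + e.coord 1 u • a + e.coord 2 u • b + e.coord 3 u • c +
      e.coord 4 u • d := by
    intro u
    conv_lhs => rw [← e.sum_repr u, Fin.sum_univ_five]
    simp only [heE]
    rfl
  have hcoord : ∀ i j, e.coord j (E i) = if i = j then 1 else 0 := fun i j => by
    rw [← heE, Module.Basis.coord_apply, Module.Basis.repr_self, Finsupp.single_apply]
  have hle : ∀ (Z : Submodule ℂ (Fin 5 → ℂ)) (j : Fin 5) (p q : Fin 5 → ℂ),
      Z = Submodule.span ℂ {v, p, q} → e.coord j v = 0 → e.coord j p = 0 → e.coord j q = 0 →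
      ∀ u ∈ Z, e.coord j u = 0 := by
    intro Z j p q hZ h1 h2 h3 u hu
    have : Z ≤ LinearMap.ker (e.coord j) := by
      rw [hZ, Submodule.span_le]
      rintro _ (rfl | rfl | rfl)
      · exact h1
      · exact h2
      · exact h3
    exact this hu
  intro i u
  cases i
  · simp only [Bool.false_eq_true, if_false]
    constructor
    · intro hu j hj
      fin_cases j
      · exact absurd (by decide) hj
      · exact absurd (by decide) hj
      · exact hle U 3 a b hUs (hcoord 0 3) (hcoord 1 3) (hcoord 2 3) u hu
      · exact hle U 4 a b hUs (hcoord 0 4) (hcoord 1 4) (hcoord 2 4) u hu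
    · intro h
      have h3 : e.coord 3 u = 0 := h 2 (by decide)
      have h4 : e.coord 4 u = 0 := h 3 (by decide)
      rw [hsum u, h3, h4, zero_smul, zero_smul, add_zero, add_zero]
      exact add_mem (add_mem (U.smul_mem _ hvU) (U.smul_mem _ ha)) (U.smul_mem _ hb)
  · simp only [if_true]
    constructor
    · intro hu j hj
      fin_cases j
      · exact hle W 1 c d hWs (hcoord 0 1) (hcoord 3 1) (hcoord 4 1) u hu
      · exact hle W 2 c d hWs (hcoord 0 2) (hcoord 3 2) (hcoord 4 2) u hu
      · exact absurd (by decide) hj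
      · exact absurd (by decide) hj
    · intro h
      have h1 : e.coord 1 u = 0 := h 0 (by decide)
      have h2 : e.coord 2 u = 0 := h 1 (by decide)
      rw [hsum u, h1, h2, zero_smul, zero_smul, add_zero, add_zero]
      exact add_mem (add_mem (W.smul_mem _ hvW) (W.smul_mem _ hc)) (W.smul_mem _ hd)

theorem exists_chart_of_isImproperDoublePoint (hx : LinearIndependent ℂ x) {p : P4}
    (hp : IsImproperDoublePoint (RingHom.ker (gradedHom x)) p) :
    ∃ e : Module.Basis (Fin 5) ℂ (Fin 5 → ℂ), e 0 = p.rep ∧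
      HasTangentCone (RingHom.ker (chartHom x e))
        (fun i => restrictVars ℂ (improperComponent i)) := by
  obtain ⟨-, U, W, hU, hW, hpU, hpW, hUW, hT⟩ := hp
  have hmem : p.rep ∈ p.submodule := by
    rw [Projectivization.submodule_eq]
    exact Submodule.mem_span_singleton_self _
  obtain ⟨e, he, hZ⟩ := exists_adapted_basis_of_improper p.rep_nonzero hU hW (hpU hmem)
    (hpW hmem) hUW
  refine ⟨e, he, hasTangentCone_of_improper e hx (Z := fun i => if i then W else U) hZ ?_⟩
  rw [he, hT]
  simp

end ImproperDoublePoints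

/-! ## The conductor along the singular locus -/

section SingularLocus

open MvPolynomial

variable {K : Type*} [Field K] [Algebra ℂ K] {x : Fin 5 → K} {y : Fin 2 → K}

/-- At an improper double point, linear forms through the point lie in the conductor, if the
conductor contains a power of the maximal ideal. -/
theorem exists_mul_mem_sectionConductor_of_improper (hx : LinearIndependent ℂ x)
    (hy : PowersGenerated x y) {p : P4}
    (hp : IsImproperDoublePoint (RingHom.ker (gradedHom x)) p) {g : CoordRing}
    (hg : eval p.rep g ≠ 0)
    (hN : ∀ l : CoordRing, l.IsHomogeneous 1 → eval p.rep l = 0 →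
      ∃ N, (g * l) ^ N ∈ sectionConductor x y)
    {l : CoordRing} (hl : l.IsHomogeneous 1) (hl0 : eval p.rep l = 0) :
    ∃ H : CoordRing, eval p.rep H ≠ 0 ∧ H * l ∈ sectionConductor x y := by
  obtain ⟨e, he, htc⟩ := exists_chart_of_isImproperDoublePoint hx hp
  rw [← he] at hg hN hl0 ⊢
  -- This form becomes X 0 + X 2 on the chart, with one coordinate from each plane, so its
  -- restriction to either plane is nonzero. The same holds for the initial form of the conductor
  -- element, because g is nonzero at the point.
  obtain ⟨N, hb⟩ := hN (dualForm e 1 + dualForm e 3)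
    ((isHomogeneous_dualForm e 1).add (isHomogeneous_dualForm e 3)) (by
      rw [map_add, eval_dualForm, eval_dualForm]
      simp)
  have hchart : chart e (dualForm e 1 + dualForm e 3) = X 0 + X 2 := by
    rw [map_add]
    exact congrArg₂ (· + ·) (chart_dualForm_succ e 0) (chart_dualForm_succ e 2)
  have hlin : (X 0 + X 2 : MvPolynomial (Fin 4) ℂ).IsHomogeneous 1 :=
    (isHomogeneous_X _ _).add (isHomogeneous_X _ _)
  set b₁ := chart e (g * (dualForm e 1 + dualForm e 3)) with hb₁
  have hb₁m : b₁ ∈ idealOfVars (Fin 4) ℂ ^ 1 := by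
    rw [hb₁, map_mul, hchart]
    exact Ideal.mul_mem_left _ _ hlin.mem_pow_idealOfVars
  have hb₁c : homogeneousComponent 1 b₁ = C (eval (e 0) g) * (X 0 + X 2) := by
    have := homogeneousComponent_mul_of_mem (a := 0) (b := 1) (f := chart e g) (by simp)
      hlin.mem_pow_idealOfVars
    rw [zero_add] at this
    rw [hb₁, map_mul, hchart, this, homogeneousComponent_zero, ← constantCoeff_eq,
      constantCoeff_chart, homogeneousComponent_eq_self hlin]
  obtain ⟨hbm, hbc⟩ := homogeneousComponent_pow_of_mem hb₁m N
  have hb0 : ∀ i, restrictVars ℂ (improperComponent i)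
      (homogeneousComponent (N * 1) (b₁ ^ N)) ≠ 0 := by
    intro i
    rw [hbc, hb₁c, map_pow, map_mul, ← algebraMap_eq, AlgHom.commutes, algebraMap_eq]
    refine pow_ne_zero _ (mul_ne_zero (by simpa using hg) ?_)
    rw [map_add, restrictVars_X, restrictVars_X]
    cases i
    · rw [if_pos (by decide), if_neg (by decide), add_zero]
      exact X_ne_zero _
    · rw [if_neg (by decide), if_pos (by decide), zero_add]
      exact X_ne_zero _
  have hH : ∀ i, ∃ H : CoordRing, eval (e 0) H = 1 ∧
      gradedHom x (H * l) * Polynomial.monomial 2 (y i) ∈ (gradedHom x).range := by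
    intro i
    have hyb := hy.exists_chartHom_eq e hx hb i
    rw [map_pow, ← hb₁] at hyb
    obtain ⟨h, z, hh, hz⟩ := htc.exists_mul_mul_eq_of_improper improperComponent_disjoint hbm hb0
      hyb (l := chart e l) (by rw [constantCoeff_chart, hl0])
    obtain ⟨H, -, hH1, hHr⟩ := exists_form_mul_eq e hx hl hz
    exact ⟨H, by rw [hH1, hh], hHr⟩
  choose H hH1 hHr using hH
  refine ⟨H 0 * H 1, by rw [map_mul, hH1, hH1]; simp, fun i => ?_⟩
  fin_cases i
  · rw [show H 0 * H 1 * l = H 1 * (H 0 * l) by ring, map_mul, mul_assoc]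
    exact mul_mem ⟨_, rfl⟩ (hHr 0)
  · rw [mul_assoc, map_mul, mul_assoc]
    exact mul_mem ⟨_, rfl⟩ (hHr 1)

/-- The two planes span the chart, so a linear form vanishing on both is zero. Consequently the
equations of the image have no linear terms at such a point. -/
theorem homogeneousComponent_one_eq_zero_of_restrictVars {f : MvPolynomial (Fin 4) ℂ}
    (h : ∀ i, restrictVars ℂ (improperComponent i) (homogeneousComponent 1 f) = 0) :
    homogeneousComponent 1 f = 0 := by
  have h1 := homogeneousComponent_one_eq f
  rw [h1]
  refine Finset.sum_eq_zero fun j _ => ?_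
  obtain ⟨i, hi⟩ : ∃ i, improperComponent i j := by
    rcases improperComponent_or j with h | h
    · exact ⟨_, h⟩
    · exact ⟨_, h⟩
  have h2 := congrArg (eval (Pi.single j (1 : ℂ))) (h i)
  rw [h1, eval_restrictVars, map_zero, map_sum, Finset.sum_eq_single j] at h2
  · rw [map_mul, eval_C, eval_X, if_pos hi, Pi.single_eq_same, mul_one] at h2
    rw [h2, C_0, zero_mul]
  · intro b _ hb
    rw [map_mul, eval_X, Pi.single_eq_of_ne hb, ite_self, mul_zero]
  · simp

/-- The ideal of the image is not a complete intersection at an improper double point. -/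
theorem not_locally_generated_by_two_of_improper (hx : LinearIndependent ℂ x) {p : P4}
    (hp : IsImproperDoublePoint (RingHom.ker (gradedHom x)) p) {f : Fin 2 → CoordRing}
    (hf : ∀ a, gradedHom x (f a) = 0) :
    ∃ F, gradedHom x F = 0 ∧ ∀ h a : CoordRing, ∀ b : CoordRing,
      h * F = a * f 0 + b * f 1 → eval p.rep h = 0 := by
  obtain ⟨e, he, htc⟩ := exists_chart_of_isImproperDoublePoint hx hp
  rw [← he]
  by_contra hcon
  push Not at hcon
  have hG : ∀ a, chart e (f a) ∈ idealOfVars (Fin 4) ℂ ^ 2 := by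
    intro a
    have hker := chart_mem_ker e hx (hf a)
    have h1 : chart e (f a) ∈ idealOfVars (Fin 4) ℂ ^ 1 := by
      rw [pow_one, mem_idealOfVars_iff]
      exact htc.constantCoeff_eq_zero hker
    exact (mem_pow_succ_idealOfVars_iff h1).2
      (homogeneousComponent_one_eq_zero_of_restrictVars (htc.init 1 _ hker h1))
  set G : Fin 2 → MvPolynomial (Fin 4) ℂ := fun a => homogeneousComponent 2 (chart e (f a))
  -- The product of a coordinate from each plane vanishes on the cone, hence is the quadratic part
  -- of an element of the ideal. If f 0, f 1 generated locally, it would be a constant combination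
  -- of their quadratic parts.
  have hspan : ∀ s t : Fin 4, improperComponent false s → improperComponent true t →
      (X s * X t : MvPolynomial (Fin 4) ℂ) ∈ Submodule.span ℂ (Set.range G) := by
    intro s t hs ht
    have hq : (X s * X t : MvPolynomial (Fin 4) ℂ).IsHomogeneous 2 :=
      (isHomogeneous_X _ _).mul (isHomogeneous_X _ _)
    obtain ⟨c, hc, r, hr, hcr⟩ := Submodule.mem_sup.1
      (htc.lift 2 _ hq.mem_pow_idealOfVars (fun i => by
        rw [homogeneousComponent_eq_self hq, map_mul, restrictVars_X, restrictVars_X]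
        cases i
        · rw [if_neg fun h => improperComponent_disjoint t ⟨h, ht⟩, mul_zero]
        · rw [if_neg fun h => improperComponent_disjoint s ⟨hs, h⟩, zero_mul]))
    have hc' : c = X s * X t - r := by rw [← hcr, add_sub_cancel_right]
    have hcm : c ∈ idealOfVars (Fin 4) ℂ ^ 2 := by
      rw [hc']
      exact sub_mem hq.mem_pow_idealOfVars (Ideal.pow_le_pow_right (by omega) hr)
    have hc2 : homogeneousComponent 2 c = X s * X t := by
      rw [hc', map_sub, homogeneousComponent_eq_self hq,
        homogeneousComponent_eq_zero_of_mem hr (by omega), sub_zero]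
    obtain ⟨h, a, b, hab, hh⟩ := hcon _ (homogenization_mem_ker e hx hc le_rfl)
    have h1 := congrArg (fun q => homogeneousComponent 2 (chart e q)) hab
    have hmul : ∀ u w : MvPolynomial (Fin 4) ℂ, w ∈ idealOfVars (Fin 4) ℂ ^ 2 →
        homogeneousComponent 2 (u * w) = constantCoeff u • homogeneousComponent 2 w := by
      intro u w hw
      have := homogeneousComponent_mul_of_mem (a := 0) (b := 2) (f := u) (by simp) hw
      rw [zero_add] at this
      rw [this, homogeneousComponent_zero, ← constantCoeff_eq, C_mul']
    simp only [map_mul, map_add, chart_homogenization e le_rfl] at h1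
    rw [hmul _ _ hcm, hmul _ _ (hG 0), hmul _ _ (hG 1), hc2, constantCoeff_chart] at h1
    rw [← inv_smul_smul₀ hh (X s * X t : MvPolynomial (Fin 4) ℂ), h1]
    exact Submodule.smul_mem _ _ (add_mem
      (Submodule.smul_mem _ _ (Submodule.subset_span ⟨0, rfl⟩))
      (Submodule.smul_mem _ _ (Submodule.subset_span ⟨1, rfl⟩)))
  -- Three of the four products already exceed the dimension of a span of two quadrics.
  set q : Fin 3 → MvPolynomial (Fin 4) ℂ := ![X 0 * X 2, X 0 * X 3, X 1 * X 2] with hqdef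
  have hli : LinearIndependent ℂ q := by
    rw [Fintype.linearIndependent_iff]
    intro c hc
    rw [Fin.sum_univ_three] at hc
    simp only [hqdef, Matrix.cons_val] at hc
    have e1 := congrArg (eval ![1, 0, 1, 0]) hc
    have e2 := congrArg (eval ![1, 0, 0, 1]) hc
    have e3 := congrArg (eval ![0, 1, 1, 0]) hc
    simp [smul_eval] at e1 e2 e3
    intro i
    fin_cases i
    · exact e1
    · exact e2
    · exact e3
  have hle : Submodule.span ℂ (Set.range q) ≤ Submodule.span ℂ (Set.range G) := by
    rw [Submodule.span_le]
    rintro _ ⟨i, rfl⟩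
    fin_cases i
    · exact hspan 0 2 (by decide) (by decide)
    · exact hspan 0 3 (by decide) (by decide)
    · exact hspan 1 2 (by decide) (by decide)
  have : FiniteDimensional ℂ (Submodule.span ℂ (Set.range G)) :=
    FiniteDimensional.span_of_finite ℂ (Set.finite_range G)
  have h3 := Submodule.finrank_mono hle
  have h4 := finrank_span_eq_card hli
  have h5 := finrank_range_le_card (R := ℂ) G
  rw [Set.finrank] at h5
  simp only [Fintype.card_fin] at h4 h5
  omega

/-- Away from the given points the conductor is trivial. -/
theorem exists_form_mem_sectionConductor_of_notMem (hx : LinearIndependent ℂ x)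
    (hbir : IntermediateField.adjoin ℂ {z : K | ∃ i j, z = x i / x j} = ⊤)
    {ω : ⋀[K]^2 Ω[K⁄ℂ]} (hω : ω ≠ 0) (hy : PowersGenerated x y) {p : P4}
    (hp : ¬ IsSingularPoint (RingHom.ker (gradedHom x)) p) :
    ∃ H ∈ sectionConductor x y, (∃ d, H.IsHomogeneous d) ∧ eval p.rep H ≠ 0 := by
  by_cases hmem : p ∈ projZeros (RingHom.ker (gradedHom x) : Set CoordRing)
  · refine exists_form_mem_sectionConductor_of_smooth hx hbir hω hy p.rep_nonzero
      (fun f hf => hmem f hf) ?_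
    by_contra hrank
    exact hp ⟨hmem, hrank⟩
  -- Off the image, a homogeneous equation that is nonzero at the point belongs to the conductor
  -- because it acts as zero.
  · obtain ⟨f, hf, hf0⟩ : ∃ f, gradedHom x f = 0 ∧ eval p.rep f ≠ 0 := by
      by_contra hcon
      push Not at hcon
      exact hmem fun f hf => hcon f hf
    obtain ⟨n, hn⟩ : ∃ n, eval p.rep (homogeneousComponent n f) ≠ 0 := by
      by_contra hcon
      push Not at hcon
      apply hf0
      rw [← sum_homogeneousComponent f, map_sum]
      exact Finset.sum_eq_zero fun n _ => hcon n
    refine ⟨homogeneousComponent n f, fun i => ?_, ⟨n, homogeneousComponent_isHomogeneous n f⟩, hn⟩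
    rw [gradedHom_homogeneousComponent_eq_zero x hf, zero_mul]
    exact zero_mem _

theorem eval_smul_of_isHomogeneous {σ k : Type*} [Field k] {f : MvPolynomial σ k} {d : ℕ}
    (hf : f.IsHomogeneous d) (a : k) (u : σ → k) : eval (a • u) f = a ^ d * eval u f := by
  rw [eval_eq, eval_eq, Finset.mul_sum]
  refine Finset.sum_congr rfl fun m hm => ?_
  simp only [Pi.smul_apply, smul_eq_mul, mul_pow, Finset.prod_mul_distrib]
  rw [Finset.prod_pow_eq_pow_sum, ← hf.degree_eq_sum_deg_support hm]
  ring

theorem exists_linear_form_of_notMem_span {v q : Fin 5 → ℂ} (hq : q ∉ Submodule.span ℂ {v}) :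
    ∃ l : CoordRing, l.IsHomogeneous 1 ∧ eval v l = 0 ∧ eval q l ≠ 0 := by
  obtain ⟨φ, hφq, hφv⟩ := Submodule.exists_le_ker_of_notMem hq
  set l : CoordRing := ∑ i, C (φ (Pi.single i 1)) * X i with hl
  have heval : ∀ u, eval u l = φ u := by
    intro u
    conv_rhs => rw [← Finset.univ_sum_single u, map_sum]
    rw [hl, map_sum]
    refine Finset.sum_congr rfl fun i _ => ?_
    have : (Pi.single i (u i) : Fin 5 → ℂ) = u i • Pi.single i 1 := by
      rw [← Pi.single_smul', smul_eq_mul, mul_one]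
    rw [map_mul, eval_C, eval_X, this, map_smul, smul_eq_mul, mul_comm]
  refine ⟨l, IsHomogeneous.sum _ _ _ fun i _ => isHomogeneous_C_mul_X _ i, ?_, ?_⟩
  · rw [heval]
    exact hφv (Submodule.mem_span_singleton_self _)
  · rwa [heval]

theorem rep_notMem_span_rep {p q : P4} (hpq : p ≠ q) :
    p.rep ∉ Submodule.span ℂ {q.rep} := by
  rw [Submodule.mem_span_singleton]
  rintro ⟨a, ha⟩
  have hli := Projectivization.linearIndependent_pair_iff_ne.2 hpq.symm
  rw [LinearIndependent.pair_iff' q.rep_nonzero] at hli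
  exact hli a ha

/-- At each of finitely many improper double points which are the only singular points, the
quotient by the coordinate ring of the module generated by `1, y 0, y 1` is killed by the maximal
ideal. -/
theorem exists_mul_mem_sectionConductor (hx : LinearIndependent ℂ x)
    (hbir : IntermediateField.adjoin ℂ {z : K | ∃ i j, z = x i / x j} = ⊤)
    {ω : ⋀[K]^2 Ω[K⁄ℂ]} (hω : ω ≠ 0) (hy : PowersGenerated x y) {ι : Type*} [Fintype ι]
    {P : ι → P4} (hP : Function.Injective P)
    (hsing : ∀ p, IsSingularPoint (RingHom.ker (gradedHom x)) p → p ∈ Set.range P) (i : ι)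
    (hp : IsImproperDoublePoint (RingHom.ker (gradedHom x)) (P i))
    {l : CoordRing} (hl : l.IsHomogeneous 1) (hl0 : eval (P i).rep l = 0) :
    ∃ H : CoordRing, eval (P i).rep H ≠ 0 ∧ H * l ∈ sectionConductor x y := by
  classical
  -- The product of these forms vanishes at all the other points but not at P i; the factor for j =
  -- i is just a coordinate not vanishing there.
  have hsep : ∀ j : ι, ∃ g : CoordRing, g.IsHomogeneous 1 ∧ (j ≠ i → eval (P j).rep g = 0) ∧
      eval (P i).rep g ≠ 0 := by
    intro j
    by_cases hji : j = i
    · obtain ⟨k, hk⟩ : ∃ k, (P i).rep k ≠ 0 := Function.ne_iff.1 (P i).rep_nonzero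
      exact ⟨X k, isHomogeneous_X _ _, fun h => absurd hji h, by simpa using hk⟩
    · obtain ⟨g, hg, h1, h2⟩ := exists_linear_form_of_notMem_span
        (rep_notMem_span_rep (hP.ne (Ne.symm hji)))
      exact ⟨g, hg, fun _ => h1, h2⟩
  choose g hg hg0 hgi using hsep
  have hscale : ∀ (p : P4) (u : Fin 5 → ℂ) (hu : u ≠ 0), p = Projectivization.mk ℂ u hu →
      ∀ (f : CoordRing) (d : ℕ), f.IsHomogeneous d → (eval u f = 0 ↔ eval p.rep f = 0) := by
    rintro p u hu rfl f d hf
    obtain ⟨a, ha⟩ := Projectivization.exists_smul_eq_mk_rep ℂ u hu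
    rw [← ha, Units.smul_def, eval_smul_of_isHomogeneous hf, mul_eq_zero]
    simp
  refine exists_mul_mem_sectionConductor_of_improper hx hy hp (g := ∏ j, g j) ?_ ?_ hl hl0
  · rw [map_prod]
    exact Finset.prod_ne_zero_iff.2 fun j _ => hgi j
  · intro l hl hl0
    -- Nullstellensatz: apart from the origin, the conductor vanishes only over the points P j. The
    -- product kills those with j ≠ i, and `l` kills P i and the origin.
    have hrad : (∏ j, g j) * l ∈ (sectionConductor x y).radical := by
      rw [← vanishingIdeal_zeroLocus_eq_radical (K := ℂ), mem_vanishingIdeal_iff]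
      intro u hu
      rw [mem_zeroLocus_iff] at hu
      rw [aeval_eq_eval]
      change eval u _ = 0
      rw [map_mul, mul_eq_zero]
      by_cases hu0 : u = 0
      · right
        rw [hu0, eval_zero, ← mem_idealOfVars_iff, ← pow_one (idealOfVars _ _)]
        exact hl.mem_pow_idealOfVars
      · set p : P4 := Projectivization.mk ℂ u hu0 with hpdef
        by_cases hpP : p ∈ Set.range P
        · obtain ⟨j, hj⟩ := hpP
          by_cases hji : j = i
          · right
            rw [hscale p u hu0 hpdef l 1 hl, ← hj, hji, hl0]
          · left
            rw [map_prod]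
            refine Finset.prod_eq_zero (Finset.mem_univ j) ?_
            rw [hscale p u hu0 hpdef _ 1 (hg j), ← hj, hg0 j hji]
        · obtain ⟨H, hH, ⟨d, hd⟩, hH0⟩ := exists_form_mem_sectionConductor_of_notMem hx hbir hω hy
            (fun h => hpP (hsing p h))
          refine absurd ?_ hH0
          rw [← hscale p u hu0 hpdef H d hd]
          exact hu H hH
    exact hrad

end SingularLocus

/-! ## Degeneracy of the linear part of a symmetric presentation -/

section Presentation

open MvPolynomial Matrix

theorem dotProduct_J_mulVec {R : Type*} [CommRing R] (a b : Fin 3 ⊕ Fin 3 → R) :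
    a ⬝ᵥ (J (Fin 3) R *ᵥ b) =
      ∑ j, (a (Sum.inr j) * b (Sum.inl j) - a (Sum.inl j) * b (Sum.inr j)) := by
  simp [dotProduct, J, fromBlocks_mulVec, Fintype.sum_sum_type, Finset.sum_sub_distrib, neg_mulVec]
  ring

theorem dotProduct_J_mulVec_self {R : Type*} [CommRing R] (a : Fin 3 ⊕ Fin 3 → R) :
    a ⬝ᵥ (J (Fin 3) R *ᵥ a) = 0 := by
  rw [dotProduct_J_mulVec]
  exact Finset.sum_eq_zero fun j _ => by ring

theorem dotProduct_J_mulVec_swap {R : Type*} [CommRing R] (a b : Fin 3 ⊕ Fin 3 → R) :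
    a ⬝ᵥ (J (Fin 3) R *ᵥ b) = -(b ⬝ᵥ (J (Fin 3) R *ᵥ a)) := by
  rw [dotProduct_J_mulVec, dotProduct_J_mulVec, ← Finset.sum_neg_distrib]
  exact Finset.sum_congr rfl fun j _ => by ring

theorem map_J_mulVec {R S : Type*} [CommRing R] [CommRing S] (φ : R →+* S)
    (a : Fin 3 ⊕ Fin 3 → R) (k : Fin 3 ⊕ Fin 3) :
    φ ((J (Fin 3) R *ᵥ a) k) = (J (Fin 3) S *ᵥ fun k => φ (a k)) k := by
  rw [RingHom.map_mulVec, map_J]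
  rfl

/-- The square of J is -1. -/
theorem J_mulVec_injective {R : Type*} [CommRing R] :
    Function.Injective fun a : Fin 3 ⊕ Fin 3 → R => J (Fin 3) R *ᵥ a := by
  intro a b h
  have := congrArg (fun c => -(J (Fin 3) R *ᵥ c)) h
  simpa [mulVec_mulVec, J_squared, neg_mulVec] using this

theorem map_dotProduct_eq {R S ι : Type*} [CommRing R] [CommRing S] [Fintype ι] (φ : R →+* S)
    (a b : ι → R) : φ (a ⬝ᵥ b) = (fun k => φ (a k)) ⬝ᵥ fun k => φ (b k) := by
  simp [dotProduct]

/-- Symplectic completion of an isotropic pair. -/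
theorem exists_basis_of_isotropic_pair {ρ₀ ρ₁ : Fin 3 ⊕ Fin 3 → ℂ}
    (hli : LinearIndependent ℂ ![ρ₀, ρ₁]) (h01 : ρ₀ ⬝ᵥ (J (Fin 3) ℂ *ᵥ ρ₁) = 0) :
    ∃ κ₀ κ₁ g₀ g₁ : Fin 3 ⊕ Fin 3 → ℂ,
      (ρ₀ ⬝ᵥ κ₀ = 1 ∧ ρ₁ ⬝ᵥ κ₀ = 0 ∧ ρ₀ ⬝ᵥ κ₁ = 0 ∧ ρ₁ ⬝ᵥ κ₁ = 1) ∧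
      (ρ₀ ⬝ᵥ g₀ = 0 ∧ ρ₁ ⬝ᵥ g₀ = 0 ∧ ρ₀ ⬝ᵥ g₁ = 0 ∧ ρ₁ ⬝ᵥ g₁ = 0) ∧
      LinearIndependent ℂ (Sum.elim ![κ₀, J (Fin 3) ℂ *ᵥ ρ₀, g₀] ![κ₁, J (Fin 3) ℂ *ᵥ ρ₁, g₁]) := by
  set Φ := (Matrix.of ![ρ₀, ρ₁]).mulVecLin with hΦ
  have hΦ0 : ∀ u, Φ u 0 = ρ₀ ⬝ᵥ u := fun u => rfl
  have hΦ1 : ∀ u, Φ u 1 = ρ₁ ⬝ᵥ u := fun u => rfl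
  have hrk : Module.finrank ℂ (LinearMap.range Φ) = 2 := by
    have := LinearIndependent.rank_matrix (M := Matrix.of ![ρ₀, ρ₁]) hli
    simpa [Matrix.rank] using this
  have hsurj : Function.Surjective Φ := by
    rw [← LinearMap.range_eq_top]
    exact Submodule.eq_top_of_finrank_eq (by rw [hrk]; simp)
  have hker : Module.finrank ℂ (LinearMap.ker Φ) = 4 := by
    have := LinearMap.finrank_range_add_finrank_ker Φ
    rw [hrk, Module.finrank_fintype_fun_eq_card] at this
    simp only [Fintype.card_sum, Fintype.card_fin] at this
    omega
  have h10 : ρ₁ ⬝ᵥ (J (Fin 3) ℂ *ᵥ ρ₀) = 0 := by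
    rw [dotProduct_J_mulVec_swap, h01, neg_zero]
  have hmem : ∀ u, ρ₀ ⬝ᵥ u = 0 → ρ₁ ⬝ᵥ u = 0 → u ∈ LinearMap.ker Φ := by
    intro u h0 h1
    rw [LinearMap.mem_ker]
    funext a
    fin_cases a
    · exact h0
    · exact h1
  have m0 := hmem _ (dotProduct_J_mulVec_self ρ₀) h10
  have m1 := hmem _ h01 (dotProduct_J_mulVec_self ρ₁)
  have hJli : LinearIndependent ℂ
      (![⟨J (Fin 3) ℂ *ᵥ ρ₀, m0⟩, ⟨J (Fin 3) ℂ *ᵥ ρ₁, m1⟩] : Fin 2 → LinearMap.ker Φ) := by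
    rw [LinearIndependent.pair_iff] at hli ⊢
    intro s t hst
    apply hli s t
    apply J_mulVec_injective
    have := congrArg Subtype.val hst
    simpa [mulVec_add, mulVec_smul] using this
  obtain ⟨g₀, hg₀⟩ := exists_linearIndependent_snoc_of_lt_finrank hJli (by omega)
  obtain ⟨g₁, hg₁⟩ := exists_linearIndependent_snoc_of_lt_finrank hg₀ (by omega)
  obtain ⟨κ₀, hκ₀⟩ := hsurj (Pi.single 0 1)
  obtain ⟨κ₁, hκ₁⟩ := hsurj (Pi.single 1 1)
  have k00 : ρ₀ ⬝ᵥ κ₀ = 1 := by rw [← hΦ0, hκ₀]; simp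
  have k10 : ρ₁ ⬝ᵥ κ₀ = 0 := by rw [← hΦ1, hκ₀]; simp
  have k01 : ρ₀ ⬝ᵥ κ₁ = 0 := by rw [← hΦ0, hκ₁]; simp
  have k11 : ρ₁ ⬝ᵥ κ₁ = 1 := by rw [← hΦ1, hκ₁]; simp
  have hg : ∀ g : LinearMap.ker Φ, ρ₀ ⬝ᵥ g.1 = 0 ∧ ρ₁ ⬝ᵥ g.1 = 0 := fun g =>
    ⟨congrFun g.2 0, congrFun g.2 1⟩
  refine ⟨κ₀, κ₁, g₀.1, g₁.1, ⟨k00, k10, k01, k11⟩,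
    ⟨(hg g₀).1, (hg g₀).2, (hg g₁).1, (hg g₁).2⟩, ?_⟩
  rw [Fintype.linearIndependent_iff]
  intro c hc
  rw [Fintype.sum_sum_type, Fin.sum_univ_three, Fin.sum_univ_three] at hc
  simp only [Sum.elim_inl, Sum.elim_inr, Matrix.cons_val] at hc
  -- Pairing with ρ₀ and ρ₁ isolates the coefficients of κ₀ and κ₁; the remaining vectors form a
  -- basis of the common kernel.
  have e0 := congrArg (fun u => ρ₀ ⬝ᵥ u) hc
  have e1 := congrArg (fun u => ρ₁ ⬝ᵥ u) hc
  simp only [dotProduct_add, dotProduct_smul, dotProduct_zero, k00, k01, k10, k11, (hg g₀).1,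
    (hg g₀).2, (hg g₁).1, (hg g₁).2, h01, h10, dotProduct_J_mulVec_self, smul_eq_mul, mul_one,
    mul_zero, add_zero, zero_add] at e0 e1
  rw [e0, e1, zero_smul, zero_smul, zero_add, zero_add] at hc
  have h3 := Fintype.linearIndependent_iff.1 hg₁
    ![c (Sum.inl 1), c (Sum.inr 1), c (Sum.inl 2), c (Sum.inr 2)] (by
      rw [Fin.sum_univ_four]
      apply Subtype.ext
      refine Eq.trans ?_ hc
      change c (Sum.inl 1) • (J (Fin 3) ℂ *ᵥ ρ₀) + c (Sum.inr 1) • (J (Fin 3) ℂ *ᵥ ρ₁) +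
        c (Sum.inl 2) • g₀.1 + c (Sum.inr 2) • g₁.1 = _
      abel)
  rintro (i | i)
  · fin_cases i
    · exact e0
    · exact h3 0
    · exact h3 2
  · fin_cases i
    · exact e1
    · exact h3 1
    · exact h3 3

/-- A module with presentation matrix of symplectic type with rows `r₀, r₁, r₂` is locally a
complete intersection where `r₁, r₂` are independent: the annihilator of the first generator is
locally generated by two elements. -/
theorem exists_two_generators_of_linearIndependent {r₀ r₁ r₂ : Fin 3 ⊕ Fin 3 → CoordRing}
    (h01 : r₀ ⬝ᵥ (J (Fin 3) CoordRing *ᵥ r₁) = 0) (h02 : r₀ ⬝ᵥ (J (Fin 3) CoordRing *ᵥ r₂) = 0)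
    (h12 : r₁ ⬝ᵥ (J (Fin 3) CoordRing *ᵥ r₂) = 0) {v : Fin 5 → ℂ}
    (hli : LinearIndependent ℂ ![fun k => eval v (r₁ k), fun k => eval v (r₂ k)]) :
    ∃ g : Fin 2 → Fin 3 ⊕ Fin 3 → CoordRing, (∀ i, r₁ ⬝ᵥ g i = 0 ∧ r₂ ⬝ᵥ g i = 0) ∧
      ∃ E : CoordRing, eval v E ≠ 0 ∧ ∀ d, r₁ ⬝ᵥ d = 0 → r₂ ⬝ᵥ d = 0 →
        ∃ a b, E * (r₀ ⬝ᵥ d) = a * (r₀ ⬝ᵥ g 0) + b * (r₀ ⬝ᵥ g 1) := by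
  have hρ : (fun k => eval v (r₁ k)) ⬝ᵥ (J (Fin 3) ℂ *ᵥ fun k => eval v (r₂ k)) = 0 := by
    have := congrArg (eval v) h12
    rw [map_dotProduct_eq, map_zero] at this
    rw [← this]
    congr 1
    funext k
    rw [map_J_mulVec]
  obtain ⟨κ₀, κ₁, γ₀, γ₁, ⟨k00, k10, k01, k11⟩, ⟨g00, g10, g01, g11⟩, hbasis⟩ :=
    exists_basis_of_isotropic_pair hli hρ
  have hCdot : ∀ (r : Fin 3 ⊕ Fin 3 → CoordRing) (u : Fin 3 ⊕ Fin 3 → ℂ),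
      eval v (r ⬝ᵥ fun k => C (u k)) = (fun k => eval v (r k)) ⬝ᵥ u := by
    intro r u
    rw [map_dotProduct_eq]
    simp only [eval_C]
  set c₀ : Fin 3 ⊕ Fin 3 → CoordRing := fun k => C (κ₀ k)
  set c₁ : Fin 3 ⊕ Fin 3 → CoordRing := fun k => C (κ₁ k)
  set p := r₁ ⬝ᵥ c₀ with hp
  set q := r₁ ⬝ᵥ c₁ with hq
  set r := r₂ ⬝ᵥ c₀ with hr
  set s := r₂ ⬝ᵥ c₁ with hs
  have ep : eval v p = 1 := by rw [hp, hCdot, k00]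
  have eq : eval v q = 0 := by rw [hq, hCdot, k01]
  have er : eval v r = 0 := by rw [hr, hCdot, k10]
  have es : eval v s = 1 := by rw [hs, hCdot, k11]
  set D := p * s - q * r with hD
  have eD : eval v D = 1 := by
    rw [hD, map_sub, map_mul, map_mul, ep, eq, es]
    ring
  have hD0 : D ≠ 0 := by
    intro h
    rw [h, map_zero] at eD
    exact zero_ne_one eD
  -- Cramer's rule corrects D γ by multiples of c₀, c₁ so that it is annihilated by both rows. At v
  -- the correction vanishes for γ in the kernel, and D takes the value 1.
  set g : (Fin 3 ⊕ Fin 3 → ℂ) → Fin 3 ⊕ Fin 3 → CoordRing := fun γ =>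
    D • (fun k => C (γ k)) - (s * (r₁ ⬝ᵥ fun k => C (γ k)) - q * (r₂ ⬝ᵥ fun k => C (γ k))) • c₀ -
      (p * (r₂ ⬝ᵥ fun k => C (γ k)) - r * (r₁ ⬝ᵥ fun k => C (γ k))) • c₁ with hg
  have hg1 : ∀ γ, r₁ ⬝ᵥ g γ = 0 := by
    intro γ
    simp only [hg, dotProduct_sub, dotProduct_smul, smul_eq_mul, ← hp, ← hq, hD]
    ring
  have hg2 : ∀ γ, r₂ ⬝ᵥ g γ = 0 := by
    intro γ
    simp only [hg, dotProduct_sub, dotProduct_smul, smul_eq_mul, ← hr, ← hs, hD]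
    ring
  have hgv : ∀ γ, (fun k => eval v (r₁ k)) ⬝ᵥ γ = 0 → (fun k => eval v (r₂ k)) ⬝ᵥ γ = 0 →
      ∀ k, eval v (g γ k) = γ k := by
    intro γ h1 h2 k
    simp only [hg, Pi.sub_apply, Pi.smul_apply, smul_eq_mul, map_sub, map_mul, hCdot, h1, h2, eD,
      eval_C]
    ring
  set cols : Fin 3 ⊕ Fin 3 → Fin 3 ⊕ Fin 3 → CoordRing :=
    Sum.elim ![c₀, J (Fin 3) CoordRing *ᵥ r₁, g γ₀] ![c₁, J (Fin 3) CoordRing *ᵥ r₂, g γ₁]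
    with hcols
  set Q : Matrix (Fin 3 ⊕ Fin 3) (Fin 3 ⊕ Fin 3) CoordRing := Matrix.of fun k i => cols i k with hQ
  have hQv : eval v Q.det ≠ 0 := by
    rw [RingHom.map_det]
    have hmat : (eval v).mapMatrix Q = (Matrix.of (Sum.elim
        ![κ₀, J (Fin 3) ℂ *ᵥ (fun k => eval v (r₁ k)), γ₀]
        ![κ₁, J (Fin 3) ℂ *ᵥ (fun k => eval v (r₂ k)), γ₁]))ᵀ := by
      ext k i
      rw [RingHom.mapMatrix_apply, Matrix.map_apply, transpose_apply, hQ, Matrix.of_apply,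
        Matrix.of_apply, hcols]
      rcases i with i | i
      · fin_cases i
        · exact eval_C _
        · exact map_J_mulVec _ _ _
        · exact hgv γ₀ g00 g10 k
      · fin_cases i
        · exact eval_C _
        · exact map_J_mulVec _ _ _
        · exact hgv γ₁ g01 g11 k
    rw [hmat, det_transpose, ← isUnit_iff_ne_zero, ← isUnit_iff_isUnit_det,
      ← linearIndependent_rows_iff_isUnit]
    exact hbasis
  refine ⟨![g γ₀, g γ₁], fun i => ?_, Q.det, hQv, fun d hd1 hd2 => ?_⟩
  · fin_cases i
    · exact ⟨hg1 _, hg2 _⟩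
    · exact ⟨hg1 _, hg2 _⟩
  · set a := Q.adjugate *ᵥ d with ha
    have hQa : Q *ᵥ a = Q.det • d := by
      rw [ha, mulVec_mulVec, mul_adjugate, smul_mulVec, one_mulVec]
    have hrow : ∀ w : Fin 3 ⊕ Fin 3 → CoordRing, Q.det * (w ⬝ᵥ d) =
        a (Sum.inl 0) * (w ⬝ᵥ c₀) + a (Sum.inl 1) * (w ⬝ᵥ (J (Fin 3) CoordRing *ᵥ r₁)) +
          a (Sum.inl 2) * (w ⬝ᵥ g γ₀) + (a (Sum.inr 0) * (w ⬝ᵥ c₁) +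
          a (Sum.inr 1) * (w ⬝ᵥ (J (Fin 3) CoordRing *ᵥ r₂)) + a (Sum.inr 2) * (w ⬝ᵥ g γ₁)) := by
      intro w
      have h1 : Q *ᵥ a = ∑ i, a i • cols i := by
        funext k
        simp only [mulVec, dotProduct, hQ, Matrix.of_apply, Finset.sum_apply, Pi.smul_apply,
          smul_eq_mul]
        exact Finset.sum_congr rfl fun i _ => mul_comm _ _
      rw [← smul_eq_mul, ← dotProduct_smul, ← hQa, h1, dotProduct_sum, Fintype.sum_sum_type,
        Fin.sum_univ_three, Fin.sum_univ_three]
      simp only [dotProduct_smul, smul_eq_mul]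
      rfl
    have h21 : r₂ ⬝ᵥ (J (Fin 3) CoordRing *ᵥ r₁) = 0 := by
      rw [dotProduct_J_mulVec_swap, h12, neg_zero]
    have e1 := hrow r₁
    have e2 := hrow r₂
    rw [hd1, dotProduct_J_mulVec_self, hg1, hg1, h12, ← hp, ← hq] at e1
    rw [hd2, dotProduct_J_mulVec_self, hg2, hg2, h21, ← hr, ← hs] at e2
    -- Since d is annihilated by r₁ and r₂, its coefficients along c₀, c₁ solve a homogeneous system
    -- with determinant D ≠ 0. The directions J r₁, J r₂ do not contribute to r₀ ⬝ᵥ d by isotropy,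
    -- so only the two g's remain.
    have a0 : a (Sum.inl 0) = 0 := by
      have : D * a (Sum.inl 0) = 0 := by
        rw [hD]
        linear_combination (-s) * e1 + q * e2
      exact (mul_eq_zero.1 this).resolve_left hD0
    have a1 : a (Sum.inr 0) = 0 := by
      have : D * a (Sum.inr 0) = 0 := by
        rw [hD]
        linear_combination r * e1 - p * e2
      exact (mul_eq_zero.1 this).resolve_left hD0
    refine ⟨a (Sum.inl 2), a (Sum.inr 2), ?_⟩
    rw [hrow r₀, a0, a1, h01, h02]
    simp

end Presentation

/-! ## Linear rows of the presentation at improper double points -/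

section LinearRows

open MvPolynomial Matrix

theorem eq_sum_of_isHomogeneous_one {f : CoordRing} (hf : f.IsHomogeneous 1) :
    f = ∑ j, C (constantCoeff (pderiv j f)) * X j := by
  rw [← homogeneousComponent_one_eq, homogeneousComponent_eq_self hf]

/-- The value at a vector of a tuple of linear forms, as a linear map. -/
noncomputable def linearValue {ι : Type*} (r : ι → CoordRing) : (Fin 5 → ℂ) →ₗ[ℂ] (ι → ℂ) :=
  LinearMap.pi fun k => ∑ j, constantCoeff (pderiv j (r k)) • LinearMap.proj j

theorem linearValue_apply {ι : Type*} {r : ι → CoordRing} (hr : ∀ k, (r k).IsHomogeneous 1)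
    (p : Fin 5 → ℂ) (k : ι) : linearValue r p k = eval p (r k) := by
  conv_rhs => rw [eq_sum_of_isHomogeneous_one (hr k), map_sum]
  simp [linearValue]

/-- The derivative in the direction of a vector. -/
noncomputable def directionalDerivation (q : Fin 5 → ℂ) : Derivation ℂ CoordRing CoordRing :=
  mkDerivation ℂ fun i => C (q i)

theorem directionalDerivation_of_isHomogeneous_one (q : Fin 5 → ℂ) {f : CoordRing}
    (hf : f.IsHomogeneous 1) : directionalDerivation q f = C (eval q f) := by
  rw [eq_sum_of_isHomogeneous_one hf, map_sum, map_sum, map_sum]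
  refine Finset.sum_congr rfl fun j _ => ?_
  rw [← smul_eq_C_mul, Derivation.map_smul, directionalDerivation, mkDerivation_X, smul_eval, eval_X, C_mul,
    smul_eq_C_mul]

/-- A combination of the linear rows of a presentation matrix. -/
noncomputable def linearRow (N : Matrix (Fin 3) (Fin 3 ⊕ Fin 3) CoordRing) (c : Fin 2 → ℂ) :
    Fin 3 ⊕ Fin 3 → CoordRing :=
  (C (c 0) : CoordRing) • N 1 + (C (c 1) : CoordRing) • N 2

variable {N : Matrix (Fin 3) (Fin 3 ⊕ Fin 3) CoordRing}

theorem isHomogeneous_linearRow (hN : ∀ i k, i ≠ 0 → (N i k).IsHomogeneous 1) (c : Fin 2 → ℂ)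
    (k : Fin 3 ⊕ Fin 3) : (linearRow N c k).IsHomogeneous 1 :=
  ((hN 1 k (by decide)).C_mul _).add ((hN 2 k (by decide)).C_mul _)

theorem linearRow_dotProduct (c : Fin 2 → ℂ) (d : Fin 3 ⊕ Fin 3 → CoordRing) :
    linearRow N c ⬝ᵥ d = C (c 0) * (N 1 ⬝ᵥ d) + C (c 1) * (N 2 ⬝ᵥ d) := by
  rw [linearRow, add_dotProduct, smul_dotProduct, smul_dotProduct, smul_eq_mul, smul_eq_mul]

theorem eval_linearRow (c : Fin 2 → ℂ) (p : Fin 5 → ℂ) (k : Fin 3 ⊕ Fin 3) :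
    eval p (linearRow N c k) = c 0 * eval p (N 1 k) + c 1 * eval p (N 2 k) := by
  simp [linearRow]

variable {K : Type*} [Field K] [Algebra ℂ K] {x : Fin 5 → K} {y : Fin 2 → K}

/-- The columns of `N` generate the relations between `1, y 0, y 1` over the coordinate ring. -/
def PresentsSections (x : Fin 5 → K) (y : Fin 2 → K)
    (N : Matrix (Fin 3) (Fin 3 ⊕ Fin 3) CoordRing) : Prop :=
  ∀ c : Fin 3 → CoordRing, gradedHom x (c 0) + gradedHom x (c 1) * Polynomial.monomial 2 (y 0) +
    gradedHom x (c 2) * Polynomial.monomial 2 (y 1) = 0 ↔ c ∈ Set.range N.mulVec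

/-- For h in the conductor, h (u 0 y 0 + u 1 y 1) is the image of a form z, so (-z, u 0 h, u 1 h) is
a relation and hence a combination of the columns of `N`. -/
theorem PresentsSections.exists_dotProduct_eq (hN : PresentsSections x y N) {h : CoordRing}
    (hh : h ∈ sectionConductor x y) (u : Fin 2 → ℂ) :
    ∃ d, ∀ c, linearRow N c ⬝ᵥ d = C (c 0 * u 0 + c 1 * u 1) * h := by
  obtain ⟨z₀, hz₀⟩ := hh 0
  obtain ⟨z₁, hz₁⟩ := hh 1
  have hz₀' : gradedHom x z₀ = gradedHom x h * Polynomial.monomial 2 (y 0) := hz₀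
  have hz₁' : gradedHom x z₁ = gradedHom x h * Polynomial.monomial 2 (y 1) := hz₁
  obtain ⟨d, hd⟩ := (hN ![-(C (u 0) * z₀ + C (u 1) * z₁), C (u 0) * h, C (u 1) * h]).1 (by
    simp only [Matrix.cons_val, map_neg, map_add, map_mul, hz₀', hz₁']
    ring)
  refine ⟨d, fun c => ?_⟩
  have h1 : N 1 ⬝ᵥ d = C (u 0) * h := congrFun hd 1
  have h2 : N 2 ⬝ᵥ d = C (u 1) * h := congrFun hd 2
  rw [linearRow_dotProduct, h1, h2]
  simp only [C_add, C_mul]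
  ring

/-- Where the module of sections has embedding colength one, a vanishing linear row vanishes
nowhere else, and its value is not the value of another row. -/
theorem PresentsSections.mem_span_of_linearValue_eq (hN : PresentsSections x y N)
    (hlin : ∀ i k, i ≠ 0 → (N i k).IsHomogeneous 1) {v : Fin 5 → ℂ}
    (hv : ∀ l : CoordRing, l.IsHomogeneous 1 → eval v l = 0 →
      ∃ H : CoordRing, eval v H ≠ 0 ∧ H * l ∈ sectionConductor x y)
    {c b : Fin 2 → ℂ} (hcb : c 0 * b 1 - c 1 * b 0 ≠ 0)
    (hc : ∀ k, eval v (linearRow N c k) = 0) {q : Fin 5 → ℂ} {t : ℂ}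
    (hq : ∀ k, eval q (linearRow N c k) = t * eval v (linearRow N b k)) :
    q ∈ Submodule.span ℂ {v} := by
  by_contra hqv
  obtain ⟨l, hl, hlv, hlq⟩ := exists_linear_form_of_notMem_span hqv
  obtain ⟨H, hH, hHl⟩ := hv l hl hlv
  -- With this choice row c pairs with d to the nonzero determinant times H l. Row b pairs with d to
  -- zero at v, since l vanishes there.
  obtain ⟨d, hd⟩ := hN.exists_dotProduct_eq hHl ![b 1, -b 0]
  have hdc := hd c
  have hdb := congrArg (eval v) (hd b)
  rw [map_dotProduct_eq] at hdb
  simp only [Matrix.cons_val_zero, Matrix.cons_val_one, map_mul, hlv, mul_zero] at hdb hdc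
  -- The derivative at v in direction q: on the left row c vanishes at v and its derivative is t
  -- times the value of row b, giving 0; on the right remains the determinant times H(v) l(q), which
  -- is nonzero.
  have hder := congrArg (fun f => eval v (directionalDerivation q f)) hdc
  have hsum : eval v (directionalDerivation q (linearRow N c ⬝ᵥ d)) = 0 := by
    rw [dotProduct, map_sum, map_sum]
    have : ∀ k, eval v (directionalDerivation q (linearRow N c k * d k)) =
        t * (eval v (linearRow N b k) * eval v (d k)) := by
      intro k
      rw [Derivation.leibniz, smul_eq_mul, smul_eq_mul, map_add, map_mul, map_mul, hc, zero_mul,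
        zero_add, directionalDerivation_of_isHomogeneous_one q (isHomogeneous_linearRow hlin c k),
        eval_C, hq]
      ring
    rw [Finset.sum_congr rfl fun k _ => this k, ← Finset.mul_sum]
    rw [dotProduct] at hdb
    rw [hdb, mul_zero]
  simp only [hsum] at hder
  rw [← smul_eq_C_mul, Derivation.map_smul, Derivation.leibniz, smul_eval, smul_eq_mul, smul_eq_mul, map_add,
    map_mul, map_mul, hlv, zero_mul, add_zero, directionalDerivation_of_isHomogeneous_one q hl,
    eval_C] at hder
  refine mul_ne_zero ?_ (mul_ne_zero hH hlq) hder.symm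
  rw [mul_neg, ← sub_eq_add_neg]
  exact hcb

/-- At an improper double point some linear row of the presentation vanishes. -/
theorem PresentsSections.exists_linearRow_eq_zero (hN : PresentsSections x y N)
    (hx : LinearIndependent ℂ x)
    (hJ : ∀ i j, N i ⬝ᵥ (J (Fin 3) CoordRing *ᵥ N j) = 0) {p : P4}
    (hp : IsImproperDoublePoint (RingHom.ker (gradedHom x)) p) :
    ∃ c : Fin 2 → ℂ, c ≠ 0 ∧ ∀ k, eval p.rep (linearRow N c k) = 0 := by
  by_contra hcon
  push Not at hcon
  have hli : LinearIndependent ℂ ![fun k => eval p.rep (N 1 k), fun k => eval p.rep (N 2 k)] := by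
    rw [LinearIndependent.pair_iff]
    intro s t hst
    by_contra hne
    obtain ⟨k, hk⟩ := hcon ![s, t] (by
      intro h
      exact hne ⟨congrFun h 0, congrFun h 1⟩)
    apply hk
    rw [eval_linearRow]
    exact congrFun hst k
  obtain ⟨g, hg, E, hE, hgen⟩ := exists_two_generators_of_linearIndependent (hJ 0 1) (hJ 0 2)
    (hJ 1 2) hli
  have hker : ∀ d, N 1 ⬝ᵥ d = 0 → N 2 ⬝ᵥ d = 0 → gradedHom x (N 0 ⬝ᵥ d) = 0 := by
    intro d h1 h2
    have := (hN (N *ᵥ d)).2 ⟨d, rfl⟩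
    change gradedHom x (N 0 ⬝ᵥ d) + gradedHom x (N 1 ⬝ᵥ d) * _ + gradedHom x (N 2 ⬝ᵥ d) * _ = 0
      at this
    simpa [h1, h2] using this
  obtain ⟨F, hF, hFE⟩ := not_locally_generated_by_two_of_improper hx hp
    (f := fun a => N 0 ⬝ᵥ g a) fun a => hker _ (hg a).1 (hg a).2
  -- Equations F of the image are the relations (F, 0, 0), that is, the values of the first row on
  -- vectors annihilated by both linear rows.
  obtain ⟨d, hd⟩ := (hN ![F, 0, 0]).1 (by simp [hF])
  obtain ⟨a, b, hab⟩ := hgen d (congrFun hd 1) (congrFun hd 2)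
  have h0 : N 0 ⬝ᵥ d = F := congrFun hd 0
  rw [h0] at hab
  exact hE (hFE E a b hab)

end LinearRows

/-! ## Symplectic bases adapted to isotropic nets of linear maps -/

section Symplectic

open Matrix

variable {k E V : Type*} [Field k] [CharZero k] [AddCommGroup E] [Module k E] [AddCommGroup V]
  [Module k V] [FiniteDimensional k E] [FiniteDimensional k V]

/-- The radical of an alternating form on a space of odd dimension. -/
theorem three_le_finrank_orthogonal_top {T : LinearMap.BilinForm k E} (hT : T.IsAlt)
    (hE : Module.finrank k E = 5) (h2 : 2 ≤ Module.finrank k (T.orthogonal ⊤)) :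
    3 ≤ Module.finrank k (T.orthogonal ⊤) := by
  by_contra hcon
  -- If the radical had dimension 2, the form on a complement of dimension 3 would have a skew Gram
  -- matrix of odd size, hence singular. This yields a further radical vector in the complement.
  obtain ⟨C, hC⟩ := Submodule.exists_isCompl (T.orthogonal ⊤)
  have hC3 : Module.finrank k C = 3 := by
    have := Submodule.finrank_add_eq_of_isCompl hC
    omega
  let b := Module.finBasisOfFinrankEq k C hC3
  let G : Matrix (Fin 3) (Fin 3) k := Matrix.of fun i j => T (b i) (b j)
  have hG : Gᵀ = -G := by
    ext i j
    exact (hT.neg_eq (b i : E) (b j : E)).symm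
  have hdet : G.det = 0 := by
    have h := congrArg Matrix.det hG
    rw [det_transpose, det_neg, Fintype.card_fin] at h
    have h' : (2 : k) * G.det = 0 := by linear_combination h
    exact (mul_eq_zero.1 h').resolve_left two_ne_zero
  obtain ⟨a, ha0, ha⟩ := Matrix.exists_mulVec_eq_zero_iff.2 hdet
  set q : C := ∑ j, a j • b j with hq
  have hq0 : q ≠ 0 := by
    intro h
    exact ha0 (funext fun j => Fintype.linearIndependent_iff.1 b.linearIndependent a h j)
  have hbq : ∀ i, T (b i) q = 0 := by
    intro i
    have := congrFun ha i
    rw [hq]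
    simp only [Submodule.coe_sum, Submodule.coe_smul, map_sum, map_smul, smul_eq_mul]
    simp only [mulVec, dotProduct, G, Matrix.of_apply, Pi.zero_apply] at this
    rw [← this]
    exact Finset.sum_congr rfl fun j _ => mul_comm _ _
  have hCq : ∀ c : C, T c q = 0 := by
    intro c
    rw [← b.sum_repr c]
    simp only [Submodule.coe_sum, Submodule.coe_smul, map_sum, map_smul, LinearMap.sum_apply,
      LinearMap.smul_apply, hbq, smul_zero, Finset.sum_const_zero]
  have hmem : (q : E) ∈ T.orthogonal ⊤ := by
    intro n _
    obtain ⟨r, hr, c, hc, rfl⟩ := Submodule.mem_sup.1 (hC.sup_eq_top ▸ Submodule.mem_top : n ∈ _)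
    change T (r + c) q = 0
    rw [map_add, LinearMap.add_apply, hCq ⟨c, hc⟩, add_zero, ← hT.neg_eq, hr q trivial, neg_zero]
  exact hq0 (Subtype.ext (Submodule.disjoint_def.1 hC.disjoint _ hmem q.2))

/-- For two linear maps from a space of dimension five to a symplectic space of dimension six,
mutually isotropic and with distinct one-dimensional kernels, the orthogonal of the range of the
first lies in the range of the second. -/
theorem orthogonal_range_le_range {B : LinearMap.BilinForm k V} (hB : B.Nondegenerate)
    (hE : Module.finrank k E = 5) (hV : Module.finrank k V = 6)
    {s t : E →ₗ[k] V} (hst : ∀ p, B (s p) (t p) = 0) {v w : E}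
    (hs : LinearMap.ker s = Submodule.span k {v}) (ht : LinearMap.ker t = Submodule.span k {w})
    (hv0 : v ≠ 0) (hwv : w ∉ Submodule.span k {v}) :
    B.orthogonal (LinearMap.range s) ≤ LinearMap.range t := by
  have hw0 : w ≠ 0 := fun h => hwv (h ▸ zero_mem _)
  set T : LinearMap.BilinForm k E := B.compl₁₂ s t with hTdef
  have hTapp : ∀ p q, T p q = B (s p) (t q) := fun p q => rfl
  -- The radical of T is the preimage under t of the orthogonal of im s. It contains w because t w =
  -- 0, and v because s v = 0 and T is alternating.
  have hT : T.IsAlt := fun p => hst p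
  have hR : ∀ q, q ∈ T.orthogonal ⊤ ↔ t q ∈ B.orthogonal (LinearMap.range s) := by
    intro q
    constructor
    · rintro h _ ⟨p, rfl⟩
      exact h p trivial
    · intro h p _
      exact h _ ⟨p, rfl⟩
  have hsv : s v = 0 := by
    rw [← LinearMap.mem_ker, hs]
    exact Submodule.mem_span_singleton_self v
  have htw : t w = 0 := by
    rw [← LinearMap.mem_ker, ht]
    exact Submodule.mem_span_singleton_self w
  have hvR : v ∈ T.orthogonal ⊤ := by
    intro p _
    change T p v = 0
    rw [← hT.neg_eq, hTapp, hsv, map_zero, LinearMap.zero_apply, neg_zero]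
  have hwR : w ∈ T.orthogonal ⊤ := by
    rw [hR, htw]
    exact zero_mem _
  have h2 : 2 ≤ Module.finrank k (T.orthogonal ⊤) := by
    have hli : LinearIndependent k ![v, w] := by
      rw [LinearIndependent.pair_iff' hv0]
      intro a ha
      exact hwv (Submodule.mem_span_singleton.2 ⟨a, ha⟩)
    have hle : Submodule.span k (Set.range ![v, w]) ≤ T.orthogonal ⊤ := by
      rw [Submodule.span_le]
      rintro _ ⟨i, rfl⟩
      fin_cases i
      · exact hvR
      · exact hwR
    have := Submodule.finrank_mono hle
    rwa [finrank_span_eq_card hli, Fintype.card_fin] at this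
  have h3 := three_le_finrank_orthogonal_top hT hE h2
  have hmap : (T.orthogonal ⊤).map t ≤ B.orthogonal (LinearMap.range s) := by
    rintro _ ⟨q, hq, rfl⟩
    exact (hR q).1 hq
  have hfs : Module.finrank k (B.orthogonal (LinearMap.range s)) = 2 := by
    have h := LinearMap.finrank_range_add_finrank_ker s
    rw [hs, finrank_span_singleton hv0] at h
    rw [LinearMap.BilinForm.finrank_orthogonal hB]
    omega
  have hft : 2 ≤ Module.finrank k ((T.orthogonal ⊤).map t) := by
    have h := LinearMap.finrank_range_add_finrank_ker (t.domRestrict (T.orthogonal ⊤))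
    have hker : Module.finrank k (LinearMap.ker (t.domRestrict (T.orthogonal ⊤))) ≤ 1 := by
      rw [← finrank_span_singleton (K := k) hw0, ← ht]
      let f : LinearMap.ker (t.domRestrict (T.orthogonal ⊤)) →ₗ[k] LinearMap.ker t :=
        LinearMap.codRestrict _ ((T.orthogonal ⊤).subtype ∘ₗ Submodule.subtype _) fun q => q.2
      refine LinearMap.finrank_le_finrank_of_injective (f := f) ?_
      intro a b hab
      exact Subtype.ext (Subtype.ext (congrArg (fun z : LinearMap.ker t => (z : E)) hab))
    rw [LinearMap.range_domRestrict] at h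
    omega
  -- The image of the radical under t has dimension at least 3 - 1, which is already the dimension 6
  -- - 4 of the orthogonal of im s.
  rw [← Submodule.eq_of_le_of_finrank_le hmap (by omega)]
  exact LinearMap.map_le_range

/-- A symplectic basis adapted to three mutually isotropic linear maps. -/
theorem exists_symplectic_basis_of_isotropic_net {B : LinearMap.BilinForm k V}
    (hB : B.Nondegenerate) (hBalt : B.IsAlt) (hE : Module.finrank k E = 5)
    (hV : Module.finrank k V = 6) {ι : Type*} {s : ι → E →ₗ[k] V}
    (hst : ∀ i j p, B (s i p) (s j p) = 0) {v : ι → E}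
    (hs : ∀ i, LinearMap.ker (s i) = Submodule.span k {v i})
    (hv0 : ∀ i, v i ≠ 0) (hv : ∀ i j, i ≠ j → v i ∉ Submodule.span k {v j})
    (hrange : ∀ i, ∃ j, s j (v i) ∉ LinearMap.range (s i)) :
    ∃ u w : ι → V, (∀ i p, B (s i p) (u i) = 0 ∧ B (s i p) (w i) = 0) ∧
      (∀ i, B (u i) (w i) = -1) ∧ ∀ i j, i ≠ j → B (u i) (u j) = 0 ∧ B (u i) (w j) = 0 ∧
        B (w i) (u j) = 0 ∧ B (w i) (w j) = 0 := by
  have key : ∀ i, ∃ u ∈ B.orthogonal (LinearMap.range (s i)),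
      ∃ w ∈ B.orthogonal (LinearMap.range (s i)), B u w = -1 := by
    intro i
    obtain ⟨j, hj⟩ := hrange i
    have hsi : s i (v i) = 0 := by
      rw [← LinearMap.mem_ker, hs]
      exact Submodule.mem_span_singleton_self _
    have hmem : s j (v i) ∈ B.orthogonal (LinearMap.range (s i)) := by
      rintro _ ⟨q, rfl⟩
      change B (s i q) (s j (v i)) = 0
      -- Polarization of the isotropy condition at v i, where s i vanishes.
      have h := hst i j (v i + q)
      simp only [map_add, hsi, hst, zero_add, add_zero] at h
      exact h
    have hne : ∃ w ∈ B.orthogonal (LinearMap.range (s i)), B w (s j (v i)) ≠ 0 := by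
      by_contra hcon
      push Not at hcon
      apply hj
      -- If s j (v i) were orthogonal to the whole plane (im s i)^⊥, it would lie in the double
      -- orthogonal im s i. So it has a partner in the plane, scaled below to pair to -1.
      rw [← LinearMap.BilinForm.orthogonal_orthogonal hB hBalt.isRefl (LinearMap.range (s i))]
      exact hcon
    obtain ⟨w, hw, hw0⟩ := hne
    refine ⟨_, hmem, (B w (s j (v i)))⁻¹ • w, Submodule.smul_mem _ _ hw, ?_⟩
    rw [map_smul, smul_eq_mul, ← neg_neg (B (s j (v i)) w), hBalt.neg_eq, mul_neg,
      inv_mul_cancel₀ hw0]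
  choose u hu w hw huw using key
  have hcross : ∀ i j, i ≠ j → ∀ a ∈ B.orthogonal (LinearMap.range (s i)),
      ∀ b ∈ B.orthogonal (LinearMap.range (s j)), B a b = 0 := by
    intro i j hij a ha b hb
    exact hb a (orthogonal_range_le_range hB hE hV (hst i j) (hs i) (hs j) (hv0 i)
      (hv j i hij.symm) ha)
  exact ⟨u, w, fun i p => ⟨hu i _ ⟨p, rfl⟩, hw i _ ⟨p, rfl⟩⟩, huw, fun i j hij =>
    ⟨hcross i j hij _ (hu i) _ (hu j), hcross i j hij _ (hu i) _ (hw j),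
      hcross i j hij _ (hw i) _ (hu j), hcross i j hij _ (hw i) _ (hw j)⟩⟩

-- Symplectic matrices adapted to nets of linear maps

theorem isAlt_toBilin'_J : (Matrix.toBilin' (J (Fin 3) ℂ)).IsAlt := by
  intro a
  rw [Matrix.toBilin'_apply', dotProduct_J_mulVec_self]

/-- The value -1 of the pairings is the upper right block of `J`, whose Gram matrix the columns must
reproduce. -/
theorem mem_symplecticGroup_of_columns {u w : Fin 3 → Fin 3 ⊕ Fin 3 → ℂ}
    (huw : ∀ i, u i ⬝ᵥ (J (Fin 3) ℂ *ᵥ w i) = -1)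
    (hij : ∀ i j, i ≠ j → u i ⬝ᵥ (J (Fin 3) ℂ *ᵥ u j) = 0 ∧ u i ⬝ᵥ (J (Fin 3) ℂ *ᵥ w j) = 0 ∧
      w i ⬝ᵥ (J (Fin 3) ℂ *ᵥ u j) = 0 ∧ w i ⬝ᵥ (J (Fin 3) ℂ *ᵥ w j) = 0) :
    (Matrix.of (Sum.elim u w))ᵀ ∈ symplecticGroup (Fin 3) ℂ := by
  rw [SymplecticGroup.mem_iff']
  ext i j
  have hval : ((Matrix.of (Sum.elim u w))ᵀᵀ * J (Fin 3) ℂ * (Matrix.of (Sum.elim u w))ᵀ) i j =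
      Sum.elim u w i ⬝ᵥ (J (Fin 3) ℂ *ᵥ Sum.elim u w j) := by
    rw [Matrix.mul_assoc]
    rfl
  rw [hval]
  have hwu : ∀ i, w i ⬝ᵥ (J (Fin 3) ℂ *ᵥ u i) = 1 := by
    intro i
    rw [dotProduct_J_mulVec_swap, huw, neg_neg]
  have hJ : ∀ i j, J (Fin 3) ℂ i j = fromBlocks 0 (-1) 1 0 i j := fun _ _ => rfl
  rw [hJ]
  rcases i with i | i <;> rcases j with j | j <;> rcases eq_or_ne i j with rfl | h <;>
    simp [dotProduct_J_mulVec_self, *]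

/-- Three mutually isotropic linear maps are put in a common normal form by a symplectic matrix. -/
theorem exists_symplectic_matrix_of_isotropic_net {s : Fin 3 → (Fin 5 → ℂ) →ₗ[ℂ] (Fin 3 ⊕ Fin 3 → ℂ)}
    (hst : ∀ i j p, s i p ⬝ᵥ (J (Fin 3) ℂ *ᵥ s j p) = 0) {v : Fin 3 → Fin 5 → ℂ}
    (hs : ∀ i, LinearMap.ker (s i) = Submodule.span ℂ {v i})
    (hv0 : ∀ i, v i ≠ 0) (hv : ∀ i j, i ≠ j → v i ∉ Submodule.span ℂ {v j})
    (hrange : ∀ i, ∃ j, s j (v i) ∉ LinearMap.range (s i)) :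
    ∃ M ∈ symplecticGroup (Fin 3) ℂ,
      ∀ i p, (s i p ᵥ* M) (Sum.inl i) = 0 ∧ (s i p ᵥ* M) (Sum.inr i) = 0 := by
  have hB : (Matrix.toBilin' (J (Fin 3) ℂ)).Nondegenerate :=
    LinearMap.BilinForm.nondegenerate_toBilin'_iff_det_ne_zero.2 (isUnit_det_J (Fin 3) ℂ).ne_zero
  obtain ⟨u, w, hsuw, huw, hij⟩ := exists_symplectic_basis_of_isotropic_net hB isAlt_toBilin'_J
    (by simp) (by simp) (s := s) (by simpa only [Matrix.toBilin'_apply'] using hst) hs hv0 hv hrange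
  simp only [Matrix.toBilin'_apply'] at hsuw huw hij
  -- The extra factor J turns the ordinary product of a row with a column into the symplectic
  -- pairing with u i or w i.
  refine ⟨J (Fin 3) ℂ * (Matrix.of (Sum.elim u w))ᵀ,
    mul_mem (SymplecticGroup.J_mem _ _) (mem_symplecticGroup_of_columns huw hij), fun i p => ?_⟩
  have hval : ∀ m, (s i p ᵥ* (J (Fin 3) ℂ * (Matrix.of (Sum.elim u w))ᵀ)) m =
      s i p ⬝ᵥ (J (Fin 3) ℂ *ᵥ Sum.elim u w m) := fun m => rfl
  rw [hval, hval]
  exact hsuw i p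

end Symplectic

/-! ## Normal form of the presentation -/

section NormalForm

open MvPolynomial Matrix

/-- The symmetry αβᵗ = βαᵗ is thereby isotropy of the rows for J, a condition stable under
symplectic column operations and arbitrary row operations. -/
theorem fromCols_mul_J_mul_transpose {R : Type*} [CommRing R] (α β : Matrix (Fin 3) (Fin 3) R) :
    Matrix.fromCols α β * J (Fin 3) R * (Matrix.fromCols α β)ᵀ = β * αᵀ - α * βᵀ := by
  rw [J, fromCols_mul_fromBlocks, transpose_fromCols, fromCols_mul_fromRows]
  simp [sub_eq_add_neg]

theorem mul_J_mul_transpose_eq_zero {R : Type*} [CommRing R] (Q : Matrix (Fin 3) (Fin 3) R)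
    {N : Matrix (Fin 3) (Fin 3 ⊕ Fin 3) R} {M : Matrix (Fin 3 ⊕ Fin 3) (Fin 3 ⊕ Fin 3) R}
    (hM : M * J (Fin 3) R * Mᵀ = J (Fin 3) R) (hN : N * J (Fin 3) R * Nᵀ = 0) :
    Q * N * M * J (Fin 3) R * (Q * N * M)ᵀ = 0 := by
  calc Q * N * M * J (Fin 3) R * (Q * N * M)ᵀ
      = Q * (N * (M * J (Fin 3) R * Mᵀ) * Nᵀ) * Qᵀ := by
        simp only [transpose_mul, Matrix.mul_assoc]
    _ = 0 := by rw [hM, hN, Matrix.mul_zero, Matrix.zero_mul]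

variable {K : Type*} [Field K] [Algebra ℂ K] {x : Fin 5 → K} {y : Fin 2 → K}
  {N : Matrix (Fin 3) (Fin 3 ⊕ Fin 3) CoordRing}

theorem linearValue_linearRow (hlin : ∀ i k, i ≠ 0 → (N i k).IsHomogeneous 1) (c : Fin 2 → ℂ)
    (p : Fin 5 → ℂ) (k : Fin 3 ⊕ Fin 3) :
    linearValue (linearRow N c) p k = eval p (linearRow N c k) :=
  linearValue_apply (isHomogeneous_linearRow hlin c) p k

/-- The linear rows vanishing at three improper double points. -/
theorem PresentsSections.exists_vanishing_rows (hN : PresentsSections x y N)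
    (hlin : ∀ i k, i ≠ 0 → (N i k).IsHomogeneous 1)
    (hJ : ∀ i j, N i ⬝ᵥ (J (Fin 3) CoordRing *ᵥ N j) = 0) (hx : LinearIndependent ℂ x)
    (hbir : IntermediateField.adjoin ℂ {z : K | ∃ i j, z = x i / x j} = ⊤)
    {ω : ⋀[K]^2 Ω[K⁄ℂ]} (hω : ω ≠ 0) (hy : PowersGenerated x y) {P : Fin 3 → P4}
    (hP : Function.Injective P)
    (hsing : ∀ p, IsSingularPoint (RingHom.ker (gradedHom x)) p → p ∈ Set.range P)
    (hdouble : ∀ i, IsImproperDoublePoint (RingHom.ker (gradedHom x)) (P i)) :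
    ∃ c : Fin 3 → Fin 2 → ℂ, c 2 = c 0 + c 1 ∧ c 0 0 * c 1 1 - c 0 1 * c 1 0 ≠ 0 ∧
      (∀ i, LinearMap.ker (linearValue (linearRow N (c i))) = Submodule.span ℂ {(P i).rep}) ∧
      ∀ i, ∃ j, linearValue (linearRow N (c j)) (P i).rep ∉
        LinearMap.range (linearValue (linearRow N (c i))) := by
  have hnil : ∀ i, ∀ l : CoordRing, l.IsHomogeneous 1 → eval (P i).rep l = 0 →
      ∃ H : CoordRing, eval (P i).rep H ≠ 0 ∧ H * l ∈ sectionConductor x y := fun i l hl hl0 =>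
    exists_mul_mem_sectionConductor hx hbir hω hy hP hsing i (hdouble i) hl hl0
  choose e he0 he using fun i => hN.exists_linearRow_eq_zero hx hJ (hdouble i)
  have hcompl : ∀ i, ∃ b : Fin 2 → ℂ, e i 0 * b 1 - e i 1 * b 0 ≠ 0 := by
    intro i
    by_contra hcon
    push Not at hcon
    apply he0 i
    have h0 := hcon ![0, 1]
    have h1 := hcon ![1, 0]
    simp at h0 h1
    funext a
    fin_cases a
    · exact h0
    · exact h1
  -- If e i and e j were proportional, row e i would vanish at P j as well, contradicting that it
  -- vanishes only at P i.
  have hpair : ∀ i j, i ≠ j → e i 0 * e j 1 - e i 1 * e j 0 ≠ 0 := by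
    intro i j hij hdet
    obtain ⟨b, hb⟩ := hcompl i
    refine rep_notMem_span_rep (hP.ne hij.symm) (hN.mem_span_of_linearValue_eq hlin (hnil i) hb
      (he i) (q := (P j).rep) (t := 0) fun k => ?_)
    have h := he j k
    rw [eval_linearRow] at h
    rw [eval_linearRow, zero_mul]
    have h0 : e j 0 * (e i 0 * eval (P j).rep (N 1 k) + e i 1 * eval (P j).rep (N 2 k)) = 0 := by
      linear_combination e i 0 * h - eval (P j).rep (N 2 k) * hdet
    have h1 : e j 1 * (e i 0 * eval (P j).rep (N 1 k) + e i 1 * eval (P j).rep (N 2 k)) = 0 := by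
      linear_combination e i 1 * h + eval (P j).rep (N 1 k) * hdet
    by_contra hne
    apply he0 j
    funext a
    fin_cases a
    · exact (mul_eq_zero.1 h0).resolve_right hne
    · exact (mul_eq_zero.1 h1).resolve_right hne
  have h01 := hpair 0 1 (by decide)
  have h21 := hpair 2 1 (by decide)
  have h02 := hpair 0 2 (by decide)
  set D := e 0 0 * e 1 1 - e 0 1 * e 1 0 with hD
  -- Cramer's rule for e 2 as a combination of e 0 and e 1; pairwise independence makes both
  -- coefficients nonzero.
  set a : Fin 3 → ℂ := ![(e 2 0 * e 1 1 - e 2 1 * e 1 0) / D, (e 0 0 * e 2 1 - e 0 1 * e 2 0) / D, 1]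
    with ha
  have ha0 : ∀ i, a i ≠ 0 := by
    intro i
    fin_cases i
    · exact div_ne_zero h21 h01
    · exact div_ne_zero h02 h01
    · exact one_ne_zero
  have hc : ∀ i k, eval (P i).rep (linearRow N (a i • e i) k) = 0 := by
    intro i k
    have h := he i k
    rw [eval_linearRow] at h ⊢
    simp only [Pi.smul_apply, smul_eq_mul]
    linear_combination a i * h
  have hcpair : ∀ i j, i ≠ j → (a i • e i) 0 * (a j • e j) 1 - (a i • e i) 1 * (a j • e j) 0 ≠ 0 := by
    intro i j hij
    have := mul_ne_zero (mul_ne_zero (ha0 i) (ha0 j)) (hpair i j hij)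
    simp only [Pi.smul_apply, smul_eq_mul]
    convert this using 1
    ring
  have hex : ∀ i : Fin 3, ∃ j, i ≠ j := by decide
  refine ⟨fun i => a i • e i, ?_, hcpair 0 1 (by decide), fun i => ?_, fun i => ?_⟩
  · funext m
    simp only [ha, Matrix.cons_val, Pi.add_apply, Pi.smul_apply, smul_eq_mul, one_mul]
    field_simp
    rw [hD]
    fin_cases m <;> simp <;> ring
  · obtain ⟨j, hij⟩ := hex i
    apply le_antisymm
    · intro q hq
      refine hN.mem_span_of_linearValue_eq hlin (hnil i) (hcpair i j hij) (hc i) (t := 0)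
        fun k => ?_
      rw [zero_mul, ← linearValue_linearRow hlin]
      exact congrFun hq k
    · rw [Submodule.span_singleton_le_iff_mem, LinearMap.mem_ker]
      funext k
      rw [linearValue_linearRow hlin]
      exact hc i k
  · obtain ⟨j, hij⟩ := hex i
    refine ⟨j, ?_⟩
    rintro ⟨q, hq⟩
    have hval : ∀ k, eval q (linearRow N (a i • e i) k) =
        eval (P i).rep (linearRow N (a j • e j) k) := by
      intro k
      rw [← linearValue_linearRow hlin, ← linearValue_linearRow hlin]
      exact congrFun hq k
    -- If row j at P i were the value of row i at q, then q would be a multiple of P i. Row i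
    -- vanishes there, so row j would vanish at P i, which is excluded.
    have hmem := hN.mem_span_of_linearValue_eq hlin (hnil i) (hcpair i j hij) (hc i) (t := 1)
      (q := q) fun k => by rw [one_mul, hval]
    obtain ⟨t, rfl⟩ := Submodule.mem_span_singleton.1 hmem
    refine rep_notMem_span_rep (hP.ne hij) (hN.mem_span_of_linearValue_eq hlin (hnil j)
      (hcpair j i hij.symm) (hc j) (q := (P i).rep) (t := 0) fun k => ?_)
    rw [zero_mul, ← hval, eval_smul_of_isHomogeneous (isHomogeneous_linearRow hlin _ k), hc,
      mul_zero]

theorem isHomogeneous_vecMul_constMatrix {ι κ : Type} [Fintype ι] {d : ℕ} {r : ι → CoordRing}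
    (hr : ∀ k, (r k).IsHomogeneous d) (M : Matrix ι κ ℂ) (m : κ) :
    ((r ᵥ* constMatrix M) m).IsHomogeneous d := by
  refine IsHomogeneous.sum _ _ _ fun k _ => ?_
  rw [mul_comm]
  exact (hr k).C_mul _

theorem eval_vecMul_constMatrix {ι κ : Type} [Fintype ι] (r : ι → CoordRing) (M : Matrix ι κ ℂ)
    (p : Fin 5 → ℂ) (m : κ) :
    eval p ((r ᵥ* constMatrix M) m) = ((fun k => eval p (r k)) ᵥ* M) m := by
  simp [vecMul, dotProduct, constMatrix]

theorem vecMul_constMatrix_mem_span {ι κ : Type} [Fintype ι] (r : ι → CoordRing) (M : Matrix ι κ ℂ)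
    (m : κ) : (r ᵥ* constMatrix M) m ∈ Submodule.span ℂ (Set.range r) := by
  refine Submodule.sum_mem _ fun k _ => ?_
  change r k * C (M k m) ∈ _
  rw [mul_comm, ← smul_eq_C_mul]
  exact Submodule.smul_mem _ _ (Submodule.subset_span ⟨k, rfl⟩)

theorem constMatrix_mem_symplecticGroup {M : Matrix (Fin 3 ⊕ Fin 3) (Fin 3 ⊕ Fin 3) ℂ}
    (hM : M ∈ symplecticGroup (Fin 3) ℂ) : constMatrix M ∈ symplecticGroup (Fin 3) CoordRing := by
  have h := SymplecticGroup.map_mem hM (C : ℂ →+* CoordRing)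
  exact h

/-- Symplectic normal form of the linear rows at three improper double points. -/
theorem PresentsSections.exists_normal_form (hN : PresentsSections x y N)
    (hlin : ∀ i k, i ≠ 0 → (N i k).IsHomogeneous 1)
    (hJ : ∀ i j, N i ⬝ᵥ (J (Fin 3) CoordRing *ᵥ N j) = 0) (hx : LinearIndependent ℂ x)
    (hbir : IntermediateField.adjoin ℂ {z : K | ∃ i j, z = x i / x j} = ⊤)
    {ω : ⋀[K]^2 Ω[K⁄ℂ]} (hω : ω ≠ 0) (hy : PowersGenerated x y) {P : Fin 3 → P4}
    (hP : Function.Injective P)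
    (hsing : ∀ p, IsSingularPoint (RingHom.ker (gradedHom x)) p → p ∈ Set.range P)
    (hdouble : ∀ i, IsImproperDoublePoint (RingHom.ker (gradedHom x)) (P i)) :
    ∃ c : Fin 3 → Fin 2 → ℂ, ∃ M ∈ symplecticGroup (Fin 3) ℂ,
      c 2 = c 0 + c 1 ∧ c 0 0 * c 1 1 - c 0 1 * c 1 0 ≠ 0 ∧
      (∀ i m, m = Sum.inl (![0, 2, 1] i) ∨ m = Sum.inr (![0, 2, 1] i) →
        (linearRow N (c i) ᵥ* constMatrix M) m = 0) ∧
      ∀ i p, (∀ m, eval p.rep ((linearRow N (c i) ᵥ* constMatrix M) m) = 0) ↔ p = P i := by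
  obtain ⟨c, hc2, hdet, hker, hrange⟩ :=
    hN.exists_vanishing_rows hlin hJ hx hbir hω hy hP hsing hdouble
  -- In the target matrix row c 0 vanishes in the first column pair, c 1 in the last, and c 2 = c 0
  -- + c 1 in the middle one.
  set σ : Fin 3 → Fin 3 := ![0, 2, 1] with hσ
  have hσσ : ∀ i, σ (σ i) = i := by decide
  have hiso : ∀ i j p, linearValue (linearRow N (c i)) p ⬝ᵥ
      (J (Fin 3) ℂ *ᵥ linearValue (linearRow N (c j)) p) = 0 := by
    intro i j p
    have h : linearRow N (c i) ⬝ᵥ (J (Fin 3) CoordRing *ᵥ linearRow N (c j)) = 0 := by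
      rw [linearRow_dotProduct]
      simp only [linearRow, mulVec_add, mulVec_smul, dotProduct_add, dotProduct_smul, hJ,
        smul_zero, add_zero, mul_zero]
    have h' := congrArg (eval p) h
    rw [map_dotProduct_eq, map_zero] at h'
    rw [← h']
    congr 1
    · funext k
      exact linearValue_linearRow hlin _ _ _
    · funext k
      rw [map_J_mulVec]
      congr 1
      funext k
      exact linearValue_linearRow hlin _ _ _
  obtain ⟨M, hM, hzero⟩ := exists_symplectic_matrix_of_isotropic_net
    (s := fun i => linearValue (linearRow N (c (σ i)))) (fun i j p => hiso _ _ p)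
    (v := fun i => (P (σ i)).rep) (fun i => hker _) (fun i => (P (σ i)).rep_nonzero)
    (fun i j hij => rep_notMem_span_rep
      (hP.ne fun h => hij (by rw [← hσσ i, h, hσσ])))
    (fun i => by
      obtain ⟨j, hj⟩ := hrange (σ i)
      exact ⟨σ j, by rwa [hσσ]⟩)
  have heval : ∀ i p m, eval p ((linearRow N (c i) ᵥ* constMatrix M) m) =
      (linearValue (linearRow N (c i)) p ᵥ* M) m := by
    intro i p m
    rw [eval_vecMul_constMatrix]
    congr 2
    funext k
    exact (linearValue_linearRow hlin _ _ _).symm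
  refine ⟨c, M, hM, hc2, hdet, fun i m hm => ?_, fun i p => ?_⟩
  · apply MvPolynomial.funext
    intro p
    rw [heval, map_zero]
    have := hzero (σ i) p
    simp only [hσσ] at this
    rcases hm with rfl | rfl
    · exact this.1
    · exact this.2
  · simp only [heval]
    have h1 : (∀ m, (linearValue (linearRow N (c i)) p.rep ᵥ* M) m = 0) ↔
        linearValue (linearRow N (c i)) p.rep = 0 := by
      have hunit : IsUnit M :=
        (Matrix.isUnit_iff_isUnit_det M).2 (SymplecticGroup.symplectic_det hM)
      constructor
      · intro h
        apply Matrix.vecMul_injective_of_isUnit hunit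
        simp only [zero_vecMul]
        exact funext h
      · intro h m
        rw [h, zero_vecMul]
        rfl
    rw [h1, ← LinearMap.mem_ker, hker]
    constructor
    · intro h
      by_contra hne
      exact rep_notMem_span_rep hne h
    · rintro rfl
      exact Submodule.mem_span_singleton_self _

end NormalForm

/-- The block form of a presentation with linear rows in symplectic normal form. -/
theorem exists_block_normal_form {α β : Matrix (Fin 3) (Fin 3) CoordRing}
    (hlin : ∀ i k, i ≠ 0 → (Matrix.fromCols α β i k).IsHomogeneous 1)
    (hcub : ∀ k, (Matrix.fromCols α β 0 k).IsHomogeneous 3)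
    (hNJ : Matrix.fromCols α β * Matrix.J (Fin 3) CoordRing * (Matrix.fromCols α β).transpose = 0)
    {P : Fin 3 → P4} {c : Fin 3 → Fin 2 → ℂ} {M : Matrix (Fin 3 ⊕ Fin 3) (Fin 3 ⊕ Fin 3) ℂ}
    (hM : M ∈ Matrix.symplecticGroup (Fin 3) ℂ) (hc2 : c 2 = c 0 + c 1)
    (hdet : c 0 0 * c 1 1 - c 0 1 * c 1 0 ≠ 0)
    (hzero : ∀ i m, m = Sum.inl (![0, 2, 1] i) ∨ m = Sum.inr (![0, 2, 1] i) →
      Matrix.vecMul (linearRow (Matrix.fromCols α β) (c i)) (constMatrix M) m = 0)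
    (hpt : ∀ i p, (∀ m, MvPolynomial.eval p.rep
      (Matrix.vecMul (linearRow (Matrix.fromCols α β) (c i)) (constMatrix M) m) = 0) ↔ p = P i) :
    ∃ (φ : GL (Fin 2) ℂ) (M : Matrix (Fin 3 ⊕ Fin 3) (Fin 3 ⊕ Fin 3) ℂ)
      (α' β' : Matrix (Fin 3) (Fin 3) CoordRing)
      (A B : Fin 3 → CoordRing) (a₂ a₃ a₄ b₂ b₃ b₄ : CoordRing),
      M ∈ Matrix.symplecticGroup (Fin 3) ℂ ∧
      constMatrix (rowBlock φ) * Matrix.fromCols α β * constMatrix M =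
        Matrix.fromCols α' β' ∧
      α' = !![A 0, A 1, A 2; 0, a₂, a₃; a₄, -a₂, 0] ∧
      β' = !![B 0, B 1, B 2; 0, b₂, b₃; b₄, -b₂, 0] ∧
      α' * β'.transpose = β' * α'.transpose ∧
      (∀ j, (A j).IsHomogeneous 3 ∧ (B j).IsHomogeneous 3 ∧
        A j ∈ Submodule.span ℂ (Set.range (α 0) ∪ Set.range (β 0)) ∧
        B j ∈ Submodule.span ℂ (Set.range (α 0) ∪ Set.range (β 0))) ∧
      (∀ l ∈ [a₂, a₃, a₄, b₂, b₃, b₄], l.IsHomogeneous 1) ∧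
      projZeros {a₂, a₃, b₂, b₃} = {P 0} ∧
      projZeros {a₄, a₂, b₄, b₂} = {P 1} ∧
      projZeros {a₄, a₃, b₄, b₃} = {P 2} := by
  set N := Matrix.fromCols α β with hNdef
  let φ : GL (Fin 2) ℂ := Matrix.GeneralLinearGroup.mkOfDetNeZero
    !![c 0 0, c 0 1; c 1 0, c 1 1] (by rwa [Matrix.det_fin_two_of])
  set T : Fin 3 → Fin 3 ⊕ Fin 3 → CoordRing := fun i =>
    Matrix.vecMul (linearRow N (c i)) (constMatrix M) with hT
  set A : Fin 3 ⊕ Fin 3 → CoordRing := Matrix.vecMul (N 0) (constMatrix M) with hA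
  have hT2 : ∀ m, T 2 m = T 0 m + T 1 m := by
    intro m
    have : linearRow N (c 2) = linearRow N (c 0) + linearRow N (c 1) := by
      rw [hc2]
      simp only [linearRow, Pi.add_apply, map_add, add_smul]
      abel
    simp only [hT]
    rw [this, Matrix.add_vecMul]
    rfl
  have z0l : T 0 (Sum.inl 0) = 0 := hzero 0 _ (Or.inl rfl)
  have z0r : T 0 (Sum.inr 0) = 0 := hzero 0 _ (Or.inr rfl)
  have z1l : T 1 (Sum.inl 2) = 0 := hzero 1 _ (Or.inl rfl)
  have z1r : T 1 (Sum.inr 2) = 0 := hzero 1 _ (Or.inr rfl)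
  have z2l : T 2 (Sum.inl 1) = 0 := hzero 2 _ (Or.inl rfl)
  have z2r : T 2 (Sum.inr 1) = 0 := hzero 2 _ (Or.inr rfl)
  -- The sum of the two rows vanishes in the middle column pair; this is the origin of the entries
  -- -a₂ and -b₂.
  have e1l : T 1 (Sum.inl 1) = -T 0 (Sum.inl 1) := by
    rw [hT2] at z2l
    linear_combination z2l
  have e1r : T 1 (Sum.inr 1) = -T 0 (Sum.inr 1) := by
    rw [hT2] at z2r
    linear_combination z2r
  have hrows : constMatrix (rowBlock φ) * N = Matrix.of ![N 0, linearRow N (c 0), linearRow N (c 1)] := by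
    ext1 i k
    rw [Matrix.mul_apply, Fin.sum_univ_three]
    fin_cases i <;> simp [constMatrix, rowBlock, linearRow, φ]
  have hprod : constMatrix (rowBlock φ) * N * constMatrix M = Matrix.fromCols
      !![A (Sum.inl 0), A (Sum.inl 1), A (Sum.inl 2); 0, T 0 (Sum.inl 1), T 0 (Sum.inl 2);
        T 1 (Sum.inl 0), -T 0 (Sum.inl 1), 0]
      !![A (Sum.inr 0), A (Sum.inr 1), A (Sum.inr 2); 0, T 0 (Sum.inr 1), T 0 (Sum.inr 2);
        T 1 (Sum.inr 0), -T 0 (Sum.inr 1), 0] := by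
    rw [hrows]
    ext1 i k
    have hi : (Matrix.of ![N 0, linearRow N (c 0), linearRow N (c 1)] * constMatrix M) i k =
        ![A, T 0, T 1] i k := by
      fin_cases i <;> rfl
    rw [hi]
    clear_value T A
    rcases k with k | k <;> fin_cases i <;> fin_cases k <;>
      first
        | rfl
        | exact z0l
        | exact z0r
        | exact z1l
        | exact z1r
        | exact e1l
        | exact e1r
  have hTlin : ∀ i m, (T i m).IsHomogeneous 1 := fun i m =>
    isHomogeneous_vecMul_constMatrix (isHomogeneous_linearRow hlin (c i)) M m
  have hAcub : ∀ m, (A m).IsHomogeneous 3 := isHomogeneous_vecMul_constMatrix hcub M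
  have hAspan : ∀ m, A m ∈ Submodule.span ℂ (Set.range (α 0) ∪ Set.range (β 0)) := by
    intro m
    refine Submodule.span_mono ?_ (vecMul_constMatrix_mem_span (N 0) M m)
    rintro _ ⟨k | k, rfl⟩
    · exact Or.inl ⟨k, rfl⟩
    · exact Or.inr ⟨k, rfl⟩
  have hsym : constMatrix (rowBlock φ) * N * constMatrix M * Matrix.J (Fin 3) CoordRing *
      (constMatrix (rowBlock φ) * N * constMatrix M).transpose = 0 :=
    mul_J_mul_transpose_eq_zero _
      (SymplecticGroup.mem_iff.1 (constMatrix_mem_symplecticGroup hM)) hNJ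
  replace hpt : ∀ i p, (∀ m, MvPolynomial.eval p.rep (T i m) = 0) ↔ p = P i := hpt
  clear_value T A
  refine ⟨φ, M, _, _, A ∘ Sum.inl, A ∘ Sum.inr, T 0 (Sum.inl 1), T 0 (Sum.inl 2), T 1 (Sum.inl 0),
    T 0 (Sum.inr 1), T 0 (Sum.inr 2), T 1 (Sum.inr 0), hM, hprod, ?_⟩
  refine ⟨rfl, rfl, ?_, ?_, ?_, ?_, ?_, ?_⟩
  · rw [eq_comm, ← sub_eq_zero, ← fromCols_mul_J_mul_transpose, ← hprod]
    exact hsym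
  · exact fun j => ⟨hAcub _, hAcub _, hAspan _, hAspan _⟩
  · simp only [List.forall_mem_cons, hTlin, true_and]
    simp
  · ext p
    rw [Set.mem_singleton_iff, ← hpt 0 p]
    simp [projZeros, Fin.forall_fin_succ, z0l, z0r, and_assoc]
  · ext p
    rw [Set.mem_singleton_iff, ← hpt 1 p]
    simp [projZeros, Fin.forall_fin_succ, z1l, z1r, e1l, e1r, and_assoc]
  -- The third set of equations comes from the row c 2, which is not a row of the matrix but the sum
  -- of its last two.
  · ext p
    rw [Set.mem_singleton_iff, ← hpt 2 p]
    simp [projZeros, Fin.forall_fin_succ, hT2, z0l, z0r, z1l, z1r, e1l, e1r, and_assoc]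

theorem lemma2p1 (S : ComplexSurface) (ω : S.RatTwoForm) (hω : ω ≠ 0)
    (x : Module.Basis (Fin 5) ℂ (S.pluricanonical ω 1)) (hcan : S.IsCanonical ω x)
    (hq : S.IsRegularSurface) (hK : S.CanonicalSelfIntersection ω 11)
    (α β : Matrix (Fin 3) (Fin 3) CoordRing) (hres : S.IsResolution ω x α β)
    (P : Fin 3 → P4) (hP : Function.Injective P)
    (hsing : {p | IsSingularPoint (S.imageIdeal ω x) p} = Set.range P)
    (hdouble : ∀ i, IsImproperDoublePoint (S.imageIdeal ω x) (P i)) :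
    ∃ (φ : GL (Fin 2) ℂ) (M : Matrix (Fin 3 ⊕ Fin 3) (Fin 3 ⊕ Fin 3) ℂ)
      (α' β' : Matrix (Fin 3) (Fin 3) CoordRing)
      (A B : Fin 3 → CoordRing) (a₂ a₃ a₄ b₂ b₃ b₄ : CoordRing),
      M ∈ Matrix.symplecticGroup (Fin 3) ℂ ∧
      constMatrix (rowBlock φ) * Matrix.fromCols α β * constMatrix M =
        Matrix.fromCols α' β' ∧
      α' = !![A 0, A 1, A 2; 0, a₂, a₃; a₄, -a₂, 0] ∧
      β' = !![B 0, B 1, B 2; 0, b₂, b₃; b₄, -b₂, 0] ∧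
      α' * β'.transpose = β' * α'.transpose ∧
      (∀ j, (A j).IsHomogeneous 3 ∧ (B j).IsHomogeneous 3 ∧
        A j ∈ Submodule.span ℂ (Set.range (α 0) ∪ Set.range (β 0)) ∧
        B j ∈ Submodule.span ℂ (Set.range (α 0) ∪ Set.range (β 0))) ∧
      (∀ l ∈ [a₂, a₃, a₄, b₂, b₃, b₄], l.IsHomogeneous 1) ∧
      projZeros {a₂, a₃, b₂, b₃} = {P 0} ∧
      projZeros {a₄, a₂, b₄, b₂} = {P 1} ∧
      projZeros {a₄, a₃, b₄, b₃} = {P 2} := by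
  obtain ⟨y₁, -, y₂, -, hexact, hrange⟩ := hres.exact_right
  set ξ : Fin 5 → S.K := fun i => (x i : S.K) with hξ
  set N := Matrix.fromCols α β with hNdef
  have hN : PresentsSections ξ ![y₁, y₂] N := hexact
  have hξli : LinearIndependent ℂ ξ :=
    x.linearIndependent.map' (S.pluricanonical ω 1).subtype (Submodule.ker_subtype _)
  have hlin : ∀ i k, i ≠ 0 → (N i k).IsHomogeneous 1 := by
    rintro i (k | k) hi
    · exact hres.linear_α i k hi
    · exact hres.linear_β i k hi
  have hcub : ∀ k, (N 0 k).IsHomogeneous 3 := by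
    rintro (k | k)
    · exact hres.cubic_α k
    · exact hres.cubic_β k
  have hNJ : N * Matrix.J (Fin 3) CoordRing * N.transpose = 0 := by
    rw [hNdef, fromCols_mul_J_mul_transpose]
    -- Isotropy of the rows is the fact that consecutive maps of the resolution compose to zero.
    have h : N * Matrix.fromRows (-β.transpose) α.transpose = 0 := by
      refine Matrix.ext_of_mulVec_single fun i => ?_
      rw [← Matrix.mulVec_mulVec, Matrix.zero_mulVec]
      exact (hres.exact_middle _).2 ⟨_, rfl⟩
    rw [hNdef, Matrix.fromCols_mul_fromRows, Matrix.mul_neg, neg_add_eq_sub] at h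
    exact h
  have hJ : ∀ i j, N i ⬝ᵥ (Matrix.J (Fin 3) CoordRing).mulVec (N j) = 0 := by
    intro i j
    rw [Matrix.mul_assoc] at hNJ
    exact congrFun (congrFun hNJ i) j
  -- The canonical ring is closed under products and generated as a module by 1, y₁, y₂, so it
  -- contains all powers of the y's.
  have hy : PowersGenerated ξ ![y₁, y₂] := by
    intro i n
    have hmem : Polynomial.monomial 2 (![y₁, y₂] i) ∈ S.canonicalRing ω := by
      rw [← SetLike.mem_coe, ← hrange]
      fin_cases i
      · exact ⟨![0, 1, 0], by simp⟩
      · exact ⟨![0, 0, 1], by simp⟩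
    have hpow := pow_mem hmem n
    rw [← SetLike.mem_coe, ← hrange] at hpow
    obtain ⟨c, hc⟩ := hpow
    exact ⟨c, hc.symm⟩
  obtain ⟨c, M, hM, hc2, hdet, hzero, hpt⟩ := hN.exists_normal_form hlin hJ hξli hcan.birational hω
    hy hP (fun p hp => hsing ▸ hp) hdouble
  exact exists_block_normal_form hlin hcub hNJ hM hc2 hdet hzero hpt
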